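/- **Setting.** Let $d\ge 1$, let $\Theta\subseteq\mathbb R^d$ be compact, let $\{p(y|x,\theta):\theta\in\Theta\}$ be positive conditional probability densities on a label space $\mathcal Y$ (with respect to a fixed reference measure), and put $\ell(y|x,\theta)=-\log p(y|x,\theta)$. At each time $t=1,2,\dots$ there are a finite nonempty pool $\mathcal S_t$ of samples and a true parameter $\theta_t^*\in\operatorname{int}\Theta$, with $\|\theta_t^*-\theta_{t-1}^*\|\le\rho$ for $t\ge2$. Let $U_t$ be the uniform distribution on $\mathcal S_t$, and let $$L_{U_t}(\theta)=\mathbb E_{X\sim U_t,\,Y\sim p(\cdot|X,\theta_t^*)}[\ell(Y|X,\theta)],$$ which is assumed to exist for $\theta\in\Theta$. Write $\|v\|_A=\sqrt{v^\top Av}$, let $\|\cdot\|$ be the spectral norm for matrices, and for a distribution $\Gamma$ on $\mathcal S_t$ let $I_\Gamma(\theta)=\mathbb E_{X\sim\Gamma}[H(X,\theta)]$, where $H$ is as follows. **Assumptions.** 1. $H(x,\theta)=\partial^2\ell(y|x,\theta)/\partial\theta^2$ does not depend on $y$, for $\theta\in\operatorname{int}\Theta$. 2. $\ell(y|x,\cdot)$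 is continuous on $\Theta$ and has first, second and third derivatives on $\operatorname{int}\Theta$. 3. For all $t\ge1$ and $\theta\in\operatorname{int}\Theta$: $I_{U_t}(\theta)\succeq mI$ with $m>0$, and the largest eigenvalue of $I_{U_t}(\theta)$ is at most $L_b$. 4. For all $t\ge1$ and $x\in\mathcal S_t$: $\|\nabla\ell(Y|x,\theta_t^*)\|_{I_{U_t}(\theta_t^*)^{-1}}\le L_1$ almost surely for $Y\sim p(\cdot|x,\theta_t^*)$, and $\|I_{U_t}(\theta_t^*)^{-1/2}H(x,\theta_t^*)I_{U_t}(\theta_t^*)^{-1/2}\|\le L_2$. 5. For all $t\ge1$ there is a neighborhood $B_t$ of $\theta_t^*$ with $$\|I_{U_t}(\theta_t^*)^{-1/2}(H(x,\theta)-H(x,\theta'))I_{U_t}(\theta_t^*)^{-1/2}\|\le L_3\|\theta-\theta'\|_{I_{U_t}(\theta_t^*)}$$ for all $x\in\mathcal S_t$ and $\theta,\theta'\in B_t\cap\operatorname{int}\Theta$. **Lemma.** There are universal constants $c,c'>0$ such that the following holds under these assumptions. Let $t\ge2$, let $\Theta_t=\{\theta\in\Theta:\|\theta-\theta_{t-1}^*\|\le\rho\}$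 be convex, and let $r>0$ be such that $$\{\theta:\|\theta-\theta_t^*\|_{I_{U_t}(\theta_t^*)}<r\}\subseteq B_t\cap\Theta_t$$ (so that $\theta_t^*$ is an interior point of $\Theta_t$). Let $\Gamma_t$ be any distribution on $\mathcal S_t$ with $I_{\Gamma_t}(\theta_t^*)\succeq C\,I_{U_t}(\theta_t^*)$ for some $0<C<1$. Let $K_t\ge1$ be so large that $$\gamma_t:=\frac{c}{C^2}\bigl(L_1L_3+\sqrt{L_2}\bigr)\sqrt{\frac{\log (dK_t)}{K_t}}<1\qquad\text{and}\qquad L_1\sqrt{\frac{\log (dK_t)}{K_t}}\le c'\,C\,r.$$ Let $(X_k,Y_k)$, $1\le k\le K_t$, be i.i.d. with $X_k\sim\Gamma_t$ and $Y_k\sim p(\cdot|X_k,\theta_t^*)$, and let $\hat\theta_{\Gamma_t}$ be a (measurable) minimizer over $\Theta_t$ of $\frac1{K_t}\sum_{k=1}^{K_t}\ell(Y_k|X_k,\theta)$. Then $L_{U_t}(\hat\theta_{\Gamma_t})-L_{U_t}(\theta_t^*)$ is integrable and $$(1-\gamma_t)\frac{\tau_t^2}{K_t}-\frac{L_1^2}{CK_t^2}\;\le\;\mathbb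 E\bigl[L_{U_t}(\hat\theta_{\Gamma_t})-L_{U_t}(\theta_t^*)\bigr]\;\le\;(1+\gamma_t)\frac{\tau_t^2}{K_t}+\frac{2L_b\rho^2}{K_t^2},$$ where $\tau_t^2=\frac12\operatorname{Tr}\bigl(I_{\Gamma_t}(\theta_t^*)^{-1}I_{U_t}(\theta_t^*)\bigr)$. -/

import Mathlib

open MeasureTheory ProbabilityTheory
open scoped Matrix

noncomputable section

/-- The Hessian matrix `∂²f/∂θ²` of `f : ℝ^d → ℝ` at `θ`. -/
def hessianMatrix {d : ℕ} (f : EuclideanSpace ℝ (Fin d) → ℝ) (θ : EuclideanSpace ℝ (Fin d)) :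
    Matrix (Fin d) (Fin d) ℝ :=
  Matrix.of fun i j =>
    fderiv ℝ (fderiv ℝ f) θ (EuclideanSpace.single i 1) (EuclideanSpace.single j 1)

/-- The first, second and third derivatives of `f` exist at all points of the open set `s`. -/
def ThreeTimesDifferentiableOn {d : ℕ} (f : EuclideanSpace ℝ (Fin d) → ℝ)
    (s : Set (EuclideanSpace ℝ (Fin d))) : Prop :=
  (∀ θ ∈ s, DifferentiableAt ℝ f θ) ∧
  (∀ θ ∈ s, DifferentiableAt ℝ (fderiv ℝ f) θ) ∧
  (∀ θ ∈ s, DifferentiableAt ℝ (fderiv ℝ (fderiv ℝ f)) θ)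

/-- The weighted norm `‖v‖_A = √(vᵀ A v)`. -/
def weightedNorm {d : ℕ} (A : Matrix (Fin d) (Fin d) ℝ) (v : EuclideanSpace ℝ (Fin d)) : ℝ :=
  √(v.ofLp ⬝ᵥ A *ᵥ v.ofLp)

/-- The spectral norm (the operator norm for the Euclidean norm) of a square matrix. -/
def spectralNorm₂ {d : ℕ} (A : Matrix (Fin d) (Fin d) ℝ) : ℝ :=
  ‖Matrix.toEuclideanCLM (n := Fin d) (𝕜 := ℝ) A‖

/-- The inverse square root `A^{-1/2}` of a symmetric positive definite matrix, obtained by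
applying `s ↦ 1/√s` to the eigenvalues. -/
def invSqrt {d : ℕ} (A : Matrix (Fin d) (Fin d) ℝ) : Matrix (Fin d) (Fin d) ℝ :=
  cfc (fun s : ℝ => (√s)⁻¹) A

/-- A parametrized family `{p(y|x,θ) : θ ∈ Θ}`, `Θ ⊆ ℝ^d`, of positive conditional probability
densities on the label space `𝒴` with respect to a reference measure. -/
structure LabelModel (𝒳 𝒴 : Type*) [MeasurableSpace 𝒴] (d : ℕ) where
  /-- the parameter space -/
  Θ : Set (EuclideanSpace ℝ (Fin d))
  /-- the reference measure on labels -/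
  ν : Measure 𝒴
  /-- the density `p(y|x,θ)` -/
  p : 𝒴 → 𝒳 → EuclideanSpace ℝ (Fin d) → ℝ
  p_measurable : ∀ x, ∀ θ ∈ Θ, Measurable fun y => p y x θ
  p_pos : ∀ y x, ∀ θ ∈ Θ, 0 < p y x θ
  p_lintegral : ∀ x, ∀ θ ∈ Θ, ∫⁻ y, ENNReal.ofReal (p y x θ) ∂ν = 1

namespace LabelModel

variable {𝒳 𝒴 : Type*} [MeasurableSpace 𝒴] {d : ℕ} (M : LabelModel 𝒳 𝒴 d)

/-- The loss `ℓ(y|x,θ) = -log p(y|x,θ)`. -/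
def loss (y : 𝒴) (x : 𝒳) (θ : EuclideanSpace ℝ (Fin d)) : ℝ := -Real.log (M.p y x θ)

/-- The law `p(·|x,θ)` of the label of `x` under the parameter `θ`. -/
def labelLaw (x : 𝒳) (θ : EuclideanSpace ℝ (Fin d)) : Measure 𝒴 :=
  M.ν.withDensity fun y => ENNReal.ofReal (M.p y x θ)

/-- The joint law of (position in the pool, label) when the position is drawn from the weights `Γ`
on a finite pool `x` and the label of the chosen sample from `p(·|x i,θ)`. -/
def sampleLaw {N : ℕ} (x : Fin N → 𝒳) (Γ : Fin N → ℝ) (θ : EuclideanSpace ℝ (Fin d)) :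
    Measure (Fin N × 𝒴) :=
  ∑ i, ENNReal.ofReal (Γ i) • (M.labelLaw (x i) θ).map (Prod.mk i)

end LabelModel

/-- The uniform weights on a pool of `N` samples. -/
def uniformWeights (N : ℕ) : Fin N → ℝ := fun _ => 1 / N

/-- The Fisher information `I_Γ(θ) = E_{X ∼ Γ} H(X,θ)` for weights `Γ` on a finite pool `x`. -/
def fisherInfo {𝒳 : Type*} {d N : ℕ}
    (H : 𝒳 → EuclideanSpace ℝ (Fin d) → Matrix (Fin d) (Fin d) ℝ) (x : Fin N → 𝒳) (Γ : Fin N → ℝ)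
    (θ : EuclideanSpace ℝ (Fin d)) : Matrix (Fin d) (Fin d) ℝ :=
  ∑ i, Γ i • H (x i) θ

/-- A sequence of learning tasks at the times `t = 1, 2, …` over one model: finite nonempty pools of
unlabeled samples, and true parameters in `Θ` which move by at most `ρ` per time step. -/
structure TaskSequence (𝒳 𝒴 : Type*) [MeasurableSpace 𝒴] (d : ℕ) extends LabelModel 𝒳 𝒴 d where
  /-- size of the pool at time `t` -/
  N : ℕ → ℕ
  /-- the pool at time `t` -/
  pool : (t : ℕ) → Fin (N t) → 𝒳
  /-- the true parameter at time `t` -/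
  θstar : ℕ → EuclideanSpace ℝ (Fin d)
  /-- bound on the change of the true parameter -/
  ρ : ℝ
  N_pos : ∀ t, 1 ≤ t → 0 < N t
  θstar_mem : ∀ t, 1 ≤ t → θstar t ∈ Θ
  drift : ∀ t, 2 ≤ t → ‖θstar t - θstar (t - 1)‖ ≤ ρ

namespace TaskSequence

variable {𝒳 𝒴 : Type*} [MeasurableSpace 𝒴] {d : ℕ} (T : TaskSequence 𝒳 𝒴 d)

/-- The law of one (position, label) pair at time `t` under the sampling distribution `Γ`. -/
def dataLaw (t : ℕ) (Γ : Fin (T.N t) → ℝ) : Measure (Fin (T.N t) × 𝒴) :=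
  T.sampleLaw (T.pool t) Γ (T.θstar t)

/-- The expected loss `L_{U_t}(θ)` under uniform sampling from the pool. -/
def risk (t : ℕ) (θ : EuclideanSpace ℝ (Fin d)) : ℝ :=
  ∫ z, T.loss z.2 (T.pool t z.1) θ ∂(T.dataLaw t (uniformWeights (T.N t)))

/-- The matrix `I_{Γ_t}(θ)`. -/
def info (H : 𝒳 → EuclideanSpace ℝ (Fin d) → Matrix (Fin d) (Fin d) ℝ) (t : ℕ)
    (Γ : Fin (T.N t) → ℝ) (θ : EuclideanSpace ℝ (Fin d)) : Matrix (Fin d) (Fin d) ℝ :=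
  fisherInfo H (T.pool t) Γ θ

/-- The matrix `I_{U_t}(θ)`. -/
def infoU (H : 𝒳 → EuclideanSpace ℝ (Fin d) → Matrix (Fin d) (Fin d) ℝ) (t : ℕ)
    (θ : EuclideanSpace ℝ (Fin d)) : Matrix (Fin d) (Fin d) ℝ :=
  T.info H t (uniformWeights (T.N t)) θ

/-- The parameter set `Θ_t`: parameters at distance at most `ρ` from the previous true parameter. -/
def paramSet (t : ℕ) : Set (EuclideanSpace ℝ (Fin d)) :=
  {θ | θ ∈ T.Θ ∧ ‖θ - T.θstar (t - 1)‖ ≤ T.ρ}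

/-- The empirical risk of `θ` on the labeled data `z`. -/
def empRisk (t : ℕ) {K : ℕ} (z : Fin K → Fin (T.N t) × 𝒴) (θ : EuclideanSpace ℝ (Fin d)) : ℝ :=
  (1 / (K : ℝ)) * ∑ k, T.loss (z k).2 (T.pool t (z k).1) θ

/-- The Hessian of the loss depends only on `x` and `θ`, and equals `H x θ`. -/
def HessianEq (H : 𝒳 → EuclideanSpace ℝ (Fin d) → Matrix (Fin d) (Fin d) ℝ) : Prop :=
  ∀ x y, ∀ θ ∈ interior T.Θ, hessianMatrix (T.loss y x) θ = H x θ

/-- The regularity conditions on the loss, with constants `m, L_b, L₁, L₂, L₃` common to all times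
and neighborhoods `B t` of the true parameters. Derivatives are only used at interior points
of `Θ`. -/
structure Regular (H : 𝒳 → EuclideanSpace ℝ (Fin d) → Matrix (Fin d) (Fin d) ℝ)
    (m Lb L₁ L₂ L₃ : ℝ) (B : ℕ → Set (EuclideanSpace ℝ (Fin d))) : Prop where
  compact : IsCompact T.Θ
  interior_mem : ∀ t, 1 ≤ t → T.θstar t ∈ interior T.Θ
  continuousOn : ∀ x y, ContinuousOn (T.loss y x) T.Θ
  smooth : ∀ x y, ThreeTimesDifferentiableOn (T.loss y x) (interior T.Θ)
  /-- the expected losses exist -/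
  integrable : ∀ t, 1 ≤ t → ∀ θ ∈ T.Θ,
    Integrable (fun z : Fin (T.N t) × 𝒴 => T.loss z.2 (T.pool t z.1) θ)
      (T.dataLaw t (uniformWeights (T.N t)))
  m_pos : 0 < m
  strongConvex : ∀ t, 1 ≤ t → ∀ θ ∈ interior T.Θ,
    (T.infoU H t θ - m • (1 : Matrix (Fin d) (Fin d) ℝ)).PosSemidef
  /-- every eigenvalue of `I_{U_t}(θ)` is at most `L_b` -/
  bounded : ∀ t, 1 ≤ t → ∀ θ ∈ interior T.Θ, ∀ μ ∈ spectrum ℝ (T.infoU H t θ), μ ≤ Lb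
  gradient_le : ∀ t, 1 ≤ t → ∀ i, ∀ᵐ y ∂(T.labelLaw (T.pool t i) (T.θstar t)),
    weightedNorm (T.infoU H t (T.θstar t))⁻¹ (gradient (T.loss y (T.pool t i)) (T.θstar t)) ≤ L₁
  hessian_le : ∀ t, 1 ≤ t → ∀ i,
    spectralNorm₂ (invSqrt (T.infoU H t (T.θstar t)) * H (T.pool t i) (T.θstar t) *
      invSqrt (T.infoU H t (T.θstar t))) ≤ L₂
  nhds_mem : ∀ t, 1 ≤ t → B t ∈ nhds (T.θstar t)
  lipschitz : ∀ t, 1 ≤ t → ∀ i, ∀ θ ∈ B t ∩ interior T.Θ, ∀ θ' ∈ B t ∩ interior T.Θ,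
    spectralNorm₂ (invSqrt (T.infoU H t (T.θstar t)) * (H (T.pool t i) θ - H (T.pool t i) θ') *
      invSqrt (T.infoU H t (T.θstar t))) ≤ L₃ * weightedNorm (T.infoU H t (T.θstar t)) (θ - θ')

end TaskSequence

/-- `Z 0, …, Z (K-1)` are independent random variables with common law `μ`. -/
def IsIIDSample {Ω S : Type*} [MeasurableSpace Ω] [MeasurableSpace S] {K : ℕ} (P : Measure Ω)
    (μ : Measure S) (Z : Fin K → Ω → S) : Prop :=
  (∀ k, Measurable (Z k)) ∧ (∀ k, P.map (Z k) = μ) ∧ iIndepFun Z P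

/-- `γ = (c / C²) (L₁ L₃ + √L₂) √(log(dK)/K)`. -/
def gammaRate (c C L₁ L₂ L₃ : ℝ) (d K : ℕ) : ℝ :=
  c / C ^ 2 * (L₁ * L₃ + √L₂) * √(Real.log (d * K) / K)

/-- `τ_t² = ½ Tr(I_{Γ_t}⁻¹(θ_t*) I_{U_t}(θ_t*))`. -/
def tauSq {𝒳 𝒴 : Type*} [MeasurableSpace 𝒴] {d : ℕ} (T : TaskSequence 𝒳 𝒴 d)
    (H : 𝒳 → EuclideanSpace ℝ (Fin d) → Matrix (Fin d) (Fin d) ℝ) (t : ℕ)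
    (Γ : Fin (T.N t) → ℝ) : ℝ :=
  1 / 2 * ((T.info H t Γ (T.θstar t))⁻¹ * T.infoU H t (T.θstar t)).trace

end

/-! ### The Golden–Thompson inequality -/

namespace GoldenThompson

open Filter Topology NormedSpace

variable {n : Type*} [Fintype n]

/-! Since the Hessian of the loss does not see the label, losses with different labels differ on
`Θ_t` by an affine function. Hence ℓ(y|x,θ) = ℓ(y|x,θ*) + ⟨score(y), θ − θ*⟩ + F_x(θ) with F_x
independent of y (`loss_eq_add_cumulant`): each x carries an exponential family with cumulant
function F_x. That the densities integrate to one says E exp(−⟨score, θ − θ*⟩) = exp F_x(θ). From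
this follow Bartlett's identities (`score_moments`: mean zero, covariance H(x,θ*)), F_x ≥ 0, and
convexity of F_x along rays from θ*. The excess risk is the average of F_x over the pool
(`risk_sub_eq`).

In coordinates scaled by I_U(θ*)^{-1/2} the averaged Hessian is the identity, so the excess risk is
nearly ‖v‖²/2; this is `NormalizedModel`. Fix the sampled positions. Then the summed Hessian S is
deterministic, the summed score γ is a sum of independent centred bounded vectors, and its
covariance is S. Let G be the scaled I_Γ(θ*). Matrix Chernoff (via Golden–Thompson) gives S ⪰ (1 −
ε)KG, and Pinelis' inequality bounds ‖γ‖, each with failure probability O(K⁻⁴). When both hold, the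
minimiser lies in a small ball, is relatively close to the Newton step −S⁻¹γ, and has excess risk (1
± 8η)‖S⁻¹γ‖²/2 (`value_bounds`).

Without the restriction on γ, E‖S⁻¹γ‖² = tr S⁻¹ for fixed positions. From above, tr S⁻¹ ≤ tr G⁻¹/((1
− ε)K). From below, the tangent inequality for S ↦ tr S⁻¹ at KG is linear in S and can be averaged,
with E S = KG; this is Jensen's inequality, and it needs no upper bound on S. On the exceptional
event the excess risk lies between 0 and 2 L_b ρ². The upper bound pays for it with 2 L_b ρ²/K²,
while the lower bound drops the event and pays only for the lost part of ‖S⁻¹γ‖², at most L₁²/(CK²)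
(`excess_bounds`). -/

lemma trace_mul_le_half (X Y : Matrix n n ℝ) :
    (X * Y).trace ≤ ((X * Xᴴ).trace + (Yᴴ * Y).trace) / 2 := by
  have h : 0 ≤ ((X - Yᴴ) * (X - Yᴴ)ᴴ).trace :=
    (Matrix.posSemidef_self_mul_conjTranspose _).trace_nonneg
  have e1 : (Yᴴ * Xᴴ).trace = (X * Y).trace := by
    rw [← Matrix.conjTranspose_mul, Matrix.trace_conjTranspose]; simp
  have e2 : (Yᴴ * Y).trace = (Yᴴ * Yᴴᴴ).trace := by simp
  simp only [Matrix.conjTranspose_sub, Matrix.conjTranspose_conjTranspose, sub_mul, mul_sub,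
    Matrix.trace_sub] at h
  linarith

variable [DecidableEq n]

lemma trace_mul_pow_comm (X Y : Matrix n n ℝ) (k : ℕ) :
    ((X * Y) ^ k).trace = ((Y * X) ^ k).trace := by
  cases k with
  | zero => simp
  | succ k =>
    have h : (X * Y) ^ (k + 1) = X * ((Y * X) ^ k * Y) := by
      rw [pow_succ, ← mul_assoc, mul_pow_mul, mul_assoc]
    rw [h, Matrix.trace_mul_comm, mul_assoc, ← pow_succ]

/-- Araki–Lieb–Thirring for dyadic powers, together with the comparison of `tr M^(2m)` and
`tr (Mᴴ M)^m` from which it is bootstrapped. -/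
lemma trace_pow_two_pow_aux (k : ℕ) :
    (∀ A B : Matrix n n ℝ, A.IsHermitian → B.IsHermitian →
      ((A * B) ^ 2 ^ k).trace ≤ (A ^ 2 ^ k * B ^ 2 ^ k).trace) ∧
    (∀ M : Matrix n n ℝ, (M ^ 2 ^ (k + 1)).trace ≤ ((Mᴴ * M) ^ 2 ^ k).trace) := by
  induction k with
  | zero =>
    refine ⟨fun A B _ _ => by simp, fun M => ?_⟩
    have h := trace_mul_le_half M M
    have e : (M * Mᴴ).trace = (Mᴴ * M).trace := Matrix.trace_mul_comm _ _
    simp only [zero_add, pow_one, pow_zero, pow_two]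
    linarith
  | succ k ih =>
    obtain ⟨hGT, hP⟩ := ih
    constructor
    · intro A B hA hB
      -- By cyclicity, (AB)ᴴ(AB) = B·A²B has the same power traces as A²B², to which the first claim
      -- applies at the previous level.
      have h1 := hP (A * B)
      have e1 : (A * B)ᴴ * (A * B) = B * (A * A * B) := by
        rw [Matrix.conjTranspose_mul, hA.eq, hB.eq]; noncomm_ring
      rw [e1, trace_mul_pow_comm B] at h1
      have e2 : A * A * B * B = A ^ 2 * B ^ 2 := by noncomm_ring
      rw [e2] at h1
      have h2 := hGT (A ^ 2) (B ^ 2) (hA.pow 2) (hB.pow 2)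
      rw [← pow_mul, ← pow_mul, ← pow_succ'] at h2
      exact h1.trans h2
    · intro M
      -- By cyclicity (M²)ᴴM² may be replaced by QR with Q = MᴴM and R = MMᴴ. The first claim
      -- separates the powers, and then the arithmetic-geometric bound finishes, because powers of Q
      -- and R have equal traces.
      have h1 := hP (M ^ 2)
      have e1 : (M ^ 2)ᴴ * M ^ 2 = Mᴴ * (Mᴴ * M * M) := by
        rw [Matrix.conjTranspose_pow]; noncomm_ring
      rw [e1, trace_mul_pow_comm, ← pow_mul, ← pow_succ'] at h1
      have e2 : Mᴴ * M * M * Mᴴ = (Mᴴ * M) * (M * Mᴴ) := by noncomm_ring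
      rw [e2] at h1
      have hQ : (Mᴴ * M).IsHermitian := Matrix.isHermitian_conjTranspose_mul_self M
      have hR : (M * Mᴴ).IsHermitian := Matrix.isHermitian_mul_conjTranspose_self M
      have h2 := hGT (Mᴴ * M) (M * Mᴴ) hQ hR
      have h3 := trace_mul_le_half ((Mᴴ * M) ^ 2 ^ k) ((M * Mᴴ) ^ 2 ^ k)
      rw [(hQ.pow _).eq, (hR.pow _).eq, ← pow_two, ← pow_two, ← pow_mul, ← pow_mul, ← pow_succ,
        trace_mul_pow_comm M Mᴴ] at h3
      linarith

/-- Telescoping. The exponent `k` instead of `k - 1` is harmless because `1 ≤ M`. -/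
lemma norm_pow_sub_pow_le {𝔸 : Type*} [NormedRing 𝔸] [NormOneClass 𝔸] {X Y : 𝔸} {M : ℝ}
    (hM : 1 ≤ M) (hX : ‖X‖ ≤ M) (hY : ‖Y‖ ≤ M) (k : ℕ) :
    ‖X ^ k - Y ^ k‖ ≤ k * M ^ k * ‖X - Y‖ := by
  have hM0 : 0 ≤ M := zero_le_one.trans hM
  induction k with
  | zero => simp
  | succ k ih =>
    have e : X ^ (k + 1) - Y ^ (k + 1) = X ^ k * (X - Y) + (X ^ k - Y ^ k) * Y := by
      rw [pow_succ, pow_succ]; noncomm_ring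
    rw [e]
    have h1 : ‖X ^ k * (X - Y)‖ ≤ M ^ (k + 1) * ‖X - Y‖ := by
      refine (norm_mul_le _ _).trans (mul_le_mul_of_nonneg_right ?_ (norm_nonneg _))
      exact (norm_pow_le X k).trans ((pow_le_pow_left₀ (norm_nonneg _) hX k).trans
        (pow_le_pow_right₀ hM (Nat.le_succ k)))
    have h2 : ‖(X ^ k - Y ^ k) * Y‖ ≤ k * M ^ (k + 1) * ‖X - Y‖ := by
      refine (norm_mul_le _ _).trans ((mul_le_mul ih hY (norm_nonneg _) (by positivity)).trans ?_)
      apply le_of_eq; ring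
    refine (norm_add_le _ _).trans ((add_le_add h1 h2).trans (le_of_eq ?_))
    push_cast; ring

/-- Two curves through 1 with a common derivative differ by o(1/k) at time 1/k. Their norms there
are at most exp((‖D‖ + 1)/k), so raising to the k-th power multiplies the difference by at most
k·exp(‖D‖ + 1). -/
lemma tendsto_pow_sub_pow {𝔸 : Type*} [NormedRing 𝔸] [NormedAlgebra ℝ 𝔸] [NormOneClass 𝔸]
    {f g : ℝ → 𝔸} {D : 𝔸} (hf : HasDerivAt f D 0) (hg : HasDerivAt g D 0) (hf0 : f 0 = 1)
    (hg0 : g 0 = 1) :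
    Tendsto (fun k : ℕ => f (k : ℝ)⁻¹ ^ k - g (k : ℝ)⁻¹ ^ k) atTop (𝓝 0) := by
  have hinv : Tendsto (fun k : ℕ => (k : ℝ)⁻¹) atTop (𝓝[≠] 0) := by
    refine tendsto_nhdsWithin_iff.2 ⟨tendsto_inv_atTop_nhds_zero_nat, ?_⟩
    filter_upwards [eventually_gt_atTop 0] with k hk
    have : (k : ℝ) ≠ 0 := by exact_mod_cast hk.ne'
    simpa using this
  have slope_lim : ∀ {h : ℝ → 𝔸} {D' : 𝔸}, HasDerivAt h D' 0 →
      Tendsto (fun k : ℕ => (k : ℝ) * ‖h (k : ℝ)⁻¹ - h 0‖) atTop (𝓝 ‖D'‖) := by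
    intro h D' hh
    have := ((hasDerivAt_iff_tendsto_slope.1 hh).comp hinv).norm
    refine this.congr fun k => ?_
    simp [slope_def_module, norm_smul]
  have bound : ∀ {h : ℝ → 𝔸}, HasDerivAt h D 0 → h 0 = 1 →
      ∀ᶠ k : ℕ in atTop, ‖h (k : ℝ)⁻¹‖ ≤ Real.exp ((‖D‖ + 1) / k) := by
    intro h hh h0
    filter_upwards [(slope_lim hh).eventually_le_const (lt_add_one ‖D‖), eventually_gt_atTop 0]
      with k hk hk0
    have hk0' : (0 : ℝ) < k := by exact_mod_cast hk0
    rw [h0] at hk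
    have h1 : ‖h (k : ℝ)⁻¹ - 1‖ ≤ (‖D‖ + 1) / k := by
      rw [le_div_iff₀ hk0']; linarith
    have h2 : ‖h (k : ℝ)⁻¹‖ ≤ ‖h (k : ℝ)⁻¹ - 1‖ + 1 := by
      have := norm_add_le (h (k : ℝ)⁻¹ - 1) 1
      simpa using this
    linarith [Real.add_one_le_exp ((‖D‖ + 1) / (k : ℝ))]
  have hd : HasDerivAt (fun t => f t - g t) 0 0 := by
    have := hf.sub hg
    rwa [sub_self] at this
  have hlim := slope_lim hd
  simp only [norm_zero, hf0, hg0, sub_self, sub_zero] at hlim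
  have hlim2 := hlim.const_mul (Real.exp (‖D‖ + 1))
  rw [mul_zero] at hlim2
  refine squeeze_zero_norm' ?_ hlim2
  filter_upwards [bound hf hf0, bound hg hg0, eventually_gt_atTop 0] with k h1 h2 hk0
  have hk0' : (k : ℝ) ≠ 0 := by exact_mod_cast hk0.ne'
  have h3 := norm_pow_sub_pow_le (Real.one_le_exp (by positivity)) h1 h2 k
  rw [← Real.exp_nat_mul, mul_div_cancel₀ _ hk0'] at h3
  linarith

/-- The Lie product formula. -/
lemma tendsto_exp_mul_exp_pow {𝔸 : Type*} [NormedRing 𝔸] [NormedAlgebra ℝ 𝔸] [NormOneClass 𝔸]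
    [CompleteSpace 𝔸] (A B : 𝔸) :
    Tendsto (fun k : ℕ => (exp ((k : ℝ)⁻¹ • A) * exp ((k : ℝ)⁻¹ • B)) ^ k) atTop
      (𝓝 (exp (A + B))) := by
  let _ : NormedAlgebra ℚ 𝔸 := NormedAlgebra.restrictScalars ℚ ℝ 𝔸
  have hder : ∀ X : 𝔸, HasDerivAt (fun t : ℝ => exp (t • X)) X 0 := by
    intro X
    simpa using hasDerivAt_exp_smul_const (𝕂 := ℝ) X 0
  have h := tendsto_pow_sub_pow (f := fun t : ℝ => exp (t • A) * exp (t • B))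
    (g := fun t : ℝ => exp (t • (A + B))) (D := A + B)
    (by
      have := (hder A).mul (hder B)
      simp only [zero_smul, exp_zero, mul_one, one_mul] at this
      exact this)
    (hder _) (by simp) (by simp)
  have h2 : Tendsto (fun k : ℕ => exp ((k : ℝ)⁻¹ • (A + B)) ^ k) atTop (𝓝 (exp (A + B))) := by
    refine tendsto_const_nhds.congr' ?_
    filter_upwards [eventually_gt_atTop 0] with k hk0
    have hk0' : (k : ℝ) ≠ 0 := by exact_mod_cast hk0.ne'
    rw [← exp_nsmul, ← Nat.cast_smul_eq_nsmul ℝ, smul_smul, mul_inv_cancel₀ hk0', one_smul]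
  simpa using h.add h2

/-- The **Golden–Thompson inequality** for real symmetric matrices. -/
theorem trace_exp_add_le {A B : Matrix n n ℝ} (hA : A.IsHermitian) (hB : B.IsHermitian) :
    (exp (A + B)).trace ≤ (exp A * exp B).trace := by
  -- The operator norm introduced below satisfies ‖1‖ = 1 only for a nonempty index type.
  cases isEmpty_or_nonempty n with
  | inl h => simp [Matrix.trace]
  | inr h =>
  let _ : NormedRing (Matrix n n ℝ) := Matrix.linftyOpNormedRing
  let _ : NormedAlgebra ℝ (Matrix n n ℝ) := Matrix.linftyOpNormedAlgebra
  have _ : NormOneClass (Matrix n n ℝ) := Matrix.linfty_opNormOneClass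
  let _ : NormedAlgebra ℚ (Matrix n n ℝ) := NormedAlgebra.restrictScalars ℚ ℝ _
  -- Only the dyadic subsequence of the Lie product formula is needed, and along it the trace
  -- inequality for powers is available.
  have hlim := (tendsto_exp_mul_exp_pow A B).comp (tendsto_pow_atTop_atTop_of_one_lt one_lt_two)
  have htr : Tendsto (fun k : ℕ => ((exp (((2 ^ k : ℕ) : ℝ)⁻¹ • A) *
      exp (((2 ^ k : ℕ) : ℝ)⁻¹ • B)) ^ 2 ^ k).trace) atTop (𝓝 (exp (A + B)).trace) :=
    ((continuous_id.matrix_trace).tendsto _).comp hlim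
  refine le_of_tendsto' htr fun k => ?_
  have hherm : ∀ {X : Matrix n n ℝ}, X.IsHermitian →
      (exp (((2 ^ k : ℕ) : ℝ)⁻¹ • X)).IsHermitian := fun hX =>
    Matrix.IsHermitian.exp (hX.smul (IsSelfAdjoint.all _))
  refine ((trace_pow_two_pow_aux k).1 _ _ (hherm hA) (hherm hB)).trans (le_of_eq ?_)
  have hp : ∀ X : Matrix n n ℝ, exp (((2 ^ k : ℕ) : ℝ)⁻¹ • X) ^ 2 ^ k = exp X := by
    intro X
    rw [← Matrix.exp_nsmul, ← Nat.cast_smul_eq_nsmul ℝ, smul_smul, mul_inv_cancel₀ (by positivity),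
      one_smul]
  rw [hp, hp]

end GoldenThompson

/-! ### Spectral calculus and the matrix Chernoff bound -/

namespace Matrix

variable {n : Type*} [Fintype n] [DecidableEq n]

lemma IsHermitian.exists_diagonalization {A : Matrix n n ℝ} (hA : A.IsHermitian) :
    ∃ U : Matrix n n ℝ, Uᴴ * U = 1 ∧ U * Uᴴ = 1 ∧ A = U * diagonal hA.eigenvalues * Uᴴ ∧
      ∀ f : ℝ → ℝ, cfc f A = U * diagonal (f ∘ hA.eigenvalues) * Uᴴ := by
  refine ⟨hA.eigenvectorUnitary, ?_, ?_, ?_, fun f => ?_⟩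
  · rw [← star_eq_conjTranspose]; simp
  · rw [← star_eq_conjTranspose]; simp
  · conv_lhs => rw [hA.spectral_theorem, Unitary.conjStarAlgAut_apply]
    rfl
  · rw [hA.cfc_eq, IsHermitian.cfc, Unitary.conjStarAlgAut_apply]
    rfl

open scoped MatrixOrder in
-- With A = XᴴX the trace is that of the positive semidefinite matrix XBXᴴ.
lemma PosSemidef.trace_mul_nonneg {A B : Matrix n n ℝ} (hA : A.PosSemidef) (hB : B.PosSemidef) :
    0 ≤ (A * B).trace := by
  obtain ⟨X, rfl⟩ := CStarAlgebra.nonneg_iff_eq_star_mul_self.mp hA.nonneg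
  rw [star_eq_conjTranspose, mul_assoc, trace_mul_comm]
  exact (hB.mul_mul_conjTranspose_same X).trace_nonneg

lemma exp_smul_eq_of_diagonalization {A U : Matrix n n ℝ} {e : n → ℝ} (hU : Uᴴ * U = 1)
    (hA : A = U * diagonal e * Uᴴ) (c : ℝ) :
    NormedSpace.exp (c • A) = U * diagonal (fun i => Real.exp (c * e i)) * Uᴴ := by
  have hinv : U⁻¹ = Uᴴ := inv_eq_left_inv hU
  have hunit : IsUnit U := (Matrix.isUnit_iff_isUnit_det U).2 (isUnit_det_of_left_inverse hU)
  have h1 : c • A = U * diagonal (c • e) * U⁻¹ := by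
    rw [hA, hinv, diagonal_smul, mul_smul_comm, smul_mul_assoc]
  rw [h1, exp_conj _ _ hunit, exp_diagonal, hinv]
  congr 3
  ext i
  rw [Pi.coe_exp, ← Real.exp_eq_exp_ℝ]
  simp

lemma IsHermitian.posSemidef_exp {A : Matrix n n ℝ} (hA : A.IsHermitian) :
    (NormedSpace.exp A).PosSemidef := by
  obtain ⟨U, hU, -, hAU, -⟩ := hA.exists_diagonalization
  have h := exp_smul_eq_of_diagonalization hU hAU 1
  rw [one_smul] at h
  rw [h]
  exact (PosSemidef.diagonal fun i => (Real.exp_pos _).le).mul_mul_conjTranspose_same U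

lemma eigenvalues_le_of_posSemidef {A U : Matrix n n ℝ} {e : n → ℝ} {R : ℝ} (hU : Uᴴ * U = 1)
    (hA : A = U * diagonal e * Uᴴ) (hR : (R • (1 : Matrix n n ℝ) - A).PosSemidef) (i : n) :
    e i ≤ R := by
  have h := hR.conjTranspose_mul_mul_same U
  have e1 : Uᴴ * (R • 1 - A) * U = diagonal (fun i => R - e i) := by
    have : Uᴴ * (U * diagonal e * Uᴴ) * U = (Uᴴ * U) * diagonal e * (Uᴴ * U) := by noncomm_ring
    rw [mul_sub, sub_mul, hA, this, hU, one_mul, mul_one, mul_smul_comm, mul_one, smul_mul_assoc, hU,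
      smul_one_eq_diagonal, diagonal_sub]
  rw [e1, posSemidef_diagonal_iff] at h
  linarith [h i]

/-- (1 + t + t²/2)(1 − t + t²/2) = 1 + t⁴/4 ≥ 1, and the first factor is at most exp t. -/
lemma exp_neg_le_quadratic {t : ℝ} (ht : 0 ≤ t) : Real.exp (-t) ≤ 1 - t + t ^ 2 / 2 := by
  have h := Real.quadratic_le_exp_of_nonneg ht
  have hq : 0 < 1 - t + t ^ 2 / 2 := by nlinarith [sq_nonneg (t - 1)]
  rw [Real.exp_neg, inv_le_iff_one_le_mul₀' (Real.exp_pos t)]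
  calc (1 : ℝ) ≤ (1 + t + t ^ 2 / 2) * (1 - t + t ^ 2 / 2) := by nlinarith [sq_nonneg (t ^ 2)]
    _ ≤ Real.exp t * (1 - t + t ^ 2 / 2) := mul_le_mul_of_nonneg_right h hq.le

/-- Eigenvalue by eigenvalue: exp(−sλ) ≤ 1 − sλ + s²λ²/2, and λ² ≤ Rλ on [0, R]. A bound that is
affine in Y can be averaged over the sampling distribution. -/
lemma PosSemidef.one_sub_smul_sub_exp {Y : Matrix n n ℝ} {R s : ℝ} (hY : Y.PosSemidef)
    (hR : (R • (1 : Matrix n n ℝ) - Y).PosSemidef) (hs : 0 ≤ s) :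
    (1 - (s - s ^ 2 * R / 2) • Y - NormedSpace.exp (-s • Y)).PosSemidef := by
  obtain ⟨U, hU, hU', hYU, -⟩ := hY.isHermitian.exists_diagonalization
  have h0 := hY.eigenvalues_nonneg
  have h1 := eigenvalues_le_of_posSemidef hU hYU hR
  set e := hY.isHermitian.eigenvalues
  have e1 : 1 - (s - s ^ 2 * R / 2) • Y - NormedSpace.exp (-s • Y) =
      U * diagonal (fun i => 1 - (s - s ^ 2 * R / 2) * e i - Real.exp (-s * e i)) * Uᴴ := by
    rw [exp_smul_eq_of_diagonalization hU hYU]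
    have : (diagonal fun i => 1 - (s - s ^ 2 * R / 2) * e i - Real.exp (-s * e i)) =
        1 - (s - s ^ 2 * R / 2) • diagonal e - diagonal fun i => Real.exp (-s * e i) := by
      rw [← diagonal_smul, ← diagonal_one, diagonal_sub, diagonal_sub]; rfl
    rw [this, mul_sub, mul_sub, sub_mul, sub_mul, mul_one, hU', mul_smul_comm, smul_mul_assoc, ← hYU]
  rw [e1]
  refine (PosSemidef.diagonal fun i => ?_).mul_mul_conjTranspose_same U
  have h2 := exp_neg_le_quadratic (mul_nonneg hs (h0 i))
  rw [← neg_mul] at h2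
  have h3 : s ^ 2 * (e i * e i) ≤ s ^ 2 * (R * e i) :=
    mul_le_mul_of_nonneg_left (mul_le_mul_of_nonneg_right (h1 i) (h0 i)) (sq_nonneg s)
  simp only [Pi.zero_apply]
  nlinarith

/-- The Laplace transform step of the Chernoff bound. Golden–Thompson splits off one draw, the
affine bound on exp(−sY) averages to (1 − κ)·1 with κ = s − s²R/2, and 1 − κ ≤ exp(−κ). The
statement carries a general Hermitian S because peeling off the first draw shifts S. -/
lemma sum_prod_mul_trace_exp_le {ι : Type*} [Fintype ι] {w : ι → ℝ} (hw : ∀ i, 0 ≤ w i)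
    (hw1 : ∑ i, w i = 1) {Y : ι → Matrix n n ℝ} (hY : ∀ i, (Y i).PosSemidef)
    (hsum : ∑ i, w i • Y i = 1) {R s : ℝ} (hR : ∀ i, (R • (1 : Matrix n n ℝ) - Y i).PosSemidef)
    (hs : 0 ≤ s) (K : ℕ) :
    ∀ S : Matrix n n ℝ, S.IsHermitian →
      ∑ x : Fin K → ι, (∏ k, w (x k)) * (NormedSpace.exp (S - s • ∑ k, Y (x k))).trace ≤
        Real.exp (-(s - s ^ 2 * R / 2)) ^ K * (NormedSpace.exp S).trace := by
  induction K with
  | zero => intro S _; simp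
  | succ K ih =>
    intro S hS
    set κ := s - s ^ 2 * R / 2
    have hstep : ∀ i, (NormedSpace.exp (S - s • Y i)).trace ≤
        (NormedSpace.exp S * (1 - κ • Y i)).trace := by
      intro i
      have h1 := GoldenThompson.trace_exp_add_le hS
        (B := -s • Y i) ((hY i).isHermitian.smul (IsSelfAdjoint.all _))
      have h2 := hS.posSemidef_exp.trace_mul_nonneg ((hY i).one_sub_smul_sub_exp (hR i) hs)
      rw [mul_sub, trace_sub] at h2
      rw [neg_smul, ← sub_eq_add_neg, ← neg_smul] at h1
      linarith
    have hE : 0 ≤ (NormedSpace.exp S).trace := hS.posSemidef_exp.trace_nonneg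
    rw [← (Fin.consEquiv fun _ : Fin (K + 1) => ι).sum_comp, Fintype.sum_prod_type]
    calc _ = ∑ i, w i * ∑ x : Fin K → ι, (∏ k, w (x k)) *
          (NormedSpace.exp (S - s • Y i - s • ∑ k, Y (x k))).trace := by
          refine Finset.sum_congr rfl fun i _ => ?_
          rw [Finset.mul_sum]
          refine Finset.sum_congr rfl fun x _ => ?_
          simp only [Fin.consEquiv_apply, Fin.prod_univ_succ, Fin.sum_univ_succ, Fin.cons_zero,
            Fin.cons_succ, smul_add, mul_assoc, sub_sub]
      _ ≤ ∑ i, w i * (Real.exp (-κ) ^ K * (NormedSpace.exp S * (1 - κ • Y i)).trace) := by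
          refine Finset.sum_le_sum fun i _ => mul_le_mul_of_nonneg_left ?_ (hw i)
          refine (ih _ (hS.sub ((hY i).isHermitian.smul (IsSelfAdjoint.all _)))).trans ?_
          exact mul_le_mul_of_nonneg_left (hstep i) (by positivity)
      _ = Real.exp (-κ) ^ K * ((1 - κ) * (NormedSpace.exp S).trace) := by
          have h3 : ∑ i, w i * (NormedSpace.exp S * (1 - κ • Y i)).trace =
              (1 - κ) * (NormedSpace.exp S).trace := by
            have : ∑ i, w i * (NormedSpace.exp S * (1 - κ • Y i)).trace =
                (NormedSpace.exp S * (∑ i, w i • (1 - κ • Y i))).trace := by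
              rw [Finset.mul_sum, trace_sum]
              simp
            have h4 : ∑ i, w i • ((1 : Matrix n n ℝ) - κ • Y i) = (1 - κ) • 1 := by
              simp_rw [smul_sub, Finset.sum_sub_distrib, ← Finset.sum_smul, hw1, smul_comm _ κ,
                ← Finset.smul_sum, hsum, sub_smul]
            rw [this, h4]
            simp
          rw [← h3, Finset.mul_sum]
          exact Finset.sum_congr rfl fun i _ => by ring
      _ ≤ Real.exp (-κ) ^ (K + 1) * (NormedSpace.exp S).trace := by
          rw [pow_succ, mul_assoc]
          refine mul_le_mul_of_nonneg_left (mul_le_mul_of_nonneg_right ?_ hE) (by positivity)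
          linarith [Real.add_one_le_exp (-κ)]

/-- Some eigenvalue lies below a, and its exponential alone already exceeds the bound. This is the
Markov step of the Chernoff argument. -/
lemma IsHermitian.exp_le_trace_exp {S : Matrix n n ℝ} (hS : S.IsHermitian) {a s : ℝ} (hs : 0 ≤ s)
    (hna : ¬ (S - a • (1 : Matrix n n ℝ)).PosSemidef) :
    Real.exp (-s * a) ≤ (NormedSpace.exp (-s • S)).trace := by
  obtain ⟨U, hU, hU', hSU, -⟩ := hS.exists_diagonalization
  set e := hS.eigenvalues
  have hex : ∃ i, e i < a := by
    by_contra! hcon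
    refine hna ?_
    have : S - a • (1 : Matrix n n ℝ) = U * diagonal (fun i => e i - a) * Uᴴ := by
      rw [← diagonal_sub, ← smul_one_eq_diagonal, mul_sub, sub_mul, ← hSU, mul_smul_comm, smul_mul_assoc,
        mul_one, hU']
    rw [this]
    exact (PosSemidef.diagonal fun i => sub_nonneg.2 (hcon i)).mul_mul_conjTranspose_same U
  obtain ⟨i, hi⟩ := hex
  rw [exp_smul_eq_of_diagonalization hU hSU, trace_mul_comm, ← mul_assoc, hU, one_mul,
    trace_diagonal]
  refine le_trans (Real.exp_le_exp.2 ?_)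
    (Finset.single_le_sum (f := fun i => Real.exp (-s * e i)) (fun _ _ => (Real.exp_pos _).le)
      (Finset.mem_univ i))
  nlinarith

open Classical in
/-- Lower tail of the **matrix Chernoff bound**, normalised to mean `1`. -/
lemma sum_prod_not_posSemidef_le {ι : Type*} [Fintype ι] {w : ι → ℝ} (hw : ∀ i, 0 ≤ w i)
    (hw1 : ∑ i, w i = 1) {Y : ι → Matrix n n ℝ} (hY : ∀ i, (Y i).PosSemidef)
    (hsum : ∑ i, w i • Y i = 1) {R ε : ℝ} (hR0 : 0 < R)
    (hR : ∀ i, (R • (1 : Matrix n n ℝ) - Y i).PosSemidef) (hε : 0 ≤ ε) (K : ℕ) :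
    (∑ x : Fin K → ι, if (∑ k, Y (x k) - ((1 - ε) * K) • (1 : Matrix n n ℝ)).PosSemidef then 0
      else ∏ k, w (x k)) ≤ Fintype.card n * Real.exp (-(K * ε ^ 2 / (2 * R))) := by
  -- This s minimises the exponent K(s²R/2 − sε).
  set s := ε / R with hs_def
  have hs : 0 ≤ s := div_nonneg hε hR0.le
  have h1 := sum_prod_mul_trace_exp_le hw hw1 hY hsum hR hs K 0 (Matrix.isHermitian_zero)
  have htr1 : (NormedSpace.exp (0 : Matrix n n ℝ)).trace = Fintype.card n := by
    rw [NormedSpace.exp_zero, trace_one]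
  rw [htr1] at h1
  simp only [zero_sub, ← neg_smul] at h1
  have h2 : Real.exp (-s * ((1 - ε) * K)) * (∑ x : Fin K → ι,
      if (∑ k, Y (x k) - ((1 - ε) * K) • (1 : Matrix n n ℝ)).PosSemidef then 0
      else ∏ k, w (x k)) ≤ Real.exp (-(s - s ^ 2 * R / 2)) ^ K * Fintype.card n := by
    refine le_trans ?_ h1
    rw [Finset.mul_sum]
    refine Finset.sum_le_sum fun x _ => ?_
    have hp : 0 ≤ ∏ k, w (x k) := Finset.prod_nonneg fun k _ => hw _
    have hH : (∑ k, Y (x k)).IsHermitian :=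
      (posSemidef_sum _ fun k _ => hY (x k)).isHermitian
    split_ifs with hx
    · rw [mul_zero]
      exact mul_nonneg hp (hH.smul (IsSelfAdjoint.all _)).posSemidef_exp.trace_nonneg
    · rw [mul_comm]
      exact mul_le_mul_of_nonneg_left (hH.exp_le_trace_exp hs hx) hp
  rw [← le_div_iff₀' (Real.exp_pos _)] at h2
  refine h2.trans (le_of_eq ?_)
  rw [mul_comm, mul_div_assoc, ← Real.exp_nat_mul, ← Real.exp_sub]
  congr 2
  rw [hs_def]
  field_simp
  ring

end Matrix

/-! ### The inverse square root of a positive definite matrix -/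

section InvSqrt

variable {d : ℕ} {A : Matrix (Fin d) (Fin d) ℝ}

lemma exists_diagonalization_invSqrt (hA : A.PosDef) :
    ∃ (U : Matrix (Fin d) (Fin d) ℝ) (e : Fin d → ℝ), Uᴴ * U = 1 ∧ U * Uᴴ = 1 ∧ (∀ i, 0 < e i) ∧
      A = U * Matrix.diagonal e * Uᴴ ∧
      invSqrt A = U * Matrix.diagonal (fun i => (√(e i))⁻¹) * Uᴴ := by
  obtain ⟨U, hU, hU', hAU, hf⟩ := hA.isHermitian.exists_diagonalization
  exact ⟨U, _, hU, hU', hA.eigenvalues_pos, hAU, hf _⟩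

lemma invSqrt_isHermitian (hA : A.PosDef) : (invSqrt A).IsHermitian := by
  obtain ⟨U, e, -, -, -, -, h⟩ := exists_diagonalization_invSqrt hA
  rw [h]
  exact Matrix.isHermitian_mul_mul_conjTranspose U (Matrix.isHermitian_diagonal _)

lemma invSqrt_mul_self_mul (hA : A.PosDef) : invSqrt A * A * invSqrt A = 1 := by
  obtain ⟨U, e, hU, hU', hpos, hAU, h⟩ := exists_diagonalization_invSqrt hA
  rw [h]
  conv_lhs => rw [hAU]
  set D := Matrix.diagonal fun i => (√(e i))⁻¹
  have e1 : U * D * Uᴴ * (U * Matrix.diagonal e * Uᴴ) * (U * D * Uᴴ) =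
      U * (D * (Uᴴ * U) * Matrix.diagonal e * (Uᴴ * U) * D) * Uᴴ := by noncomm_ring
  have e2 : D * Matrix.diagonal e * D = 1 := by
    rw [Matrix.diagonal_mul_diagonal, Matrix.diagonal_mul_diagonal, ← Matrix.diagonal_one]
    congr 1
    ext i
    have h1 : √(e i) ≠ 0 := (Real.sqrt_pos.2 (hpos i)).ne'
    nth_rw 2 [← Real.mul_self_sqrt (hpos i).le]
    field_simp
  rw [e1, hU, mul_one, mul_one, e2, mul_one, hU']

lemma invSqrt_mul_invSqrt (hA : A.PosDef) : invSqrt A * invSqrt A = A⁻¹ := by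
  have h := invSqrt_mul_self_mul hA
  have h1 : invSqrt A * (A * invSqrt A) = 1 := by rw [← mul_assoc, h]
  have h2 : A * invSqrt A * invSqrt A = 1 := mul_eq_one_comm.1 h1
  rw [mul_assoc] at h2
  exact (Matrix.inv_eq_right_inv h2).symm

open Classical in
/-- Lower tail of the **matrix Chernoff bound**, relative to a positive definite mean. -/
lemma sum_prod_not_posSemidef_le_of_posDef {ι : Type*} [Fintype ι] {w : ι → ℝ}
    (hw : ∀ i, 0 ≤ w i) (hw1 : ∑ i, w i = 1) {T : ι → Matrix (Fin d) (Fin d) ℝ}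
    (hT : ∀ i, (T i).PosSemidef) (hsum : ∑ i, w i • T i = A) (hA : A.PosDef) {R ε : ℝ}
    (hR0 : 0 < R) (hR : ∀ i, (R • A - T i).PosSemidef) (hε : 0 ≤ ε) (K : ℕ) :
    (∑ x : Fin K → ι, if (∑ k, T (x k) - ((1 - ε) * K) • A).PosSemidef then 0
      else ∏ k, w (x k)) ≤ d * Real.exp (-(K * ε ^ 2 / (2 * R))) := by
  set B := invSqrt A
  have hB : Bᴴ = B := (invSqrt_isHermitian hA).eq
  have hBA : B * A * B = 1 := invSqrt_mul_self_mul hA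
  have hBunit : IsUnit B := by
    refine (Matrix.isUnit_iff_isUnit_det B).2 (Matrix.isUnit_det_of_right_inverse (B := A * B) ?_)
    rw [← mul_assoc, hBA]
  have h := Matrix.sum_prod_not_posSemidef_le (Y := fun i => B * T i * B) hw hw1
    (fun i => by simpa only [hB] using (hT i).mul_mul_conjTranspose_same B)
    (by
      rw [← hBA, ← hsum, Finset.mul_sum, Finset.sum_mul]
      simp) hR0
    (fun i => by
      have := (hR i).mul_mul_conjTranspose_same B
      rw [hB, mul_sub, sub_mul, mul_smul_comm, smul_mul_assoc, hBA] at this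
      exact this) hε K
  rw [Fintype.card_fin] at h
  refine le_trans (le_of_eq (Finset.sum_congr rfl fun x _ => ?_)) h
  congr 1
  have e1 : ∑ k, B * T (x k) * B - ((1 - ε) * K) • (1 : Matrix (Fin d) (Fin d) ℝ) =
      star B * (∑ k, T (x k) - ((1 - ε) * K) • A) * B := by
    rw [Matrix.star_eq_conjTranspose, hB, mul_sub B, sub_mul _ _ B, mul_smul_comm, smul_mul_assoc, hBA,
      Finset.mul_sum, Finset.sum_mul]
  rw [e1, Matrix.IsUnit.posSemidef_star_left_conjugate_iff hBunit]

end InvSqrt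

/-! ### A dimension-free tail bound for sums of independent bounded vectors -/

section VectorHoeffding

/-- cosh √x = Σ xᵏ/(2k)!, a series of functions convex on [0, ∞). -/
lemma convexOn_cosh_sqrt : ConvexOn ℝ (Set.Ici 0) fun x : ℝ => Real.cosh (√x) := by
  have hs : ∀ x : ℝ, 0 ≤ x → HasSum (fun k : ℕ => x ^ k / (2 * k).factorial) (Real.cosh (√x)) := by
    intro x hx
    have h := Real.hasSum_cosh (√x)
    simpa only [pow_mul, Real.sq_sqrt hx] using h
  refine ⟨convex_Ici 0, fun x hx y hy a b ha hb hab => ?_⟩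
  have hxy : 0 ≤ a • x + b • y := (convex_Ici (0 : ℝ)) hx hy ha hb hab
  refine hasSum_le (fun k => ?_) (hs _ hxy) (((hs x hx).mul_left a).add ((hs y hy).mul_left b))
  have h := (convexOn_pow k).2 hx hy ha hb hab
  simp only [smul_eq_mul] at h ⊢
  rw [mul_div_assoc', mul_div_assoc', ← add_div]
  exact div_le_div_of_nonneg_right h (by positivity)

variable {E : Type*} [NormedAddCommGroup E] [InnerProductSpace ℝ E]

/-- With a = ‖v‖, b = ‖g‖ and c = ⟨v, g⟩, the number ‖v + g‖² is the convex combination of (a + b)²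
and (a − b)² with weights (1 ± c/(ab))/2. Convexity of cosh √x and the addition formulas do the
rest. -/
lemma cosh_norm_add_le (v g : E) :
    Real.cosh ‖v + g‖ ≤ Real.cosh ‖v‖ * Real.cosh ‖g‖ +
      inner ℝ v g * (Real.sinh ‖v‖ / ‖v‖) * (Real.sinh ‖g‖ / ‖g‖) := by
  rcases eq_or_ne v 0 with rfl | hv
  · simp
  rcases eq_or_ne g 0 with rfl | hg
  · simp
  set a := ‖v‖
  set b := ‖g‖
  set c : ℝ := inner ℝ v g
  have ha : 0 < a := norm_pos_iff.2 hv
  have hb : 0 < b := norm_pos_iff.2 hg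
  have hab : 0 < a * b := mul_pos ha hb
  have hc := abs_le.1 (abs_real_inner_le_norm v g)
  have hp : 0 ≤ (1 + c / (a * b)) / 2 := by
    have : -1 ≤ c / (a * b) := by rw [le_div_iff₀ hab]; linarith [hc.1]
    linarith
  have hq : 0 ≤ (1 - c / (a * b)) / 2 := by
    have : c / (a * b) ≤ 1 := by rw [div_le_iff₀ hab]; linarith [hc.2]
    linarith
  have h := convexOn_cosh_sqrt.2 (x := (a + b) ^ 2) (y := (a - b) ^ 2) (Set.mem_Ici.2 (sq_nonneg _))
    (Set.mem_Ici.2 (sq_nonneg _)) hp hq (by ring)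
  have e1 : √((a + b) ^ 2) = a + b := Real.sqrt_sq (by positivity)
  have e2 : Real.cosh (√((a - b) ^ 2)) = Real.cosh (a - b) := by
    rw [Real.sqrt_sq_eq_abs, Real.cosh_abs]
  have e3 : √((1 + c / (a * b)) / 2 * (a + b) ^ 2 + (1 - c / (a * b)) / 2 * (a - b) ^ 2) =
      ‖v + g‖ := by
    rw [← Real.sqrt_sq (norm_nonneg (v + g)), norm_add_sq_real]
    congr 1
    change _ = a ^ 2 + 2 * c + b ^ 2
    field_simp
    ring
  simp only [smul_eq_mul] at h
  rw [e1, e2, e3, Real.cosh_add, Real.cosh_sub] at h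
  refine h.trans (le_of_eq ?_)
  field_simp
  ring

/-- Replacing sinh b/b by 1 leaves a term linear in g, which vanishes on averaging a centred g. The
replacement costs at most cosh a·(sinh b − b), and cosh b + sinh b − b = exp b − b ≤ 1 + b² for b ≤
1. -/
lemma cosh_norm_add_le_of_norm_le {v g : E} {β : ℝ} (hg : ‖g‖ ≤ β) (hβ : β ≤ 1) :
    Real.cosh ‖v + g‖ ≤ Real.cosh ‖v‖ * (1 + β ^ 2) +
      Real.sinh ‖v‖ / ‖v‖ * inner ℝ v g := by
  have h := cosh_norm_add_le v g
  have hsa : 0 ≤ Real.sinh ‖v‖ := Real.sinh_nonneg_iff.2 (norm_nonneg v)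
  have hsb : ‖g‖ ≤ Real.sinh ‖g‖ := Real.self_le_sinh_iff.2 (norm_nonneg g)
  have h1 : inner ℝ v g * (Real.sinh ‖v‖ / ‖v‖) * (Real.sinh ‖g‖ / ‖g‖ - 1) ≤
      Real.sinh ‖v‖ * (Real.sinh ‖g‖ - ‖g‖) := by
    rcases eq_or_ne v 0 with rfl | hv
    · simp
    rcases eq_or_ne g 0 with rfl | hg0
    · simp
    have ha : 0 < ‖v‖ := norm_pos_iff.2 hv
    have hb : 0 < ‖g‖ := norm_pos_iff.2 hg0
    have hin : inner ℝ v g ≤ ‖v‖ * ‖g‖ := real_inner_le_norm v g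
    have hq : 0 ≤ Real.sinh ‖g‖ / ‖g‖ - 1 := by
      rw [sub_nonneg, one_le_div hb]; exact hsb
    calc _ ≤ ‖v‖ * ‖g‖ * (Real.sinh ‖v‖ / ‖v‖) * (Real.sinh ‖g‖ / ‖g‖ - 1) := by gcongr
      _ = _ := by field_simp
  have h2 : Real.sinh ‖v‖ * (Real.sinh ‖g‖ - ‖g‖) ≤ Real.cosh ‖v‖ * (Real.sinh ‖g‖ - ‖g‖) :=
    mul_le_mul_of_nonneg_right (Real.sinh_lt_cosh _).le (sub_nonneg.2 hsb)
  have h3 : Real.cosh ‖g‖ + Real.sinh ‖g‖ - ‖g‖ ≤ 1 + β ^ 2 := by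
    rw [Real.cosh_add_sinh]
    have := (abs_le.1 (Real.abs_exp_sub_one_sub_id_le (x := ‖g‖)
      (by rw [abs_norm]; exact hg.trans hβ))).2
    have : ‖g‖ ^ 2 ≤ β ^ 2 := pow_le_pow_left₀ (norm_nonneg g) hg 2
    linarith
  have h4 := mul_le_mul_of_nonneg_left h3 (Real.cosh_pos ‖v‖).le
  nlinarith

variable {d : ℕ} {𝒴 : Type*} [MeasurableSpace 𝒴]

lemma lintegral_cosh_norm_add_le {μ : Measure 𝒴} [IsProbabilityMeasure μ]
    {g : 𝒴 → EuclideanSpace ℝ (Fin d)} (hg : Measurable g) {β : ℝ} (hβ : β ≤ 1)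
    (hb : ∀ᵐ y ∂μ, ‖g y‖ ≤ β) (h0 : ∫ y, g y ∂μ = 0) (v : EuclideanSpace ℝ (Fin d)) :
    ∫⁻ y, ENNReal.ofReal (Real.cosh ‖v + g y‖) ∂μ ≤
      ENNReal.ofReal (Real.exp (β ^ 2) * Real.cosh ‖v‖) := by
  have hint : Integrable g μ := Integrable.of_bound hg.aestronglyMeasurable β hb
  have hin : Integrable (fun y => inner ℝ v (g y)) μ := hint.const_inner v
  set F : 𝒴 → ℝ := fun y => Real.cosh ‖v‖ * (1 + β ^ 2) + Real.sinh ‖v‖ / ‖v‖ * inner ℝ v (g y)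
  have hF : Integrable F μ := (integrable_const _).add (hin.const_mul _)
  have hle : ∀ᵐ y ∂μ, Real.cosh ‖v + g y‖ ≤ F y := by
    filter_upwards [hb] with y hy using cosh_norm_add_le_of_norm_le hy hβ
  have hF0 : 0 ≤ᵐ[μ] F := by
    filter_upwards [hle] with y hy using (Real.cosh_pos _).le.trans hy
  calc _ ≤ ∫⁻ y, ENNReal.ofReal (F y) ∂μ := by
        refine lintegral_mono_ae ?_
        filter_upwards [hle] with y hy using ENNReal.ofReal_le_ofReal hy
    _ = ENNReal.ofReal (∫ y, F y ∂μ) := (ofReal_integral_eq_lintegral_ofReal hF hF0).symm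
    _ ≤ _ := by
        refine ENNReal.ofReal_le_ofReal ?_
        have e : ∫ y, F y ∂μ = Real.cosh ‖v‖ * (1 + β ^ 2) := by
          simp only [F]
          have h := integral_add (integrable_const (μ := μ) (Real.cosh ‖v‖ * (1 + β ^ 2)))
            (hin.const_mul (Real.sinh ‖v‖ / ‖v‖))
          rw [integral_const, integral_const_mul, integral_inner hint, h0] at h
          simpa using h
        rw [e, mul_comm]
        refine mul_le_mul_of_nonneg_right ?_ (Real.cosh_pos _).le
        linarith [Real.add_one_le_exp (β ^ 2)]

/-- One factor exp(β²) per summand; the starting vector v is arbitrary so that the first summand can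
be absorbed into it. Lower integrals avoid integrability questions. -/
lemma lintegral_cosh_norm_add_sum_le {β : ℝ} (hβ : β ≤ 1) {K : ℕ} :
    ∀ (μ : Fin K → Measure 𝒴) [∀ k, IsProbabilityMeasure (μ k)]
      (g : Fin K → 𝒴 → EuclideanSpace ℝ (Fin d)), (∀ k, Measurable (g k)) →
      (∀ k, ∀ᵐ y ∂μ k, ‖g k y‖ ≤ β) → (∀ k, ∫ y, g k y ∂μ k = 0) →
      ∀ v : EuclideanSpace ℝ (Fin d),
        ∫⁻ y, ENNReal.ofReal (Real.cosh ‖v + ∑ k, g k (y k)‖) ∂Measure.pi μ ≤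
          ENNReal.ofReal (Real.exp (K * β ^ 2) * Real.cosh ‖v‖) := by
  induction K with
  | zero => intro μ _ g _ _ _ v; simp
  | succ K ih =>
    intro μ _ g hg hb h0 v
    have hmp := measurePreserving_piFinSuccAbove μ 0
    have hmeas : Measurable fun p : 𝒴 × (Fin K → 𝒴) =>
        ENNReal.ofReal (Real.cosh ‖v + g 0 p.1 + ∑ k, g (Fin.succ k) (p.2 k)‖) := by
      refine ENNReal.measurable_ofReal.comp (Real.continuous_cosh.measurable.comp ?_)
      refine Measurable.norm ((measurable_const.add ((hg 0).comp measurable_fst)).add ?_)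
      exact Finset.measurable_fun_sum _ fun k _ =>
        (hg k.succ).comp ((measurable_pi_apply k).comp measurable_snd)
    have e1 : ∫⁻ y, ENNReal.ofReal (Real.cosh ‖v + ∑ k, g k (y k)‖) ∂Measure.pi μ =
        ∫⁻ p : 𝒴 × (Fin K → 𝒴),
          ENNReal.ofReal (Real.cosh ‖v + g 0 p.1 + ∑ k, g (Fin.succ k) (p.2 k)‖)
          ∂(μ 0).prod (Measure.pi fun k => μ (Fin.succ k)) := by
      have := hmp.lintegral_comp hmeas
      simp only [Fin.succAbove_zero] at this
      rw [← this]
      refine lintegral_congr fun y => ?_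
      rw [Fin.sum_univ_succ, ← add_assoc]
      rfl
    rw [e1, lintegral_prod _ hmeas.aemeasurable]
    calc _ ≤ ∫⁻ y, ENNReal.ofReal (Real.exp (K * β ^ 2)) *
          ENNReal.ofReal (Real.cosh ‖v + g 0 y‖) ∂μ 0 := by
          have hih := ih (fun k => μ k.succ) (fun k => g k.succ) (fun k => hg _) (fun k => hb _)
            (fun k => h0 _)
          simp only [← ENNReal.ofReal_mul (Real.exp_pos (K * β ^ 2)).le]
          exact lintegral_mono fun y => hih (v + g 0 y)
      _ ≤ ENNReal.ofReal (Real.exp (K * β ^ 2)) *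
          ENNReal.ofReal (Real.exp (β ^ 2) * Real.cosh ‖v‖) := by
          rw [lintegral_const_mul' _ _ ENNReal.ofReal_ne_top]
          gcongr
          exact lintegral_cosh_norm_add_le (hg 0) hβ (hb 0) (h0 0) v
      _ = _ := by
          rw [← ENNReal.ofReal_mul (Real.exp_pos _).le, ← mul_assoc, ← Real.exp_add]
          congr 3
          push_cast
          ring

/-- **Pinelis' inequality** for independent, centred, bounded vectors: a tail bound without
dependence on the dimension. -/
lemma measureReal_le_norm_sum_le {L t s : ℝ} {K : ℕ} (μ : Fin K → Measure 𝒴)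
    [∀ k, IsProbabilityMeasure (μ k)] (g : Fin K → 𝒴 → EuclideanSpace ℝ (Fin d))
    (hg : ∀ k, Measurable (g k)) (hb : ∀ k, ∀ᵐ y ∂μ k, ‖g k y‖ ≤ L)
    (h0 : ∀ k, ∫ y, g k y ∂μ k = 0) (hs : 0 ≤ s) (hsL : s * L ≤ 1) :
    (Measure.pi μ).real {y | t ≤ ‖∑ k, g k (y k)‖} ≤
      2 * Real.exp (K * (s * L) ^ 2 - s * t) := by
  have h := lintegral_cosh_norm_add_sum_le hsL μ (fun k y => s • g k y)
    (fun k => (hg k).const_smul s)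
    (fun k => by
      filter_upwards [hb k] with y hy
      rw [norm_smul, Real.norm_of_nonneg hs]
      exact mul_le_mul_of_nonneg_left hy hs)
    (fun k => by rw [integral_smul, h0, smul_zero]) 0
  simp only [zero_add, ← Finset.smul_sum, norm_smul, Real.norm_of_nonneg hs, norm_zero,
    Real.cosh_zero, mul_one] at h
  set S : (Fin K → 𝒴) → ℝ := fun y => ‖∑ k, g k (y k)‖
  have hS : Measurable S := Measurable.norm (Finset.measurable_fun_sum _ fun k _ =>
    (hg k).comp (measurable_pi_apply k))
  -- cosh x ≥ exp(x)/2 is the source of the factor 2 in the tail bound.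
  have hset : {y | t ≤ S y} ⊆
      {y | ENNReal.ofReal (Real.exp (s * t) / 2) ≤ ENNReal.ofReal (Real.cosh (s * S y))} := by
    intro y hy
    refine ENNReal.ofReal_le_ofReal ?_
    have h1 : Real.exp (s * t) ≤ Real.exp (s * S y) :=
      Real.exp_le_exp.2 (mul_le_mul_of_nonneg_left hy hs)
    rw [Real.cosh_eq]
    linarith [Real.exp_pos (-(s * S y))]
  have hmarkov := mul_meas_ge_le_lintegral₀ (μ := Measure.pi μ)
    (f := fun y => ENNReal.ofReal (Real.cosh (s * S y)))
    (ENNReal.measurable_ofReal.comp (Real.continuous_cosh.measurable.comp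
      (hS.const_mul s))).aemeasurable (ENNReal.ofReal (Real.exp (s * t) / 2))
  have h2 := (mul_le_mul' (le_refl (ENNReal.ofReal (Real.exp (s * t) / 2)))
    (measure_mono (μ := Measure.pi μ) hset)).trans (hmarkov.trans h)
  have h3 := ENNReal.toReal_mono ENNReal.ofReal_ne_top h2
  rw [ENNReal.toReal_mul, ENNReal.toReal_ofReal (by positivity),
    ENNReal.toReal_ofReal (Real.exp_pos _).le] at h3
  rw [Real.exp_sub]
  change (Measure.pi μ).real {y | t ≤ S y} ≤ _
  rw [measureReal_def, mul_div_assoc', le_div_iff₀ (Real.exp_pos _)]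
  linarith

end VectorHoeffding

/-! ### Localisation of the minimiser of a perturbed convex function -/

section Localisation

variable {E : Type*} [NormedAddCommGroup E] [InnerProductSpace ℝ E]

/-- If ‖v‖ ≥ s, shrink v to the sphere of radius s. Convexity along the ray and comparison with 0
make the objective there at most 0. But it is at least as²/2 − as²/4 − as²/8 > 0, from the quadratic
part, the cubic error and the linear term; s = 8b/a is chosen for the last of these. -/
lemma norm_lt_of_isMinOn_of_quadratic_growth {V : Set E} {r a b s L : ℝ} {F : E → ℝ} {A : E →L[ℝ] E}
    {g v : E} (hV : Metric.ball 0 r ⊆ V) (ha : 0 < a) (hb : 0 < b) (hs : s = 8 * b / a)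
    (hsr : s < r) (hL : L * s ≤ a / 4) (hF0 : F 0 = 0)
    (hF : ∀ w ∈ Metric.ball (0 : E) r, |F w - inner ℝ (A w) w / 2| ≤ L * ‖w‖ ^ 3)
    (hconv : ∀ w ∈ V, ∀ τ ∈ Set.Icc (0 : ℝ) 1, F (τ • w) ≤ τ * F w)
    (hA : ∀ w, a * ‖w‖ ^ 2 ≤ inner ℝ (A w) w) (hg : ‖g‖ ≤ b) (hv : v ∈ V)
    (hmin : ∀ w ∈ V, inner ℝ g v + F v ≤ inner ℝ g w + F w) : ‖v‖ < s := by
  by_contra! hcon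
  have hs0 : 0 < s := by rw [hs]; positivity
  have hv0 : 0 < ‖v‖ := hs0.trans_le hcon
  set τ := s / ‖v‖
  have hτ : τ ∈ Set.Icc (0 : ℝ) 1 := ⟨by positivity, (div_le_one hv0).2 hcon⟩
  have hnorm : ‖τ • v‖ = s := by
    rw [norm_smul, Real.norm_of_nonneg hτ.1, div_mul_cancel₀ _ hv0.ne']
  have h0 := hmin 0 (hV (Metric.mem_ball_self (hs0.trans hsr)))
  rw [inner_zero_right, hF0, add_zero] at h0
  have h1 := hconv v hv τ hτ
  have h2 : inner ℝ g (τ • v) + F (τ • v) ≤ 0 := by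
    rw [inner_smul_right]
    nlinarith [hτ.1]
  have h3 := (abs_le.1 (hF (τ • v) (by simpa [hnorm] using hsr))).1
  have h4 := hA (τ • v)
  have h5 := (abs_le.1 (abs_real_inner_le_norm g (τ • v))).1
  rw [hnorm] at h3 h4 h5
  have h6 : ‖g‖ * s ≤ b * s := mul_le_mul_of_nonneg_right hg hs0.le
  have h7 : b * s = a * s ^ 2 / 8 := by rw [hs]; field_simp
  have h8 : L * s ^ 3 ≤ a / 4 * s ^ 2 := by
    calc L * s ^ 3 = L * s * s ^ 2 := by ring
      _ ≤ _ := mul_le_mul_of_nonneg_right hL (sq_nonneg s)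
  nlinarith [mul_pos ha (pow_pos hs0 2)]

/-- The minimiser is interior, so g + G v = 0, whence A(v − u) = −(G v − A v). Coercivity of A turns
the quadratic bound on the right into a relative error. -/
lemma norm_sub_le_of_isMinOn [CompleteSpace E] {V : Set E} {r a s L : ℝ} {F : E → ℝ} {G : E → E}
    {A : E →L[ℝ] E} {g v u : E} (hV : Metric.ball 0 r ⊆ V) (ha : 0 < a) (hsr : s ≤ r) (hL : 0 ≤ L)
    (hgrad : ∀ w ∈ Metric.ball (0 : E) r, HasGradientAt F (G w) w)
    (hG : ∀ w ∈ Metric.ball (0 : E) r, ‖G w - A w‖ ≤ L * ‖w‖ ^ 2)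
    (hA : ∀ w, a * ‖w‖ ^ 2 ≤ inner ℝ (A w) w) (hu : A u = -g) (hvs : ‖v‖ < s)
    (hmin : ∀ w ∈ V, inner ℝ g v + F v ≤ inner ℝ g w + F w) : ‖v - u‖ ≤ L * s / a * ‖v‖ := by
  have hvr : v ∈ Metric.ball (0 : E) r := by simpa using hvs.trans_le hsr
  have hlin : HasFDerivAt (fun w => inner ℝ g w) (innerSL ℝ g) v := (innerSL ℝ g).hasFDerivAt
  have hder := hlin.add (hgrad v hvr).hasFDerivAt
  have hloc : IsLocalMin (fun w => inner ℝ g w + F w) v := by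
    filter_upwards [Metric.isOpen_ball.mem_nhds hvr] with w hw using hmin w (hV hw)
  have hzero := hloc.hasFDerivAt_eq_zero hder
  have hsum : g + G v = 0 := by
    refine ext_inner_right ℝ fun w => ?_
    have := congrArg (fun f : E →L[ℝ] ℝ => f w) hzero
    simpa [inner_add_left] using this
  have hdiff : A (v - u) = -(G v - A v) := by
    rw [map_sub, hu, eq_neg_of_add_eq_zero_left hsum]
    abel
  have h1 : a * ‖v - u‖ ^ 2 ≤ L * ‖v‖ ^ 2 * ‖v - u‖ := by
    refine (hA (v - u)).trans ((real_inner_le_norm _ _).trans ?_)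
    rw [hdiff, norm_neg]
    exact mul_le_mul_of_nonneg_right (hG v hvr) (norm_nonneg _)
  have h2 : a * ‖v - u‖ ≤ L * ‖v‖ ^ 2 := by
    rcases (norm_nonneg (v - u)).eq_or_lt with h | h
    · rw [← h, mul_zero]; positivity
    · refine le_of_mul_le_mul_right ?_ h
      linarith
  have h3 : L * ‖v‖ ^ 2 ≤ L * s * ‖v‖ := by
    rw [pow_two, ← mul_assoc]
    exact mul_le_mul_of_nonneg_right (mul_le_mul_of_nonneg_left hvs.le hL) (norm_nonneg _)
  rw [div_mul_eq_mul_div, le_div_iff₀ ha]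
  linarith

end Localisation

/-- Here f = (1 ± 2η)‖v‖²/2 and ‖u‖ = (1 ± η)‖v‖. The factor 8 absorbs both errors, since (1 − 8η)(1
+ η)² ≤ 1 − 2η and 1 + 2η ≤ (1 + 8η)(1 − η)² for 0 ≤ η ≤ 1/8. -/
lemma value_bounds_of_norm_sub_le {E : Type*} [SeminormedAddCommGroup E] {L s η f : ℝ}
    {v u : E} (hη : η ≤ 1 / 8) (hL : 0 ≤ L)
    (hLs : L * s ≤ η) (hvs : ‖v‖ ≤ s) (hvu : ‖v - u‖ ≤ η * ‖v‖)
    (hf : |f - ‖v‖ ^ 2 / 2| ≤ L * ‖v‖ ^ 3) :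
    (1 - 8 * η) * (‖u‖ ^ 2 / 2) ≤ f ∧ f ≤ (1 + 8 * η) * (‖u‖ ^ 2 / 2) := by
  have hv := norm_nonneg v
  have hu := norm_nonneg u
  have hη0 : 0 ≤ η := (mul_nonneg hL (hv.trans hvs)).trans hLs
  have h1 : L * ‖v‖ ^ 3 ≤ η * ‖v‖ ^ 2 := by
    calc L * ‖v‖ ^ 3 = L * ‖v‖ * ‖v‖ ^ 2 := by ring
      _ ≤ η * ‖v‖ ^ 2 := mul_le_mul_of_nonneg_right
        ((mul_le_mul_of_nonneg_left hvs hL).trans hLs) (sq_nonneg _)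
  obtain ⟨h2, h3⟩ := abs_le.1 (hf.trans h1)
  have h4 : ‖u‖ ≤ (1 + η) * ‖v‖ := by
    have := norm_sub_norm_le u v
    rw [norm_sub_rev] at this
    linarith
  have h5 : (1 - η) * ‖v‖ ≤ ‖u‖ := by
    have := norm_sub_norm_le v u
    linarith
  have h6 : ‖u‖ ^ 2 ≤ (1 + η) ^ 2 * ‖v‖ ^ 2 := by
    rw [← mul_pow]; exact pow_le_pow_left₀ hu h4 2
  have h7 : (1 - η) ^ 2 * ‖v‖ ^ 2 ≤ ‖u‖ ^ 2 := by
    rw [← mul_pow]; exact pow_le_pow_left₀ (mul_nonneg (by linarith) hv) h5 2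
  have hv2 := sq_nonneg ‖v‖
  constructor
  · have h8 : (1 - 8 * η) * ‖u‖ ^ 2 ≤ (1 - 8 * η) * ((1 + η) ^ 2 * ‖v‖ ^ 2) :=
      mul_le_mul_of_nonneg_left h6 (by linarith)
    have h9 : (1 - 8 * η) * (1 + η) ^ 2 ≤ 1 - 2 * η := by
      nlinarith [mul_nonneg hη0 hη0, mul_nonneg (mul_nonneg hη0 hη0) hη0]
    nlinarith [mul_le_mul_of_nonneg_right h9 hv2]
  · have h8 : (1 + 8 * η) * ((1 - η) ^ 2 * ‖v‖ ^ 2) ≤ (1 + 8 * η) * ‖u‖ ^ 2 :=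
      mul_le_mul_of_nonneg_left h7 (by linarith)
    have h9 : 1 + 2 * η ≤ (1 + 8 * η) * (1 - η) ^ 2 := by
      nlinarith [mul_nonneg hη0 hη0, mul_nonneg (mul_nonneg hη0 hη0) hη0]
    nlinarith [mul_le_mul_of_nonneg_right h9 hv2]

/-! ### Traces of inverse matrices -/

section TraceInv

variable {d : ℕ} {S G : Matrix (Fin d) (Fin d) ℝ}

/-- Expand 0 ≤ tr (S⁻¹ − cG⁻¹) S (S⁻¹ − cG⁻¹)ᴴ. For c = 1/K this is the tangent plane at KG of the
convex function S ↦ tr S⁻¹. -/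
lemma two_mul_trace_inv_le (hS : S.PosDef) (hG : G.PosDef) (c : ℝ) :
    2 * c * G⁻¹.trace - c ^ 2 * (G⁻¹ * S * G⁻¹).trace ≤ S⁻¹.trace := by
  have hSi : S⁻¹ᴴ = S⁻¹ := hS.inv.isHermitian.eq
  have hGi : G⁻¹ᴴ = G⁻¹ := hG.inv.isHermitian.eq
  have h := (hS.posSemidef.mul_mul_conjTranspose_same (S⁻¹ - c • G⁻¹)).trace_nonneg
  have hu : IsUnit S.det := (Matrix.isUnit_iff_isUnit_det S).1 hS.isUnit
  have e : (S⁻¹ - c • G⁻¹) * S * (S⁻¹ - c • G⁻¹)ᴴ =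
      S⁻¹ - c • G⁻¹ - (c • G⁻¹ - (c ^ 2) • (G⁻¹ * S * G⁻¹)) := by
    rw [Matrix.conjTranspose_sub, Matrix.conjTranspose_smul, hSi, hGi, star_trivial, sub_mul,
      sub_mul, mul_sub, mul_sub, Matrix.nonsing_inv_mul _ hu, one_mul, one_mul, smul_mul_assoc,
      smul_mul_assoc, smul_mul_assoc, mul_assoc G⁻¹ S S⁻¹, Matrix.mul_nonsing_inv _ hu, mul_one,
      mul_smul_comm, smul_smul, pow_two]
  rw [e] at h
  simp only [Matrix.trace_sub, Matrix.trace_smul, smul_eq_mul] at h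
  linarith

/-- Conjugating S − cG by S⁻¹ gives c·tr(S⁻¹GS⁻¹) ≤ tr S⁻¹. This is inserted into the tangent
inequality with S and G exchanged. -/
lemma trace_inv_le_of_posSemidef_sub (hS : S.PosDef) (hG : G.PosDef) {c : ℝ} (hc : 0 < c)
    (h : (S - c • G).PosSemidef) : S⁻¹.trace ≤ c⁻¹ * G⁻¹.trace := by
  have hSi : S⁻¹ᴴ = S⁻¹ := hS.inv.isHermitian.eq
  have h1 := two_mul_trace_inv_le hG hS c
  have h2 := (h.mul_mul_conjTranspose_same S⁻¹).trace_nonneg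
  have hu : IsUnit S.det := (Matrix.isUnit_iff_isUnit_det S).1 hS.isUnit
  rw [hSi, mul_sub, sub_mul, Matrix.nonsing_inv_mul _ hu, one_mul, mul_smul_comm, smul_mul_assoc,
    Matrix.trace_sub, Matrix.trace_smul, smul_eq_mul] at h2
  rw [inv_mul_eq_div, le_div_iff₀ hc]
  nlinarith

end TraceInv

/-! ### Independent labels given the sampled positions -/

section Mixture

variable {ι 𝒴 : Type*} [Fintype ι] [MeasurableSpace ι] [MeasurableSpace 𝒴]

/-- The law of an i.i.d. sample of pairs is the mixture, over the positions, of products of label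
laws. -/
lemma pi_sum_smul_map_prodMk {w : ι → ℝ} (hw : ∀ i, 0 ≤ w i) (law : ι → Measure 𝒴)
    [∀ i, IsProbabilityMeasure (law i)] (K : ℕ) :
    Measure.pi (fun _ : Fin K => ∑ i, ENNReal.ofReal (w i) • (law i).map (Prod.mk i)) =
      ∑ x : Fin K → ι, ENNReal.ofReal (∏ k, w (x k)) •
        (Measure.pi fun k => law (x k)).map fun y k => (x k, y k) := by
  classical
  have hfin : ∀ i, IsFiniteMeasure (ENNReal.ofReal (w i) • (law i).map (Prod.mk i)) := fun i =>
    Measure.smul_finite _ ENNReal.ofReal_ne_top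
  refine Measure.pi_eq fun s hs => ?_
  have hmeas : ∀ x : Fin K → ι, Measurable fun (y : Fin K → 𝒴) (k : Fin K) => (x k, y k) :=
    fun x => measurable_pi_lambda _ fun k => measurable_const.prodMk (measurable_pi_apply k)
  simp only [Measure.coe_finsetSum, Measure.coe_smul, Finset.sum_apply, Pi.smul_apply, smul_eq_mul]
  rw [Finset.prod_univ_sum]
  rw [Fintype.piFinset_univ]
  refine Finset.sum_congr rfl fun x _ => ?_
  rw [Finset.prod_mul_distrib, ENNReal.ofReal_prod_of_nonneg fun k _ => hw _,
    Measure.map_apply (hmeas x) (MeasurableSet.univ_pi hs)]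
  congr 1
  have : (fun (y : Fin K → 𝒴) (k : Fin K) => (x k, y k)) ⁻¹' Set.univ.pi s =
      Set.univ.pi fun k => Prod.mk (x k) ⁻¹' s k := by
    ext y; simp
  rw [this, Measure.pi_pi]
  exact Finset.prod_congr rfl fun k _ => (Measure.map_apply measurable_prodMk_left (hs k)).symm

/-- Conditioning on the positions: an expectation over the sample becomes a finite weighted sum of
integrals against products of label laws. -/
lemma integral_sample_eq_sum [MeasurableSingletonClass ι] {Ω : Type*} [MeasurableSpace Ω] {P : Measure Ω}
    {w : ι → ℝ}
    (hw : ∀ i, 0 ≤ w i) (law : ι → Measure 𝒴) [∀ i, IsProbabilityMeasure (law i)] {K : ℕ}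
    {Z : Ω → Fin K → ι × 𝒴} (hZ : Measurable Z)
    (hlaw : P.map Z =
      Measure.pi (fun _ : Fin K => ∑ i, ENNReal.ofReal (w i) • (law i).map (Prod.mk i)))
    {ψ : (Fin K → ι) → (Fin K → 𝒴) → ℝ} (hψ : ∀ x, Measurable (ψ x))
    (hint : ∀ x, Integrable (ψ x) (Measure.pi fun k => law (x k))) :
    Integrable (fun ω => ψ (fun k => (Z ω k).1) fun k => (Z ω k).2) P ∧
      ∫ ω, ψ (fun k => (Z ω k).1) (fun k => (Z ω k).2) ∂P =
        ∑ x : Fin K → ι, (∏ k, w (x k)) * ∫ y, ψ x y ∂Measure.pi fun k => law (x k) := by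
  set Ψ : (Fin K → ι × 𝒴) → ℝ := fun z => ψ (fun k => (z k).1) fun k => (z k).2
  have hΨ : Measurable Ψ := by
    -- There are only finitely many position vectors, so measurability in the labels for each of
    -- them gives joint measurability.
    have h1 : Measurable fun p : (Fin K → 𝒴) × (Fin K → ι) => ψ p.2 p.1 :=
      measurable_from_prod_countable_left fun x => hψ x
    have h2 : Measurable fun z : Fin K → ι × 𝒴 =>
        ((fun k => (z k).2, fun k => (z k).1) : (Fin K → 𝒴) × (Fin K → ι)) := by
      fun_prop
    exact h1.comp h2
  have hmeas : ∀ x : Fin K → ι, Measurable fun (y : Fin K → 𝒴) (k : Fin K) => (x k, y k) :=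
    fun x => measurable_pi_lambda _ fun k => measurable_const.prodMk (measurable_pi_apply k)
  rw [pi_sum_smul_map_prodMk hw] at hlaw
  have hpiece : ∀ x : Fin K → ι, Integrable Ψ (ENNReal.ofReal (∏ k, w (x k)) •
      (Measure.pi fun k => law (x k)).map fun y k => (x k, y k)) := by
    intro x
    refine Integrable.smul_measure ?_ ENNReal.ofReal_ne_top
    exact (integrable_map_measure hΨ.aestronglyMeasurable (hmeas x).aemeasurable).2 (hint x)
  have hI : Integrable Ψ (P.map Z) := by
    rw [hlaw]
    exact integrable_finsetSum_measure.2 fun x _ => hpiece x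
  refine ⟨(integrable_map_measure hΨ.aestronglyMeasurable hZ.aemeasurable).1 hI, ?_⟩
  have e1 : ∫ ω, Ψ (Z ω) ∂P = ∫ z, Ψ z ∂(P.map Z) :=
    (integral_map hZ.aemeasurable hΨ.aestronglyMeasurable).symm
  change ∫ ω, Ψ (Z ω) ∂P = _
  rw [e1, hlaw, integral_finsetSum_measure fun x _ => hpiece x]
  refine Finset.sum_congr rfl fun x _ => ?_
  rw [integral_smul_measure, integral_map (hmeas x).aemeasurable hΨ.aestronglyMeasurable,
    ENNReal.toReal_ofReal (Finset.prod_nonneg fun k _ => hw _), smul_eq_mul]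

end Mixture

/-! ### Second moments of sums of independent centred vectors. -/

section SecondMoment

variable {d : ℕ} {𝒴 : Type*} [MeasurableSpace 𝒴]

lemma integral_sq_sum_pi {K : ℕ} (μ : Fin K → Measure 𝒴) [∀ k, IsProbabilityMeasure (μ k)]
    {X : Fin K → 𝒴 → ℝ} (hX : ∀ k, MemLp (X k) 2 (μ k)) (h0 : ∀ k, ∫ y, X k y ∂μ k = 0) :
    ∫ y, (∑ k, X k (y k)) ^ 2 ∂Measure.pi μ = ∑ k, ∫ y, X k y ^ 2 ∂μ k := by
  have hint : ∀ k, Integrable (fun y : Fin K → 𝒴 => X k (y k)) (Measure.pi μ) := fun k =>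
    (measurePreserving_eval μ k).integrable_comp_of_integrable ((hX k).integrable one_le_two)
  have hmean : ∀ k, ∫ y : Fin K → 𝒴, X k (y k) ∂Measure.pi μ = 0 := by
    intro k
    rw [← h0 k, ← (measurePreserving_eval μ k).map_eq, integral_map
      (measurable_pi_apply k).aemeasurable]
    rw [(measurePreserving_eval μ k).map_eq]; exact (hX k).aestronglyMeasurable
  have hsum0 : ∫ y, (∑ k, fun y : Fin K → 𝒴 => X k (y k)) y ∂Measure.pi μ = 0 := by
    simp only [Finset.sum_apply]
    rw [integral_finsetSum _ fun k _ => hint k]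
    simp [hmean]
  have hae : AEMeasurable (∑ k, fun y : Fin K → 𝒴 => X k (y k)) (Measure.pi μ) :=
    Finset.aemeasurable_sum _ fun k _ => (hint k).aemeasurable
  have h := variance_sum_pi (μ := μ) hX
  rw [variance_of_integral_eq_zero hae hsum0] at h
  simp only [Finset.sum_apply] at h
  rw [h]
  exact Finset.sum_congr rfl fun k _ => variance_of_integral_eq_zero (hX k).aemeasurable (h0 k)

/-- Row by row: each coordinate of the image under Q is a sum of independent centred scalars, whose
variances add. -/
lemma integral_norm_sq_toEuclideanCLM_sum {L : ℝ} {K : ℕ} (μ : Fin K → Measure 𝒴)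
    [∀ k, IsProbabilityMeasure (μ k)] {g : Fin K → 𝒴 → EuclideanSpace ℝ (Fin d)}
    (hg : ∀ k, Measurable (g k)) (hb : ∀ k, ∀ᵐ y ∂μ k, ‖g k y‖ ≤ L)
    (h0 : ∀ k, ∫ y, g k y ∂μ k = 0) {T : Fin K → Matrix (Fin d) (Fin d) ℝ}
    (hT : ∀ k, ∀ v : EuclideanSpace ℝ (Fin d),
      ∫ y, inner ℝ v (g k y) ^ 2 ∂μ k = v.ofLp ⬝ᵥ T k *ᵥ v.ofLp)
    (Q : Matrix (Fin d) (Fin d) ℝ) :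
    Integrable (fun y => ‖Matrix.toEuclideanCLM (𝕜 := ℝ) Q (∑ k, g k (y k))‖ ^ 2)
      (Measure.pi μ) ∧
    ∫ y, ‖Matrix.toEuclideanCLM (𝕜 := ℝ) Q (∑ k, g k (y k))‖ ^ 2 ∂Measure.pi μ =
      (Q * (∑ k, T k) * Qᴴ).trace := by
  set q : Fin d → EuclideanSpace ℝ (Fin d) := fun a => WithLp.toLp 2 (Q a)
  have hgint : ∀ k, Integrable (g k) (μ k) := fun k =>
    Integrable.of_bound (hg k).aestronglyMeasurable L (hb k)
  have hLp : ∀ a k, MemLp (fun y => inner ℝ (q a) (g k y)) 2 (μ k) := by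
    intro a k
    refine MemLp.of_bound ((hgint k).const_inner (q a)).aestronglyMeasurable (‖q a‖ * L) ?_
    filter_upwards [hb k] with y hy
    exact (abs_real_inner_le_norm _ _).trans (mul_le_mul_of_nonneg_left hy (norm_nonneg _))
  have hLp' : ∀ a, MemLp (fun y : Fin K → 𝒴 => ∑ k, inner ℝ (q a) (g k (y k))) 2
      (Measure.pi μ) := by
    intro a
    refine memLp_finsetSum _ fun k _ => ?_
    exact (hLp a k).comp_measurePreserving (measurePreserving_eval μ k)
  have hnorm : ∀ y : Fin K → 𝒴, ‖Matrix.toEuclideanCLM (𝕜 := ℝ) Q (∑ k, g k (y k))‖ ^ 2 =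
      ∑ a, (∑ k, inner ℝ (q a) (g k (y k))) ^ 2 := by
    intro y
    rw [EuclideanSpace.real_norm_sq_eq]
    refine Finset.sum_congr rfl fun a _ => ?_
    rw [← inner_sum, Matrix.ofLp_toEuclideanCLM]
    congr 1
    simp [q, Matrix.mulVec, dotProduct, PiLp.inner_apply, mul_comm]
  simp only [hnorm]
  refine ⟨integrable_finsetSum _ fun a _ => (hLp' a).integrable_sq, ?_⟩
  rw [integral_finsetSum _ fun a _ => (hLp' a).integrable_sq]
  have hrow : ∀ a, ∫ y, (∑ k, inner ℝ (q a) (g k (y k))) ^ 2 ∂Measure.pi μ =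
      ∑ k, Q a ⬝ᵥ T k *ᵥ Q a := by
    intro a
    rw [integral_sq_sum_pi μ (hLp a) fun k => by
      rw [integral_inner (hgint k), h0 k, inner_zero_right]]
    exact Finset.sum_congr rfl fun k _ => hT k (q a)
  simp only [hrow]
  rw [Matrix.trace]
  refine Finset.sum_congr rfl fun a _ => ?_
  rw [← dotProduct_sum, ← Matrix.sum_mulVec, Matrix.diag_apply, Matrix.mul_assoc,
    Matrix.mul_apply_eq_vecMul]
  simp only [dotProduct, Matrix.vecMul, Matrix.mulVec, Matrix.mul_apply, Matrix.conjTranspose_apply,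
    star_trivial]

end SecondMoment

/-! ### Quadratic forms of matrices -/

section QuadraticForm

variable {d : ℕ}

lemma inner_toEuclideanCLM (A : Matrix (Fin d) (Fin d) ℝ) (v w : EuclideanSpace ℝ (Fin d)) :
    inner ℝ (Matrix.toEuclideanCLM (𝕜 := ℝ) A v) w = w.ofLp ⬝ᵥ A *ᵥ v.ofLp := by
  rw [EuclideanSpace.inner_eq_star_dotProduct, Matrix.ofLp_toEuclideanCLM, star_trivial]

lemma mul_norm_sq_le_inner_toEuclideanCLM {A : Matrix (Fin d) (Fin d) ℝ} {a : ℝ}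
    (h : (A - a • (1 : Matrix (Fin d) (Fin d) ℝ)).PosSemidef) (v : EuclideanSpace ℝ (Fin d)) :
    a * ‖v‖ ^ 2 ≤ inner ℝ (Matrix.toEuclideanCLM (𝕜 := ℝ) A v) v := by
  have h1 := h.dotProduct_mulVec_nonneg v.ofLp
  rw [star_trivial, Matrix.sub_mulVec, Matrix.smul_mulVec, Matrix.one_mulVec, dotProduct_sub,
    dotProduct_smul, smul_eq_mul] at h1
  have h2 : v.ofLp ⬝ᵥ v.ofLp = ‖v‖ ^ 2 := by
    rw [EuclideanSpace.real_norm_sq_eq, dotProduct]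
    exact Finset.sum_congr rfl fun i _ => (pow_two _).symm
  rw [inner_toEuclideanCLM]
  linarith [h2 ▸ h1]

lemma toEuclideanCLM_mul_apply (A B : Matrix (Fin d) (Fin d) ℝ) (v : EuclideanSpace ℝ (Fin d)) :
    Matrix.toEuclideanCLM (𝕜 := ℝ) A (Matrix.toEuclideanCLM (𝕜 := ℝ) B v) =
      Matrix.toEuclideanCLM (𝕜 := ℝ) (A * B) v := by
  rw [map_mul]; rfl

lemma toEuclideanCLM_inv_apply {A : Matrix (Fin d) (Fin d) ℝ} (hA : A.PosDef)
    (v : EuclideanSpace ℝ (Fin d)) :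
    Matrix.toEuclideanCLM (𝕜 := ℝ) A (Matrix.toEuclideanCLM (𝕜 := ℝ) A⁻¹ v) = v := by
  rw [toEuclideanCLM_mul_apply, Matrix.mul_nonsing_inv _
    ((Matrix.isUnit_iff_isUnit_det A).1 hA.isUnit), map_one]
  rfl

lemma posDef_of_posSemidef_sub_smul_one {A : Matrix (Fin d) (Fin d) ℝ} {a : ℝ} (ha : 0 < a)
    (h : (A - a • (1 : Matrix (Fin d) (Fin d) ℝ)).PosSemidef) : A.PosDef := by
  have := Matrix.PosDef.posSemidef_add h (Matrix.PosDef.one.smul ha)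
  simpa using this

lemma norm_toEuclideanCLM_inv_le {A : Matrix (Fin d) (Fin d) ℝ} {a : ℝ} (ha : 0 < a)
    (h : (A - a • (1 : Matrix (Fin d) (Fin d) ℝ)).PosSemidef) (v : EuclideanSpace ℝ (Fin d)) :
    ‖Matrix.toEuclideanCLM (𝕜 := ℝ) A⁻¹ v‖ ≤ ‖v‖ / a := by
  have hA := posDef_of_posSemidef_sub_smul_one ha h
  set u := Matrix.toEuclideanCLM (𝕜 := ℝ) A⁻¹ v
  have h1 := mul_norm_sq_le_inner_toEuclideanCLM h u
  rw [toEuclideanCLM_inv_apply hA] at h1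
  have h2 := real_inner_le_norm v u
  rw [le_div_iff₀ ha]
  rcases (norm_nonneg u).eq_or_lt with h0 | h0
  · rw [← h0, zero_mul]; exact norm_nonneg v
  · refine le_of_mul_le_mul_right ?_ h0
    linarith

end QuadraticForm

/-! ### Sums over configurations of positions -/

section Configurations

variable {ι : Type*} [Fintype ι] {w : ι → ℝ}

lemma sum_prod_eq_one (hw1 : ∑ i, w i = 1) (K : ℕ) : ∑ x : Fin K → ι, ∏ k, w (x k) = 1 := by
  classical
  have h := Finset.prod_univ_sum (fun _ : Fin K => (Finset.univ : Finset ι)) fun _ i => w i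
  rw [Fintype.piFinset_univ] at h
  rw [← h]
  simp [hw1]

lemma sum_prod_mul_sum (hw1 : ∑ i, w i = 1) (h : ι → ℝ) (K : ℕ) :
    ∑ x : Fin K → ι, (∏ k, w (x k)) * ∑ k, h (x k) = K * ∑ i, w i * h i := by
  induction K with
  | zero => simp
  | succ K ih =>
    rw [← (Fin.consEquiv fun _ : Fin (K + 1) => ι).sum_comp, Fintype.sum_prod_type]
    calc _ = ∑ i, (w i * h i * (∑ x : Fin K → ι, ∏ k, w (x k)) +
          w i * ∑ x : Fin K → ι, (∏ k, w (x k)) * ∑ k, h (x k)) := by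
          refine Finset.sum_congr rfl fun i _ => ?_
          rw [Finset.mul_sum, Finset.mul_sum, ← Finset.sum_add_distrib]
          refine Finset.sum_congr rfl fun x _ => ?_
          simp only [Fin.consEquiv_apply, Fin.prod_univ_succ, Fin.sum_univ_succ, Fin.cons_zero,
            Fin.cons_succ]
          ring
      _ = _ := by
          rw [ih, sum_prod_eq_one hw1, Finset.sum_add_distrib, ← Finset.sum_mul, ← Finset.sum_mul,
            hw1]
          push_cast
          ring

end Configurations

/-- An exponential-family model in normalised coordinates: labels with laws `law i`, scores `g i`
at the true parameter `0`, cumulant functions `F i` with gradients `Gr i`, and Hessians `T i` at `0`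
whose average is the identity. -/
structure NormalizedModel {N d : ℕ} {𝒴 : Type*} [MeasurableSpace 𝒴] (law : Fin N → Measure 𝒴)
    (g : Fin N → 𝒴 → EuclideanSpace ℝ (Fin d)) (T : Fin N → Matrix (Fin d) (Fin d) ℝ)
    (F : Fin N → EuclideanSpace ℝ (Fin d) → ℝ)
    (Gr : Fin N → EuclideanSpace ℝ (Fin d) → EuclideanSpace ℝ (Fin d))
    (V : Set (EuclideanSpace ℝ (Fin d))) (r D L₁ L₂ L₃ : ℝ) : Prop where
  measurable : ∀ i, Measurable (g i)
  norm_le : ∀ i, ∀ᵐ y ∂law i, ‖g i y‖ ≤ L₁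
  mean : ∀ i, ∫ y, g i y ∂law i = 0
  second_moment : ∀ i, ∀ v : EuclideanSpace ℝ (Fin d),
    ∫ y, inner ℝ v (g i y) ^ 2 ∂law i = v.ofLp ⬝ᵥ T i *ᵥ v.ofLp
  hermitian : ∀ i, (T i).IsHermitian
  le_smul_one : ∀ i, (L₂ • (1 : Matrix (Fin d) (Fin d) ℝ) - T i).PosSemidef
  average : ∑ i, (1 / N : ℝ) • T i = 1
  r_pos : 0 < r
  lip_nonneg : 0 ≤ L₃
  ball_subset : Metric.ball 0 r ⊆ V
  zero : ∀ i, F i 0 = 0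
  hasGradientAt : ∀ i, ∀ w ∈ Metric.ball (0 : EuclideanSpace ℝ (Fin d)) r,
    HasGradientAt (F i) (Gr i w) w
  gradient_sub_le : ∀ i, ∀ w ∈ Metric.ball (0 : EuclideanSpace ℝ (Fin d)) r,
    ‖Gr i w - Matrix.toEuclideanCLM (𝕜 := ℝ) (T i) w‖ ≤ L₃ * ‖w‖ ^ 2
  abs_sub_le : ∀ i, ∀ w ∈ Metric.ball (0 : EuclideanSpace ℝ (Fin d)) r,
    |F i w - inner ℝ (Matrix.toEuclideanCLM (𝕜 := ℝ) (T i) w) w / 2| ≤ L₃ * ‖w‖ ^ 3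
  map_smul_le : ∀ i, ∀ w ∈ V, ∀ τ ∈ Set.Icc (0 : ℝ) 1, F i (τ • w) ≤ τ * F i w
  nonneg : ∀ i, ∀ w ∈ V, 0 ≤ F i w
  average_le : ∀ w ∈ V, ∑ i, (1 / N : ℝ) * F i w ≤ D

/-! ### Structure of a normalised model and its minimisers. -/

namespace NormalizedModel

variable {N d : ℕ} {𝒴 : Type*} [MeasurableSpace 𝒴] {law : Fin N → Measure 𝒴}
  {g : Fin N → 𝒴 → EuclideanSpace ℝ (Fin d)} {T : Fin N → Matrix (Fin d) (Fin d) ℝ}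
  {F : Fin N → EuclideanSpace ℝ (Fin d) → ℝ}
  {Gr : Fin N → EuclideanSpace ℝ (Fin d) → EuclideanSpace ℝ (Fin d)}
  {V : Set (EuclideanSpace ℝ (Fin d))} {r D L₁ L₂ L₃ : ℝ}

lemma posSemidef (M : NormalizedModel law g T F Gr V r D L₁ L₂ L₃) (i : Fin N) :
    (T i).PosSemidef := by
  refine Matrix.PosSemidef.of_dotProduct_mulVec_nonneg (M.hermitian i) fun v => ?_
  have h := M.second_moment i (WithLp.toLp 2 v)
  rw [star_trivial]
  change _ = v ⬝ᵥ T i *ᵥ v at h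
  rw [← h]
  exact integral_nonneg fun y => sq_nonneg _

lemma N_pos (M : NormalizedModel law g T F Gr V r D L₁ L₂ L₃) (hd : 0 < d) : 0 < N := by
  rcases Nat.eq_zero_or_pos N with rfl | h
  · have h1 := congrArg (fun A : Matrix (Fin d) (Fin d) ℝ => A ⟨0, hd⟩ ⟨0, hd⟩) M.average
    simp at h1
  · exact h

/-- Summing the second moments over the coordinate directions, tr T i = E‖g i‖². -/
lemma trace_le [∀ i, IsProbabilityMeasure (law i)]
    (M : NormalizedModel law g T F Gr V r D L₁ L₂ L₃) (i : Fin N) : (T i).trace ≤ L₁ ^ 2 := by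
  have hgint : Integrable (g i) (law i) :=
    Integrable.of_bound (M.measurable i).aestronglyMeasurable L₁ (M.norm_le i)
  have hdiag : ∀ a, T i a a = ∫ y, (g i y a) ^ 2 ∂law i := by
    intro a
    have h := M.second_moment i (EuclideanSpace.single a 1)
    simp only [EuclideanSpace.inner_single_left, map_one, one_mul] at h
    rw [h]
    simp
  have hint : ∀ a, Integrable (fun y => (g i y a) ^ 2) (law i) := by
    intro a
    refine Integrable.of_bound (C := L₁ ^ 2) ?_ ?_
    · have : Measurable fun y => g i y a := by
        have := M.measurable i
        fun_prop
      exact (this.pow_const 2).aestronglyMeasurable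
    · filter_upwards [M.norm_le i] with y hy
      rw [Real.norm_of_nonneg (sq_nonneg _), ← sq_abs]
      exact pow_le_pow_left₀ (abs_nonneg _) ((PiLp.norm_apply_le (g i y) a).trans hy) 2
  have h1 : (T i).trace = ∫ y, ‖g i y‖ ^ 2 ∂law i := by
    simp only [Matrix.trace, Matrix.diag_apply, hdiag, EuclideanSpace.real_norm_sq_eq]
    exact (integral_finsetSum _ fun a _ => hint a).symm
  have h2 : Integrable (fun y => ‖g i y‖ ^ 2) (law i) := by
    simp only [EuclideanSpace.real_norm_sq_eq]
    exact integrable_finsetSum _ fun a _ => hint a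
  rw [h1]
  calc _ ≤ ∫ _, L₁ ^ 2 ∂law i := by
        refine integral_mono_ae h2 (integrable_const _) ?_
        filter_upwards [M.norm_le i] with y hy using pow_le_pow_left₀ (norm_nonneg _) hy 2
    _ = _ := by simp

/-- The trace of the averaged Hessian is d. This allows tr G⁻¹ ≤ d/C to be replaced by L₁²/C. -/
lemma dim_le_sq [∀ i, IsProbabilityMeasure (law i)]
    (M : NormalizedModel law g T F Gr V r D L₁ L₂ L₃) (hN : 0 < N) : (d : ℝ) ≤ L₁ ^ 2 := by
  have h := congrArg Matrix.trace M.average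
  rw [Matrix.trace_one, Fintype.card_fin, Matrix.trace_sum] at h
  simp only [Matrix.trace_smul, smul_eq_mul] at h
  rw [← h]
  have hN' : (N : ℝ) ≠ 0 := by exact_mod_cast hN.ne'
  calc _ ≤ ∑ _ : Fin N, (1 / N : ℝ) * L₁ ^ 2 :=
        Finset.sum_le_sum fun i _ => mul_le_mul_of_nonneg_left (M.trace_le i) (by positivity)
    _ = L₁ ^ 2 := by
        rw [Finset.sum_const, Finset.card_univ, Fintype.card_fin, nsmul_eq_mul]
        field_simp

lemma L₁_pos [∀ i, IsProbabilityMeasure (law i)]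
    (M : NormalizedModel law g T F Gr V r D L₁ L₂ L₃) (hd : 0 < d) : 0 < L₁ := by
  have h := M.dim_le_sq (M.N_pos hd)
  have hd' : (0 : ℝ) < d := by exact_mod_cast hd
  have hN := M.N_pos hd
  obtain ⟨y, hy⟩ := (M.norm_le ⟨0, hN⟩).exists
  have h0 : 0 ≤ L₁ := (norm_nonneg _).trans hy
  rcases h0.eq_or_lt with h1 | h1
  · rw [← h1] at h; norm_num at h; omega
  · exact h1

/-- The average of L₂·1 − T i is (L₂ − 1)·1. With √L₂ ≥ 1, smallness of the rate forces √(log(dK)/K)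
itself to be small. -/
lemma one_le_L₂ (M : NormalizedModel law g T F Gr V r D L₁ L₂ L₃) (hd : 0 < d) : 1 ≤ L₂ := by
  have hN := M.N_pos hd
  have hN' : (N : ℝ) ≠ 0 := by exact_mod_cast hN.ne'
  have h : (∑ i, (1 / N : ℝ) • (L₂ • (1 : Matrix (Fin d) (Fin d) ℝ) - T i)).PosSemidef :=
    Matrix.posSemidef_sum _ fun i _ => (M.le_smul_one i).smul (by positivity)
  have e : ∑ i, (1 / N : ℝ) • (L₂ • (1 : Matrix (Fin d) (Fin d) ℝ) - T i) =
      L₂ • (1 : Matrix (Fin d) (Fin d) ℝ) - 1 := by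
    simp only [smul_sub, Finset.sum_sub_distrib, M.average]
    congr 1
    rw [Finset.sum_const, Finset.card_univ, Fintype.card_fin, ← Nat.cast_smul_eq_nsmul ℝ, smul_smul,
      mul_one_div_cancel hN', one_smul]
  rw [e] at h
  have := h.diag_nonneg (i := ⟨0, hd⟩)
  simp at this
  linarith

/-- The values of the averaged cumulant function at an empirical minimiser, on the event that the
empirical Hessian is bounded below and the empirical score is small. -/
lemma value_bounds (M : NormalizedModel law g T F Gr V r D L₁ L₂ L₃) {K : ℕ} (hK : 0 < K)
    {x : Fin K → Fin N} {y : Fin K → 𝒴} {a b s η : ℝ} (ha : 0 < a) (ha1 : a ≤ 1) (hb : 0 < b)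
    (hs : s = 8 * b / a) (hsr : s < r) (hL : L₃ * s ≤ a / 4) (hη : L₃ * s / a = η)
    (hη8 : η ≤ 1 / 8)
    (hS : (∑ k, T (x k) - (K * a) • (1 : Matrix (Fin d) (Fin d) ℝ)).PosSemidef)
    (hg : ‖∑ k, g (x k) (y k)‖ ≤ K * b) {v : EuclideanSpace ℝ (Fin d)} (hv : v ∈ V)
    (hmin : ∀ w ∈ V, ∑ k, (inner ℝ (g (x k) (y k)) v + F (x k) v) ≤
      ∑ k, (inner ℝ (g (x k) (y k)) w + F (x k) w)) :
    (1 - 8 * η) *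
        (‖Matrix.toEuclideanCLM (𝕜 := ℝ) (∑ k, T (x k))⁻¹ (∑ k, g (x k) (y k))‖ ^ 2 / 2) ≤
      ∑ i, (1 / N : ℝ) * F i v ∧
    ∑ i, (1 / N : ℝ) * F i v ≤ (1 + 8 * η) *
        (‖Matrix.toEuclideanCLM (𝕜 := ℝ) (∑ k, T (x k))⁻¹ (∑ k, g (x k) (y k))‖ ^ 2 / 2) := by
  have hK' : (0 : ℝ) < K := by exact_mod_cast hK
  set S := ∑ k, T (x k) with hS_def
  set γ := ∑ k, g (x k) (y k)
  set A := Matrix.toEuclideanCLM (𝕜 := ℝ) ((K : ℝ)⁻¹ • S) with hA_def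
  set gbar := (K : ℝ)⁻¹ • γ
  set Fbar : EuclideanSpace ℝ (Fin d) → ℝ := fun w => (K : ℝ)⁻¹ * ∑ k, F (x k) w
  set Gbar : EuclideanSpace ℝ (Fin d) → EuclideanSpace ℝ (Fin d) := fun w =>
    (K : ℝ)⁻¹ • ∑ k, Gr (x k) w
  have hSpd : S.PosDef := posDef_of_posSemidef_sub_smul_one (by positivity) hS
  have hAapp : ∀ w, A w = (K : ℝ)⁻¹ • ∑ k, Matrix.toEuclideanCLM (𝕜 := ℝ) (T (x k)) w := by
    intro w
    rw [hA_def, map_smul, hS_def, map_sum]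
    simp
  have hcard : ∀ c : ℝ, (K : ℝ)⁻¹ * ∑ _ : Fin K, c = c := by
    intro c
    rw [Finset.sum_const, Finset.card_univ, Fintype.card_fin, nsmul_eq_mul,
      inv_mul_cancel_left₀ hK'.ne']
  have hAlow : ∀ w, a * ‖w‖ ^ 2 ≤ inner ℝ (A w) w := by
    refine mul_norm_sq_le_inner_toEuclideanCLM ?_
    have h := hS.smul (inv_pos.2 hK').le
    rwa [smul_sub, smul_smul, inv_mul_cancel_left₀ hK'.ne'] at h
  have hgb : ‖gbar‖ ≤ b := by
    rw [norm_smul, norm_inv, Real.norm_of_nonneg hK'.le, inv_mul_le_iff₀ hK']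
    exact hg
  have hmin' : ∀ w ∈ V, inner ℝ gbar v + Fbar v ≤ inner ℝ gbar w + Fbar w := by
    intro w hw
    have e : ∀ w, inner ℝ gbar w + Fbar w =
        (K : ℝ)⁻¹ * ∑ k, (inner ℝ (g (x k) (y k)) w + F (x k) w) := by
      intro w
      rw [real_inner_smul_left, sum_inner, Finset.sum_add_distrib, mul_add]
    rw [e, e]
    exact mul_le_mul_of_nonneg_left (hmin w hw) (inv_pos.2 hK').le
  have hFbar : ∀ w ∈ Metric.ball (0 : EuclideanSpace ℝ (Fin d)) r,
      |Fbar w - inner ℝ (A w) w / 2| ≤ L₃ * ‖w‖ ^ 3 := by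
    intro w hw
    have e : Fbar w - inner ℝ (A w) w / 2 = (K : ℝ)⁻¹ * ∑ k, (F (x k) w -
        inner ℝ (Matrix.toEuclideanCLM (𝕜 := ℝ) (T (x k)) w) w / 2) := by
      rw [hAapp, real_inner_smul_left, sum_inner, Finset.sum_sub_distrib, ← Finset.sum_div]
      ring
    rw [e, abs_mul, abs_of_pos (inv_pos.2 hK'), ← hcard (L₃ * ‖w‖ ^ 3)]
    refine mul_le_mul_of_nonneg_left ?_ (inv_pos.2 hK').le
    exact (Finset.abs_sum_le_sum_abs _ _).trans
      (Finset.sum_le_sum fun k _ => M.abs_sub_le (x k) w hw)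
  have hGbar : ∀ w ∈ Metric.ball (0 : EuclideanSpace ℝ (Fin d)) r,
      ‖Gbar w - A w‖ ≤ L₃ * ‖w‖ ^ 2 := by
    intro w hw
    rw [hAapp, ← smul_sub, ← Finset.sum_sub_distrib, norm_smul, norm_inv,
      Real.norm_of_nonneg hK'.le, ← hcard (L₃ * ‖w‖ ^ 2)]
    refine mul_le_mul_of_nonneg_left ?_ (inv_pos.2 hK').le
    exact (norm_sum_le _ _).trans (Finset.sum_le_sum fun k _ => M.gradient_sub_le (x k) w hw)
  have hgrad : ∀ w ∈ Metric.ball (0 : EuclideanSpace ℝ (Fin d)) r,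
      HasGradientAt Fbar (Gbar w) w := by
    intro w hw
    rw [hasGradientAt_iff_hasFDerivAt]
    have h := (HasFDerivAt.fun_sum fun k (_ : k ∈ Finset.univ) =>
      (M.hasGradientAt (x k) w hw).hasFDerivAt).const_mul (K : ℝ)⁻¹
    refine h.congr_fderiv ?_
    simp only [Gbar, map_smul, map_sum]
  have hconv : ∀ w ∈ V, ∀ τ ∈ Set.Icc (0 : ℝ) 1, Fbar (τ • w) ≤ τ * Fbar w := by
    intro w hw τ hτ
    have h := Finset.sum_le_sum fun k (_ : k ∈ Finset.univ) => M.map_smul_le (x k) w hw τ hτ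
    rw [← Finset.mul_sum] at h
    have := mul_le_mul_of_nonneg_left h (inv_pos.2 hK').le
    exact this.trans (le_of_eq (mul_left_comm _ _ _))
  have hvs : ‖v‖ < s := norm_lt_of_isMinOn_of_quadratic_growth M.ball_subset ha hb hs hsr hL
    (by simp [Fbar, M.zero]) hFbar hconv hAlow hgb hv hmin'
  -- The Newton step: the exact minimiser of the quadratic model of the empirical risk.
  set u := -Matrix.toEuclideanCLM (𝕜 := ℝ) S⁻¹ γ with hu_def
  have hu : A u = -gbar := by
    rw [hA_def, map_smul, smul_apply, hu_def, map_neg,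
      toEuclideanCLM_inv_apply hSpd, smul_neg]
  have hvu := norm_sub_le_of_isMinOn M.ball_subset ha hsr.le M.lip_nonneg hgrad hGbar hAlow hu hvs
    hmin'
  rw [hη] at hvu
  have hvr : v ∈ Metric.ball (0 : EuclideanSpace ℝ (Fin d)) r := by
    simpa using hvs.trans hsr
  -- Under uniform weights the Hessians average to the identity, so the quadratic part of the
  -- population risk is ‖v‖²/2.
  have hFU : |∑ i, (1 / N : ℝ) * F i v - ‖v‖ ^ 2 / 2| ≤ L₃ * ‖v‖ ^ 3 := by
    have hone : ‖v‖ ^ 2 = ∑ i, (1 / N : ℝ) *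
        inner ℝ (Matrix.toEuclideanCLM (𝕜 := ℝ) (T i) v) v := by
      have h := congrArg (fun B => inner ℝ (Matrix.toEuclideanCLM (𝕜 := ℝ) B v) v) M.average
      simp only [map_sum, map_smul, map_one, sum_apply,
        smul_apply, sum_inner, real_inner_smul_left] at h
      rw [h]
      exact (real_inner_self_eq_norm_sq v).symm
    have hN' : ∑ _ : Fin N, (1 / N : ℝ) ≤ 1 := by
      rw [Finset.sum_const, Finset.card_univ, Fintype.card_fin, nsmul_eq_mul, mul_one_div]
      exact div_self_le_one _
    rw [hone, Finset.sum_div, ← Finset.sum_sub_distrib]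
    calc _ ≤ ∑ i, |(1 / N : ℝ) * F i v -
          (1 / N : ℝ) * inner ℝ (Matrix.toEuclideanCLM (𝕜 := ℝ) (T i) v) v / 2| :=
          Finset.abs_sum_le_sum_abs _ _
      _ ≤ ∑ _ : Fin N, (1 / N : ℝ) * (L₃ * ‖v‖ ^ 3) := by
          refine Finset.sum_le_sum fun i _ => ?_
          rw [mul_div_assoc, ← mul_sub, abs_mul, abs_of_nonneg (by positivity : (0 : ℝ) ≤ 1 / N)]
          exact mul_le_mul_of_nonneg_left (M.abs_sub_le i v hvr) (by positivity)
      _ ≤ L₃ * ‖v‖ ^ 3 := by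
          rw [← Finset.sum_mul]
          exact mul_le_of_le_one_left (mul_nonneg M.lip_nonneg (by positivity)) hN'
  have hLs : L₃ * s ≤ η := by
    rw [← hη, le_div_iff₀ ha]
    refine mul_le_of_le_one_right (mul_nonneg M.lip_nonneg ?_) ha1
    exact (norm_nonneg v).trans hvs.le
  have h := value_bounds_of_norm_sub_le hη8 M.lip_nonneg hLs hvs.le hvu hFU
  rwa [hu_def, norm_neg] at h

lemma measurable_sum (M : NormalizedModel law g T F Gr V r D L₁ L₂ L₃) {K : ℕ}
    (x : Fin K → Fin N) : Measurable fun y : Fin K → 𝒴 => ∑ k, g (x k) (y k) :=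
  Finset.measurable_fun_sum _ fun k _ => (M.measurable (x k)).comp (measurable_pi_apply k)

end NormalizedModel

/-! ### Excess risk in normalised coordinates -/

lemma exp_neg_four_mul_log_le {d K : ℕ} (hd : 0 < d) (hK : 0 < K) :
    d * Real.exp (-(4 * Real.log (d * K))) ≤ 1 / (K : ℝ) ^ 4 := by
  have hd' : (1 : ℝ) ≤ d := by exact_mod_cast hd
  have hK' : (0 : ℝ) < K := by exact_mod_cast hK
  have h : Real.exp (-(4 * Real.log (d * K))) = 1 / ((d : ℝ) * K) ^ 4 := by
    rw [Real.exp_neg, one_div]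
    congr 1
    have : (4 : ℝ) * Real.log (d * K) = ((4 : ℕ) : ℝ) * Real.log (d * K) := by norm_num
    rw [this, Real.exp_nat_mul, Real.exp_log (by positivity)]
  rw [h, mul_one_div, div_le_div_iff₀ (by positivity) (by positivity), one_mul, mul_pow]
  refine mul_le_mul_of_nonneg_right ?_ (by positivity)
  exact le_self_pow₀ hd' (by norm_num)

set_option maxHeartbeats 1000000 in
/-- The numerical consequences of the two conditions on the sample size. -/
lemma sample_size_consequences {d K : ℕ} {C L₁ L₂ L₃ r : ℝ} (hK : 0 < K)
    (hdK : 2 ≤ d * K) (hC : 0 < C) (hC1 : C < 1) (hL₁ : 0 < L₁) (hL₂ : 1 ≤ L₂) (hL₃ : 0 ≤ L₃)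
    (hr : 0 < r) (h1 : L₁ * √(Real.log (d * K) / K) ≤ 1 / 100 * C * r)
    (h2 : gammaRate 10000 C L₁ L₂ L₃ d K < 1) :
    ∃ q ε s η : ℝ, 0 < q ∧ 2 * q ≤ 1 ∧ K * q ^ 2 = Real.log (d * K) ∧ 0 ≤ ε ∧ ε ≤ 1 / 2 ∧
      K * ε ^ 2 / (2 * (L₂ / C)) = 4 * Real.log (d * K) ∧ s = 8 * (4 * L₁ * q) / (C / 2) ∧
      s < r ∧ L₃ * s ≤ C / 2 / 4 ∧ L₃ * s / (C / 2) = η ∧ 0 ≤ η ∧ η ≤ 1 / 8 ∧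
      8 * η ≤ gammaRate 10000 C L₁ L₂ L₃ d K ∧
      (1 + 8 * η) ≤ (1 + gammaRate 10000 C L₁ L₂ L₃ d K) * (1 - ε) ∧ 8 ≤ C * K ^ 2 := by
  have hK' : (0 : ℝ) < K := by exact_mod_cast hK
  have hdK' : (2 : ℝ) ≤ d * K := by exact_mod_cast hdK
  -- This is where dK ≥ 2 enters: it keeps the logarithm away from 0.
  have hlog : 1 / 2 ≤ Real.log (d * K) := by
    have := Real.log_le_log (by norm_num) hdK'
    linarith [Real.log_two_gt_d9]
  set q := √(Real.log (d * K) / K) with hq_def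
  have hq : 0 < q := Real.sqrt_pos.2 (by positivity)
  have hq2 : K * q ^ 2 = Real.log (d * K) := by
    rw [hq_def, Real.sq_sqrt (by positivity)]; field_simp
  set γ := gammaRate 10000 C L₁ L₂ L₃ d K with hγ_def
  have hγ : γ * C ^ 2 = 10000 * (L₁ * L₃ * q) + 10000 * (√L₂ * q) := by
    rw [hγ_def, gammaRate, ← hq_def]; field_simp
  have hsL₂ : 1 ≤ √L₂ := Real.one_le_sqrt.2 hL₂
  have hC2 : 0 < C ^ 2 := by positivity
  have hC2' : C ^ 2 ≤ C := by nlinarith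
  set g1 := L₁ * L₃ * q / C ^ 2 with hg1
  set g2 := √L₂ * q / C ^ 2 with hg2
  have hg1_0 : 0 ≤ g1 := by positivity
  have hg2_0 : 0 ≤ g2 := by positivity
  have hγ' : γ = 10000 * g1 + 10000 * g2 := by
    rw [hg1, hg2]; field_simp; linarith
  have hqg2 : q ≤ C ^ 2 * g2 := by
    have : C ^ 2 * g2 = √L₂ * q := by rw [hg2]; field_simp
    rw [this]; nlinarith
  have hg2lt : g2 < 1 / 10000 := by linarith
  have hqlt : q < C ^ 2 / 10000 := by nlinarith
  -- Chosen so that the Chernoff exponent Kε²/(2L₂/C) equals 4 log(dK).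
  set ε := √(8 * (L₂ / C)) * q with hε_def
  have hε0 : 0 ≤ ε := by positivity
  have hε2 : ε ^ 2 = 8 * (L₂ / C) * q ^ 2 := by
    rw [hε_def, mul_pow, Real.sq_sqrt (by positivity)]
  have hεg : ε ≤ 3 * g2 := by
    refine le_of_sq_le_sq ?_ (by positivity)
    have e : (3 * g2) ^ 2 = 9 * (L₂ / C ^ 4) * q ^ 2 := by
      rw [hg2, mul_pow, div_pow, mul_pow, Real.sq_sqrt (by linarith)]; ring
    rw [hε2, e]
    refine mul_le_mul_of_nonneg_right ?_ (sq_nonneg q)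
    have h4 : C ^ 4 ≤ C := by
      have := pow_le_pow_of_le_one hC.le hC1.le (show 1 ≤ 4 by norm_num)
      simpa using this
    have : L₂ / C ≤ L₂ / C ^ 4 := div_le_div_of_nonneg_left (by linarith) (by positivity) h4
    have : 0 ≤ L₂ / C ^ 4 := by positivity
    linarith
  have hη : L₃ * (8 * (4 * L₁ * q) / (C / 2)) / (C / 2) = 128 * g1 := by
    rw [hg1]; field_simp; ring
  have hη8 : 128 * g1 ≤ 1 / 8 := by linarith
  refine ⟨q, ε, 8 * (4 * L₁ * q) / (C / 2), 128 * g1, hq, by nlinarith, hq2, hε0, by linarith, ?_,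
    rfl, ?_, ?_, hη, by positivity, hη8, by linarith, ?_, ?_⟩
  · rw [hε2, ← hq2]; field_simp; ring
  · have e : 8 * (4 * L₁ * q) / (C / 2) = 64 * (L₁ * q) / C := by field_simp; ring
    rw [e, div_lt_iff₀ hC]
    have := mul_pos hC hr
    linarith
  · have e : L₃ * (8 * (4 * L₁ * q) / (C / 2)) = 64 * C * g1 := by rw [hg1]; field_simp; ring
    rw [e]; nlinarith
  · rw [hγ']
    nlinarith [mul_nonneg hg1_0 hε0, mul_nonneg hg2_0 hε0]
  · have hq2lt : q ^ 2 < C ^ 4 / 10 ^ 8 := by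
      have := pow_lt_pow_left₀ hqlt hq.le (two_ne_zero)
      calc q ^ 2 < _ := this
        _ = _ := by ring
    -- Combine Kq² ≥ 1/2 with q² < C⁴/10⁸.
    have hCK : 10 ≤ C ^ 4 * K := by nlinarith
    have h4 : C ^ 4 ≤ C := by
      have := pow_le_pow_of_le_one hC.le hC1.le (show 1 ≤ 4 by norm_num)
      simpa using this
    have h5 : 10 ≤ C * K := hCK.trans (mul_le_mul_of_nonneg_right h4 hK'.le)
    have hK1 : (1 : ℝ) ≤ K := by exact_mod_cast hK
    nlinarith

/-- Two losses have to fit into 2·L²/(CK²) before the factor 1/2: the ill-conditioned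
configurations, of total weight p ≤ K⁻⁴, and the truncation of large scores. Both are of order K⁻⁴
up to powers of C, and `8 ≤ C * K ^ 2` absorbs them. -/
lemma lower_bound_arith {K C L τ p η γ : ℝ} (hK1 : 1 ≤ K) (hC : 0 < C) (hC1 : C < 1)
    (hCK : 8 ≤ C * K ^ 2) (hτ0 : 0 ≤ τ) (hτ : τ ≤ L ^ 2 / C) (hp0 : 0 ≤ p) (hp : p ≤ 1 / K ^ 4)
    (hη8 : η ≤ 1 / 8) (hηγ : 8 * η ≤ γ) (hη0 : 0 ≤ η) :
    (1 - γ) * (1 / 2 * τ / K) - L ^ 2 / (C * K ^ 2) ≤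
      (1 - 8 * η) / 2 * (2 / K * τ * (1 - p) - (1 / K) ^ 2 * (K * τ) -
        8 * L ^ 2 / (C ^ 2 * K ^ 4) * 1) := by
  have hK' : 0 < K := by linarith
  have e1 : (1 / K : ℝ) ^ 2 * (K * τ) = τ / K := by field_simp
  have e2 : 2 / K * τ * (1 - p) = 2 * (τ / K) - 2 * (τ / K) * p := by ring
  rw [e1, e2]
  set E := L ^ 2 / (C * K ^ 2) with hE
  have hE0 : 0 ≤ E := by positivity
  have hKK : (1 : ℝ) ≤ K ^ 2 := one_le_pow₀ hK1
  have h3 : 8 * L ^ 2 / (C ^ 2 * K ^ 4) ≤ E := by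
    rw [hE, div_le_div_iff₀ (by positivity) (by positivity)]
    have : 8 * (L ^ 2 * C * K ^ 2) ≤ (C * K ^ 2) * (L ^ 2 * C * K ^ 2) :=
      mul_le_mul_of_nonneg_right hCK (by positivity)
    nlinarith
  have h4 : 2 * (τ / K) * p ≤ E := by
    have hKK4 : (8 : ℝ) ≤ K ^ 2 := hCK.trans (mul_le_of_le_one_left (by positivity) hC1.le)
    have hτK : τ / K ≤ L ^ 2 / C := (div_le_self hτ0 hK1).trans hτ
    calc 2 * (τ / K) * p ≤ 2 * (L ^ 2 / C) * (1 / K ^ 4) := by gcongr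
      _ ≤ E := by
        rw [hE, mul_one_div, div_le_div_iff₀ (by positivity) (by positivity)]
        have e3 : 2 * (L ^ 2 / C) * (C * K ^ 2) = L ^ 2 * K ^ 2 * 2 := by field_simp
        rw [e3]
        have : L ^ 2 * K ^ 2 * 2 ≤ L ^ 2 * K ^ 2 * K ^ 2 :=
          mul_le_mul_of_nonneg_left (by linarith) (by positivity)
        nlinarith
  have hτK0 : 0 ≤ τ / K := by positivity
  have e5 : 1 / 2 * τ / K = (τ / K) / 2 := by ring
  rw [e5]
  have h6 : (1 - 8 * η) * (2 * E) ≤ 2 * E := mul_le_of_le_one_left (by positivity) (by linarith)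
  have h7 : (1 - γ) * (τ / K) ≤ (1 - 8 * η) * (τ / K) :=
    mul_le_mul_of_nonneg_right (by linarith) hτK0
  have h8 : (1 - 8 * η) * (τ / K - 2 * E) ≤ (1 - 8 * η) * (2 * (τ / K) - 2 * (τ / K) * p - τ / K -
      8 * L ^ 2 / (C ^ 2 * K ^ 4) * 1) := mul_le_mul_of_nonneg_left (by linarith) (by linarith)
  linarith

lemma upper_bound_arith {K C D p : ℝ} (hK1 : 1 ≤ K) (hC : 0 < C) (hC1 : C < 1)
    (hCK : 8 ≤ C * K ^ 2) (hD : 0 ≤ D) (hp : p ≤ 1 / K ^ 4) :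
    D * (2 / K ^ 4) + D * p ≤ D / K ^ 2 := by
  have hK' : 0 < K := by linarith
  have hKK4 : (8 : ℝ) ≤ K ^ 2 := hCK.trans (mul_le_of_le_one_left (by positivity) hC1.le)
  have h3 : D * p ≤ D * (1 / K ^ 4) := mul_le_mul_of_nonneg_left hp hD
  have h4 : D * (2 / K ^ 4) + D * (1 / K ^ 4) ≤ D / K ^ 2 := by
    have e : D * (2 / K ^ 4) + D * (1 / K ^ 4) = 3 * D / K ^ 4 := by ring
    rw [e, div_le_div_iff₀ (by positivity) (by positivity)]
    have : 3 * D * K ^ 2 ≤ K ^ 2 * D * K ^ 2 :=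
      mul_le_mul_of_nonneg_right (mul_le_mul_of_nonneg_right (by linarith) hD) (by positivity)
    nlinarith
  linarith

lemma sum_mul_affine {ι : Type*} [Fintype ι] (w b h : ι → ℝ) (c A B E : ℝ) :
    ∑ x, w x * (c * (A * (1 - b x) - B * h x - E)) =
      c * (A * (∑ x, w x - ∑ x, w x * b x) - B * (∑ x, w x * h x) - E * ∑ x, w x) := by
  simp only [Finset.mul_sum, ← Finset.sum_sub_distrib]
  exact Finset.sum_congr rfl fun x _ => by ring

namespace NormalizedModel

variable {N d : ℕ} {𝒴 : Type*} [MeasurableSpace 𝒴] {law : Fin N → Measure 𝒴}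
  [∀ i, IsProbabilityMeasure (law i)]
  {g : Fin N → 𝒴 → EuclideanSpace ℝ (Fin d)} {T : Fin N → Matrix (Fin d) (Fin d) ℝ}
  {F : Fin N → EuclideanSpace ℝ (Fin d) → ℝ}
  {Gr : Fin N → EuclideanSpace ℝ (Fin d) → EuclideanSpace ℝ (Fin d)}
  {V : Set (EuclideanSpace ℝ (Fin d))} {r D L₁ L₂ L₃ : ℝ}

/-- The covariance of the summed score is S itself, so S⁻¹γ has covariance S⁻¹SS⁻¹ = S⁻¹. -/
lemma integral_norm_sq_inv (M : NormalizedModel law g T F Gr V r D L₁ L₂ L₃) {K : ℕ}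
    {x : Fin K → Fin N} (hS : (∑ k, T (x k)).PosDef) :
    Integrable (fun y : Fin K → 𝒴 => ‖Matrix.toEuclideanCLM (𝕜 := ℝ) (∑ k, T (x k))⁻¹
      (∑ k, g (x k) (y k))‖ ^ 2) (Measure.pi fun k => law (x k)) ∧
    ∫ y, ‖Matrix.toEuclideanCLM (𝕜 := ℝ) (∑ k, T (x k))⁻¹ (∑ k, g (x k) (y k))‖ ^ 2
      ∂(Measure.pi fun k => law (x k)) = (∑ k, T (x k))⁻¹.trace := by
  have h := integral_norm_sq_toEuclideanCLM_sum (fun k => law (x k)) (g := fun k => g (x k))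
    (fun k => M.measurable _) (fun k => M.norm_le _) (fun k => M.mean _) (T := fun k => T (x k))
    (fun k => M.second_moment _) (∑ k, T (x k))⁻¹
  rw [hS.inv.isHermitian.eq, Matrix.nonsing_inv_mul _ ((Matrix.isUnit_iff_isUnit_det _).1 hS.isUnit),
    one_mul] at h
  exact h

lemma ae_norm_sum_le (M : NormalizedModel law g T F Gr V r D L₁ L₂ L₃) {K : ℕ}
    (x : Fin K → Fin N) :
    ∀ᵐ y ∂(Measure.pi fun k => law (x k)), ‖∑ k, g (x k) (y k)‖ ≤ K * L₁ := by
  have h : ∀ k, ∀ᵐ y ∂(Measure.pi fun k => law (x k)), ‖g (x k) (y k)‖ ≤ L₁ := fun k =>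
    (measurePreserving_eval (fun k => law (x k)) k).quasiMeasurePreserving.ae (M.norm_le (x k))
  filter_upwards [ae_all_iff.2 h] with y hy
  refine (norm_sum_le _ _).trans ((Finset.sum_le_sum fun k _ => hy k).trans (le_of_eq ?_))
  simp

/-- On a configuration with well-conditioned Hessian, the second moment of the linearised error
restricted to small scores. -/
lemma trace_inv_sub_le_integral (M : NormalizedModel law g T F Gr V r D L₁ L₂ L₃) {K : ℕ}
    (hK : 0 < K) {x : Fin K → Fin N} {a p : ℝ} (ha : 0 < a)
    (hS : (∑ k, T (x k) - (K * a) • (1 : Matrix (Fin d) (Fin d) ℝ)).PosSemidef)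
    {B : Set (Fin K → 𝒴)} (hB : MeasurableSet B)
    (hp : (Measure.pi fun k => law (x k)).real B ≤ p) :
    (∑ k, T (x k))⁻¹.trace - (L₁ / a) ^ 2 * p ≤
      ∫ y, Bᶜ.indicator (fun y => ‖Matrix.toEuclideanCLM (𝕜 := ℝ) (∑ k, T (x k))⁻¹
        (∑ k, g (x k) (y k))‖ ^ 2) y ∂(Measure.pi fun k => law (x k)) := by
  have hK' : (0 : ℝ) < K := by exact_mod_cast hK
  have hpd : (∑ k, T (x k)).PosDef := posDef_of_posSemidef_sub_smul_one (by positivity) hS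
  obtain ⟨hint, hval⟩ := M.integral_norm_sq_inv hpd
  set π := Measure.pi fun k => law (x k)
  set U : (Fin K → 𝒴) → ℝ := fun y => ‖Matrix.toEuclideanCLM (𝕜 := ℝ) (∑ k, T (x k))⁻¹
    (∑ k, g (x k) (y k))‖ ^ 2
  -- The summed score is at most KL₁ while S ⪰ Ka, so removing B costs at most (L₁/a)² times its
  -- probability.
  have hUle : ∀ᵐ y ∂π, U y ≤ (L₁ / a) ^ 2 := by
    filter_upwards [M.ae_norm_sum_le x] with y hy
    refine pow_le_pow_left₀ (norm_nonneg _) ?_ 2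
    refine (norm_toEuclideanCLM_inv_le (by positivity) hS _).trans ?_
    rw [div_le_div_iff₀ (by positivity) ha]
    nlinarith
  have hle : ∀ᵐ y ∂π, U y - (L₁ / a) ^ 2 * B.indicator 1 y ≤ Bᶜ.indicator U y := by
    filter_upwards [hUle] with y hy
    by_cases hyB : y ∈ B
    · simp [hyB, hy]
    · simp [hyB]
  have hind : Integrable (B.indicator (1 : (Fin K → 𝒴) → ℝ)) π :=
    (integrable_const (1 : ℝ)).indicator hB
  have h := integral_mono_ae (hint.sub (hind.const_mul _)) (hint.indicator hB.compl) hle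
  have e := integral_sub hint (hind.const_mul ((L₁ / a) ^ 2))
  rw [integral_const_mul, hval, integral_indicator_one hB] at e
  refine le_trans ?_ h
  refine le_trans ?_ e.ge
  exact sub_le_sub_left (mul_le_mul_of_nonneg_left hp (sq_nonneg _)) _

set_option maxHeartbeats 1000000 in
/-- The expected excess risk of the empirical minimiser, up to a relative error `γ`. -/
theorem excess_bounds (M : NormalizedModel law g T F Gr V r D L₁ L₂ L₃) (hd : 0 < d) {K : ℕ}
    (hK : 0 < K) {Γ : Fin N → ℝ} (hΓ : ∀ i, 0 ≤ Γ i) (hΓ1 : ∑ i, Γ i = 1) {C : ℝ} (hC : 0 < C)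
    (hC1 : C < 1) {G : Matrix (Fin d) (Fin d) ℝ} (hG : ∑ i, Γ i • T i = G)
    (hGC : (G - C • (1 : Matrix (Fin d) (Fin d) ℝ)).PosSemidef)
    (h1 : L₁ * √(Real.log (d * K) / K) ≤ 1 / 100 * C * r)
    (h2 : gammaRate 10000 C L₁ L₂ L₃ d K < 1) {Ω : Type*} [MeasurableSpace Ω] {P : Measure Ω}
    [IsProbabilityMeasure P] {Z : Ω → Fin K → Fin N × 𝒴} (hZ : Measurable Z)
    (hlaw : P.map Z =
      Measure.pi (fun _ : Fin K => ∑ i, ENNReal.ofReal (Γ i) • (law i).map (Prod.mk i)))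
    {v : Ω → EuclideanSpace ℝ (Fin d)}
    (hmeas : AEStronglyMeasurable (fun ω => ∑ i, (1 / N : ℝ) * F i (v ω)) P)
    (hv : ∀ᵐ ω ∂P, v ω ∈ V ∧ ∀ w ∈ V,
      ∑ k, (inner ℝ (g (Z ω k).1 (Z ω k).2) (v ω) + F (Z ω k).1 (v ω)) ≤
      ∑ k, (inner ℝ (g (Z ω k).1 (Z ω k).2) w + F (Z ω k).1 w)) :
    Integrable (fun ω => ∑ i, (1 / N : ℝ) * F i (v ω)) P ∧
    (1 - gammaRate 10000 C L₁ L₂ L₃ d K) * (1 / 2 * G⁻¹.trace / K) - L₁ ^ 2 / (C * K ^ 2) ≤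
      ∫ ω, ∑ i, (1 / N : ℝ) * F i (v ω) ∂P ∧
    ∫ ω, ∑ i, (1 / N : ℝ) * F i (v ω) ∂P ≤
      (1 + gammaRate 10000 C L₁ L₂ L₃ d K) * (1 / 2 * G⁻¹.trace / K) + D / K ^ 2 := by
  classical
  have hK' : (0 : ℝ) < K := by exact_mod_cast hK
  have hK1 : (1 : ℝ) ≤ K := by exact_mod_cast hK
  have hN := M.N_pos hd
  have hL₁ := M.L₁_pos hd
  have hL₂ := M.one_le_L₂ hd
  have hdim := M.dim_le_sq hN
  have hGpd : G.PosDef := posDef_of_posSemidef_sub_smul_one hC hGC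
  set R : Ω → ℝ := fun ω => ∑ i, (1 / N : ℝ) * F i (v ω)
  set γ := gammaRate 10000 C L₁ L₂ L₃ d K
  set τ := G⁻¹.trace
  have hτ0 : 0 ≤ τ := hGpd.inv.posSemidef.trace_nonneg
  have hτ : τ ≤ L₁ ^ 2 / C := by
    have h := trace_inv_le_of_posSemidef_sub hGpd Matrix.PosDef.one hC hGC
    rw [inv_one, Matrix.trace_one, Fintype.card_fin, inv_mul_eq_div] at h
    exact h.trans (div_le_div_of_nonneg_right hdim hC.le)
  have hR0 : ∀ᵐ ω ∂P, 0 ≤ R ω := by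
    filter_upwards [hv] with ω hω
    exact Finset.sum_nonneg fun i _ => mul_nonneg (by positivity) (M.nonneg i _ hω.1)
  have hRD : ∀ᵐ ω ∂P, R ω ≤ D := by
    filter_upwards [hv] with ω hω using M.average_le _ hω.1
  have hD : 0 ≤ D := by
    obtain ⟨ω, hω, hω'⟩ := (hR0.and hRD).exists
    exact hω.trans hω'
  have hRint : Integrable R P := by
    refine Integrable.of_bound hmeas D ?_
    filter_upwards [hR0, hRD] with ω hω hω'
    rwa [Real.norm_of_nonneg hω]
  refine ⟨hRint, ?_⟩
  have hI0 : 0 ≤ ∫ ω, R ω ∂P := integral_nonneg_of_ae hR0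
  have hID : ∫ ω, R ω ∂P ≤ D := by
    have := integral_mono_ae hRint (integrable_const D) hRD
    simpa using this
  -- For d = K = 1 the logarithm and hence the rate vanish. Both bounds then follow from 0 ≤ E R ≤ D
  -- and tr G⁻¹ ≤ L₁²/C.
  rcases Nat.lt_or_ge (d * K) 2 with hdK | hdK
  · have hd1 : d = 1 := by nlinarith
    have hK1' : K = 1 := by nlinarith
    have hγ : γ = 0 := by simp [γ, gammaRate, hd1, hK1']
    subst hK1'
    rw [hγ]
    simp only [Nat.cast_one, one_pow, div_one, mul_one, sub_zero, add_zero, one_mul]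
    have h0 : 0 ≤ L₁ ^ 2 / C := by positivity
    constructor
    · linarith
    · linarith
  obtain ⟨q, ε, s, η, hq, hq1, hq2, hε0, hε, hεlog, hs, hsr, hLs, hη, hη0, hη8, hηγ, hγε, hCK⟩ :=
    sample_size_consequences hK hdK hC hC1 hL₁ hL₂ M.lip_nonneg M.r_pos h1 h2
  set b := 4 * L₁ * q with hb_def
  have hb : 0 < b := by positivity
  set w : (Fin K → Fin N) → ℝ := fun x => ∏ k, Γ (x k)
  have hw0 : ∀ x, 0 ≤ w x := fun x => Finset.prod_nonneg fun k _ => hΓ _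
  have hw1 : ∑ x, w x = 1 := sum_prod_eq_one hΓ1 K
  set good : (Fin K → Fin N) → Prop := fun x => (∑ k, T (x k) - ((1 - ε) * K) • G).PosSemidef
  set bad : (Fin K → Fin N) → ℝ := fun x => if good x then 0 else 1
  have hbad0 : ∀ x, 0 ≤ bad x := fun x => by simp only [bad]; split_ifs <;> norm_num
  have hbad : ∑ x, w x * bad x ≤ 1 / K ^ 4 := by
    have h := sum_prod_not_posSemidef_le_of_posDef (R := L₂ / C) hΓ hΓ1 M.posSemidef hG hGpd
      (by positivity) (fun i => by
        have e : (L₂ / C) • G - T i = (L₂ / C) • (G - C • (1 : Matrix (Fin d) (Fin d) ℝ)) +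
            (L₂ • (1 : Matrix (Fin d) (Fin d) ℝ) - T i) := by
          rw [smul_sub, smul_smul, div_mul_cancel₀ _ hC.ne']; abel
        rw [e]
        exact (hGC.smul (by positivity)).add (M.le_smul_one i)) hε0 K
    rw [hεlog] at h
    refine le_trans (le_of_eq (Finset.sum_congr rfl fun x _ => ?_))
      (h.trans (exp_neg_four_mul_log_le hd hK))
    simp only [bad, good, w]
    split_ifs <;> simp
  set B : (Fin K → Fin N) → Set (Fin K → 𝒴) := fun x => {y | K * b ≤ ‖∑ k, g (x k) (y k)‖}
  have hBm : ∀ x, MeasurableSet (B x) := fun x =>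
    measurableSet_le measurable_const (M.measurable_sum x).norm
  have hBp : ∀ x, (Measure.pi fun k => law (x k)).real (B x) ≤ 2 / K ^ 4 := by
    intro x
    -- With s = 2q/L₁ and threshold 4KL₁q the exponent is 4Kq² − 8Kq² = −4 log(dK).
    have h := measureReal_le_norm_sum_le (L := L₁) (t := K * b) (s := 2 * q / L₁)
      (fun k => law (x k)) (fun k => g (x k)) (fun k => M.measurable _) (fun k => M.norm_le _)
      (fun k => M.mean _) (by positivity) (by rwa [div_mul_cancel₀ _ hL₁.ne'])
    have e : K * (2 * q / L₁ * L₁) ^ 2 - 2 * q / L₁ * (K * b) = -(4 * Real.log (d * K)) := by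
      rw [← hq2, hb_def]; field_simp; ring
    rw [e] at h
    refine h.trans ?_
    have h3 := exp_neg_four_mul_log_le hd hK
    have hd' : (1 : ℝ) ≤ d := by exact_mod_cast hd
    have h4 : Real.exp (-(4 * Real.log (d * K))) ≤ d * Real.exp (-(4 * Real.log (d * K))) :=
      le_mul_of_one_le_left (Real.exp_pos _).le hd'
    rw [show (2 : ℝ) / K ^ 4 = 2 * (1 / K ^ 4) by ring]
    linarith
  have hgoodS : ∀ x, good x →
      (∑ k, T (x k) - (K * (C / 2)) • (1 : Matrix (Fin d) (Fin d) ℝ)).PosSemidef := by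
    intro x hx
    have e : ∑ k, T (x k) - (K * (C / 2)) • (1 : Matrix (Fin d) (Fin d) ℝ) =
        (∑ k, T (x k) - ((1 - ε) * K) • G) +
          (((1 - ε) * K) • (G - C • (1 : Matrix (Fin d) (Fin d) ℝ)) +
          ((1 / 2 - ε) * K * C) • (1 : Matrix (Fin d) (Fin d) ℝ)) := by
      rw [smul_sub, smul_smul]; module
    rw [e]
    refine hx.add ((hGC.smul (mul_nonneg (by linarith) hK'.le)).add
      (Matrix.PosSemidef.one.smul ?_))
    exact mul_nonneg (mul_nonneg (by linarith) hK'.le) hC.le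
  have hgoodpd : ∀ x, good x → (∑ k, T (x k)).PosDef := fun x hx =>
    posDef_of_posSemidef_sub_smul_one (by positivity) (hgoodS x hx)
  set U : (Fin K → Fin N) → (Fin K → 𝒴) → ℝ := fun x y =>
    ‖Matrix.toEuclideanCLM (𝕜 := ℝ) (∑ k, T (x k))⁻¹ (∑ k, g (x k) (y k))‖ ^ 2 with hU_def
  have hUm : ∀ x, Measurable (U x) := fun x =>
    (((Matrix.toEuclideanCLM (𝕜 := ℝ) (∑ k, T (x k))⁻¹).continuous.measurable.comp
      (M.measurable_sum x)).norm).pow_const 2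
  have hval : ∀ᵐ ω ∂P, good (fun k => (Z ω k).1) →
      (fun k => (Z ω k).2) ∉ B (fun k => (Z ω k).1) →
      (1 - 8 * η) * (U (fun k => (Z ω k).1) (fun k => (Z ω k).2) / 2) ≤ R ω ∧
      R ω ≤ (1 + 8 * η) * (U (fun k => (Z ω k).1) (fun k => (Z ω k).2) / 2) := by
    filter_upwards [hv] with ω hω hx hy
    exact M.value_bounds hK (x := fun k => (Z ω k).1) (y := fun k => (Z ω k).2) (half_pos hC)
      (by linarith) hb hs hsr hLs hη hη8 (hgoodS _ hx) (not_le.1 hy).le hω.1 hω.2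
  constructor
  · -- the lower bound
    -- Since R ≥ 0, the exceptional event can be replaced by 0.
    set ψ : (Fin K → Fin N) → (Fin K → 𝒴) → ℝ := fun x y =>
      if good x then (1 - 8 * η) / 2 * (B x)ᶜ.indicator (U x) y else 0 with hψ_def
    have hψm : ∀ x, Measurable (ψ x) := by
      intro x
      by_cases hx : good x
      · simp only [hψ_def, hx, if_true]
        exact ((hUm x).indicator (hBm x).compl).const_mul _
      · simp only [hψ_def, hx, if_false]
        exact measurable_const
    have hψint : ∀ x, Integrable (ψ x) (Measure.pi fun k => law (x k)) := by
      intro x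
      by_cases hx : good x
      · simp only [hψ_def, hx, if_true]
        exact ((M.integral_norm_sq_inv (hgoodpd x hx)).1.indicator (hBm x).compl).const_mul _
      · simp only [hψ_def, hx, if_false]
        exact integrable_const _
    obtain ⟨hI, hIeq⟩ := integral_sample_eq_sum hΓ law hZ hlaw hψm hψint
    have hle : ∫ ω, ψ (fun k => (Z ω k).1) (fun k => (Z ω k).2) ∂P ≤ ∫ ω, R ω ∂P := by
      refine integral_mono_ae hI hRint ?_
      filter_upwards [hval, hR0] with ω hω hω0
      by_cases hx : good fun k => (Z ω k).1
      · by_cases hy : (fun k => (Z ω k).2) ∈ B fun k => (Z ω k).1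
        · simpa [hψ_def, hx, hy] using hω0
        · have := (hω hx hy).1
          simp only [hψ_def, hx, if_true, Set.indicator_of_mem (Set.mem_compl hy)]
          linarith
      · simpa [hψ_def, hx] using hω0
    refine le_trans ?_ hle
    rw [hIeq]
    -- The tangent inequality at KG on well-conditioned configurations. On the others the factor 1 −
    -- bad x removes the only positive term, so the left side is at most 0 and the trace term can
    -- stay for all x.
    have hx : ∀ x, (1 - 8 * η) / 2 * ((2 / K * τ) * (1 - bad x) -
        (1 / K) ^ 2 * (∑ k, (G⁻¹ * T (x k) * G⁻¹).trace) - 8 * L₁ ^ 2 / (C ^ 2 * K ^ 4)) ≤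
        ∫ y, ψ x y ∂Measure.pi fun k => law (x k) := by
      intro x
      have hconj : ∑ k, (G⁻¹ * T (x k) * G⁻¹).trace = (G⁻¹ * (∑ k, T (x k)) * G⁻¹).trace := by
        rw [Finset.mul_sum, Finset.sum_mul, Matrix.trace_sum]
      by_cases hx : good x
      · have hlow := M.trace_inv_sub_le_integral hK (half_pos hC) (hgoodS x hx) (hBm x) (hBp x)
        have htr := two_mul_trace_inv_le (hgoodpd x hx) hGpd (1 / K)
        have e8 : (L₁ / (C / 2)) ^ 2 * (2 / K ^ 4) = 8 * L₁ ^ 2 / (C ^ 2 * K ^ 4) := by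
          field_simp; ring
        rw [e8] at hlow
        simp only [hψ_def, hx, if_true, bad]
        rw [integral_const_mul, hconj]
        refine mul_le_mul_of_nonneg_left ?_ (by linarith)
        refine le_trans ?_ hlow
        have e2 : 2 * (1 / K : ℝ) * τ = 2 / K * τ := by ring
        linarith
      · simp only [hψ_def, hx, if_false, bad, integral_zero]
        refine mul_nonpos_of_nonneg_of_nonpos (by linarith) ?_
        have h3 : 0 ≤ ∑ k, (G⁻¹ * T (x k) * G⁻¹).trace := by
          refine Finset.sum_nonneg fun k _ => ?_
          have := ((M.posSemidef (x k)).mul_mul_conjTranspose_same G⁻¹).trace_nonneg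
          rwa [hGpd.inv.isHermitian.eq] at this
        have h4 : 0 ≤ (1 / K : ℝ) ^ 2 * ∑ k, (G⁻¹ * T (x k) * G⁻¹).trace :=
          mul_nonneg (sq_nonneg _) h3
        have h5 : 0 ≤ 8 * L₁ ^ 2 / (C ^ 2 * K ^ 4) := by positivity
        linarith
    refine le_trans ?_ (Finset.sum_le_sum fun x _ => mul_le_mul_of_nonneg_left (hx x) (hw0 x))
    -- E S = KG, so the linear term averages exactly; this completes Jensen's inequality.
    have htrsum : ∑ x, w x * ∑ k, (G⁻¹ * T (x k) * G⁻¹).trace = K * τ := by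
      rw [sum_prod_mul_sum hΓ1 (fun i => (G⁻¹ * T i * G⁻¹).trace) K]
      congr 1
      have e : ∑ i, Γ i * (G⁻¹ * T i * G⁻¹).trace = (G⁻¹ * (∑ i, Γ i • T i) * G⁻¹).trace := by
        rw [Finset.mul_sum, Finset.sum_mul, Matrix.trace_sum]
        simp
      rw [e, hG, Matrix.nonsing_inv_mul _ ((Matrix.isUnit_iff_isUnit_det _).1 hGpd.isUnit), one_mul]
    rw [sum_mul_affine, htrsum, hw1]
    set p := ∑ x, w x * bad x
    have hp0 : 0 ≤ p := Finset.sum_nonneg fun x _ => mul_nonneg (hw0 x) (hbad0 x)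
    exact lower_bound_arith hK1 hC hC1 hCK hτ0 hτ hp0 hbad hη8 hηγ hη0
  · -- the upper bound
    -- On the exceptional event the risk is bounded by its maximum D.
    set ψ : (Fin K → Fin N) → (Fin K → 𝒴) → ℝ := fun x y =>
      if good x then (1 + 8 * η) / 2 * U x y + D * (B x).indicator 1 y else D with hψ_def
    have hψm : ∀ x, Measurable (ψ x) := by
      intro x
      by_cases hx : good x
      · simp only [hψ_def, hx, if_true]
        exact ((hUm x).const_mul _).add ((measurable_one.indicator (hBm x)).const_mul _)
      · simp only [hψ_def, hx, if_false]
        exact measurable_const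
    have hind : ∀ x, Integrable ((B x).indicator (1 : (Fin K → 𝒴) → ℝ))
        (Measure.pi fun k => law (x k)) := fun x => (integrable_const (1 : ℝ)).indicator (hBm x)
    have hψint : ∀ x, Integrable (ψ x) (Measure.pi fun k => law (x k)) := by
      intro x
      by_cases hx : good x
      · simp only [hψ_def, hx, if_true]
        exact ((M.integral_norm_sq_inv (hgoodpd x hx)).1.const_mul _).add ((hind x).const_mul _)
      · simp only [hψ_def, hx, if_false]
        exact integrable_const _
    obtain ⟨hI, hIeq⟩ := integral_sample_eq_sum hΓ law hZ hlaw hψm hψint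
    have hle : ∫ ω, R ω ∂P ≤ ∫ ω, ψ (fun k => (Z ω k).1) (fun k => (Z ω k).2) ∂P := by
      refine integral_mono_ae hRint hI ?_
      filter_upwards [hval, hRD] with ω hω hωD
      by_cases hx : good fun k => (Z ω k).1
      · simp only [hψ_def, hx, if_true]
        by_cases hy : (fun k => (Z ω k).2) ∈ B fun k => (Z ω k).1
        · rw [Set.indicator_of_mem hy, Pi.one_apply, mul_one]
          have : 0 ≤ (1 + 8 * η) / 2 * U (fun k => (Z ω k).1) (fun k => (Z ω k).2) :=
            mul_nonneg (by linarith) (sq_nonneg _)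
          linarith
        · rw [Set.indicator_of_notMem hy, mul_zero, add_zero]
          have := (hω hx hy).2
          linarith
      · simpa [hψ_def, hx] using hωD
    refine hle.trans ?_
    rw [hIeq]
    have hx : ∀ x, ∫ y, ψ x y ∂(Measure.pi fun k => law (x k)) ≤
        (1 + γ) * (1 / 2 * τ / K) + D * (2 / K ^ 4) + D * bad x := by
      intro x
      have hγ0 : 0 ≤ 1 + γ := by linarith
      have h0 : 0 ≤ (1 + γ) * (1 / 2 * τ / K) := by positivity
      have h0' : 0 ≤ D * (2 / K ^ 4) := by positivity
      by_cases hx : good x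
      · obtain ⟨hi, he⟩ := M.integral_norm_sq_inv (hgoodpd x hx)
        have htr := trace_inv_le_of_posSemidef_sub (hgoodpd x hx) hGpd
          (mul_pos (by linarith : 0 < 1 - ε) hK') hx
        simp only [hψ_def, hx, if_true, bad]
        rw [integral_add (hi.const_mul _) ((hind x).const_mul _), integral_const_mul,
          integral_const_mul, he, integral_indicator_one (hBm x), mul_zero, add_zero]
        refine add_le_add ?_ (mul_le_mul_of_nonneg_left (hBp x) hD)
        calc _ ≤ (1 + 8 * η) / 2 * (((1 - ε) * K)⁻¹ * τ) :=
              mul_le_mul_of_nonneg_left htr (by linarith)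
          _ ≤ ((1 + γ) * (1 - ε)) / 2 * (((1 - ε) * K)⁻¹ * τ) := by
              refine mul_le_mul_of_nonneg_right (by linarith) ?_
              exact mul_nonneg (inv_nonneg.2 (mul_nonneg (by linarith) hK'.le)) hτ0
          _ = _ := by
              have : 1 - ε ≠ 0 := by linarith
              field_simp
      · simp only [hψ_def, hx, if_false, bad, mul_one]
        rw [integral_const, probReal_univ, one_smul]
        linarith
    refine (Finset.sum_le_sum fun x _ => mul_le_mul_of_nonneg_left (hx x) (hw0 x)).trans ?_
    have hsum : ∑ x, w x * ((1 + γ) * (1 / 2 * τ / K) + D * (2 / K ^ 4) + D * bad x) =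
        ((1 + γ) * (1 / 2 * τ / K) + D * (2 / K ^ 4)) * ∑ x, w x + D * ∑ x, w x * bad x := by
      rw [Finset.mul_sum, Finset.mul_sum, ← Finset.sum_add_distrib]
      exact Finset.sum_congr rfl fun x _ => by ring
    rw [hsum, hw1, mul_one]
    have h3 := upper_bound_arith hK1 hC hC1 hCK hD hbad
    linarith

end NormalizedModel

/-! ### Gradients and Hessians -/

section Calculus

variable {d : ℕ}

lemma eq_affine_of_fderiv_fderiv_eq_zero {E : Type*} [NormedAddCommGroup E] [NormedSpace ℝ E]
    {U : Set E} (hU : IsOpen U) (hc : Convex ℝ U) {f : E → ℝ}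
    (h1 : ∀ θ ∈ U, DifferentiableAt ℝ f θ) (h2 : ∀ θ ∈ U, DifferentiableAt ℝ (fderiv ℝ f) θ)
    (h3 : ∀ θ ∈ U, fderiv ℝ (fderiv ℝ f) θ = 0) {θ₀ θ : E} (hθ₀ : θ₀ ∈ U) (hθ : θ ∈ U) :
    f θ = f θ₀ + fderiv ℝ f θ₀ (θ - θ₀) := by
  have hconst : ∀ η ∈ U, fderiv ℝ f η = fderiv ℝ f θ₀ := fun η hη =>
    hU.is_const_of_fderiv_eq_zero hc.isPreconnected (fun x hx => (h2 x hx).differentiableWithinAt)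
      h3 hη hθ₀
  have hd : ∀ η ∈ U, HasFDerivAt (fun η => f η - fderiv ℝ f θ₀ (η - θ₀)) (0 : E →L[ℝ] ℝ) η := by
    intro η hη
    have e1 := (h1 η hη).hasFDerivAt
    rw [hconst η hη] at e1
    have e2 : HasFDerivAt (fun η => fderiv ℝ f θ₀ (η - θ₀)) (fderiv ℝ f θ₀) η :=
      ((fderiv ℝ f θ₀).hasFDerivAt).comp η ((hasFDerivAt_id η).sub_const θ₀)
    have := e1.sub e2
    rwa [sub_self] at this
  have h := hU.is_const_of_fderiv_eq_zero hc.isPreconnected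
    (fun x hx => (hd x hx).differentiableAt.differentiableWithinAt)
    (fun x hx => (hd x hx).fderiv) hθ hθ₀
  simp only [sub_self, map_zero, sub_zero] at h
  linarith

lemma fderiv_fderiv_apply_eq_dotProduct (f : EuclideanSpace ℝ (Fin d) → ℝ)
    (θ a b : EuclideanSpace ℝ (Fin d)) :
    fderiv ℝ (fderiv ℝ f) θ a b = a.ofLp ⬝ᵥ hessianMatrix f θ *ᵥ b.ofLp := by
  have hexp : ∀ v : EuclideanSpace ℝ (Fin d), v = ∑ i, v i • EuclideanSpace.single i (1 : ℝ) := by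
    intro v
    have := (EuclideanSpace.basisFun (Fin d) ℝ).sum_repr v
    simpa using this.symm
  conv_lhs => rw [hexp a, hexp b]
  simp only [map_sum, map_smul, sum_apply, smul_apply, smul_eq_mul, dotProduct, Matrix.mulVec,
    hessianMatrix, Matrix.of_apply]
  simp only [Finset.mul_sum]
  rw [Finset.sum_comm]
  exact Finset.sum_congr rfl fun i _ => Finset.sum_congr rfl fun j _ => by ring

lemma hessianMatrix_isHermitian {f : EuclideanSpace ℝ (Fin d) → ℝ}
    {U : Set (EuclideanSpace ℝ (Fin d))} (hU : IsOpen U)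
    (h1 : ∀ θ ∈ U, DifferentiableAt ℝ f θ) {θ : EuclideanSpace ℝ (Fin d)} (hθ : θ ∈ U)
    (h2 : DifferentiableAt ℝ (fderiv ℝ f) θ) : (hessianMatrix f θ).IsHermitian := by
  ext i j
  rw [Matrix.conjTranspose_apply, star_trivial]
  refine second_derivative_symmetric_of_eventually (f := f) (f' := fderiv ℝ f) ?_ h2.hasFDerivAt _ _
  filter_upwards [hU.mem_nhds hθ] with η hη using (h1 η hη).hasFDerivAt

lemma hasFDerivAt_gradient {f : EuclideanSpace ℝ (Fin d) → ℝ}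
    {U : Set (EuclideanSpace ℝ (Fin d))} (hU : IsOpen U)
    (h1 : ∀ θ ∈ U, DifferentiableAt ℝ f θ) {θ : EuclideanSpace ℝ (Fin d)} (hθ : θ ∈ U)
    (h2 : DifferentiableAt ℝ (fderiv ℝ f) θ) :
    HasFDerivAt (gradient f) (Matrix.toEuclideanCLM (𝕜 := ℝ) (hessianMatrix f θ)) θ := by
  have h := (InnerProductSpace.toDual ℝ
    (EuclideanSpace ℝ (Fin d))).symm.toContinuousLinearEquiv.toContinuousLinearMap
    |>.hasFDerivAt.comp θ h2.hasFDerivAt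
  refine h.congr_fderiv ?_
  ext1 a
  refine ext_inner_right ℝ fun b => ?_
  have e1 : inner ℝ ((InnerProductSpace.toDual ℝ (EuclideanSpace ℝ (Fin d))).symm
      (fderiv ℝ (fderiv ℝ f) θ a)) b =
      fderiv ℝ (fderiv ℝ f) θ a b := InnerProductSpace.toDual_symm_apply
  have e2 := inner_toEuclideanCLM (hessianMatrix f θ) a b
  rw [e2]
  refine e1.trans ?_
  rw [fderiv_fderiv_apply_eq_dotProduct, Matrix.dotProduct_mulVec, dotProduct_comm,
    ← Matrix.mulVec_transpose]
  have := (hessianMatrix_isHermitian hU h1 hθ h2).eq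
  rw [Matrix.conjTranspose_eq_transpose_of_trivial] at this
  rw [this]

/-- Second-order Taylor estimates for a gradient with Lipschitz derivative. -/
lemma norm_sub_le_of_hasFDerivAt_ball {E : Type*} [NormedAddCommGroup E] [InnerProductSpace ℝ E]
    {G : E → E} {G' : E → E →L[ℝ] E} {r L : ℝ} (hL : 0 ≤ L) (h0 : G 0 = 0)
    (hG : ∀ w ∈ Metric.ball (0 : E) r, HasFDerivAt G (G' w) w)
    (hlip : ∀ w ∈ Metric.ball (0 : E) r, ‖G' w - G' 0‖ ≤ L * ‖w‖) {w : E}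
    (hw : w ∈ Metric.ball (0 : E) r) : ‖G w - G' 0 w‖ ≤ L * ‖w‖ ^ 2 := by
  have hsub : Metric.closedBall (0 : E) ‖w‖ ⊆ Metric.ball 0 r := by
    intro x hx
    simp only [mem_closedBall_zero_iff, mem_ball_zero_iff] at hx hw ⊢
    exact hx.trans_lt hw
  have h := (convex_closedBall (0 : E) ‖w‖).norm_image_sub_le_of_norm_hasFDerivWithin_le'
    (f := G) (f' := G') (φ := G' 0) (C := L * ‖w‖) (x := 0) (y := w)
    (fun x hx => (hG x (hsub hx)).hasFDerivWithinAt)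
    (fun x hx => (hlip x (hsub hx)).trans (mul_le_mul_of_nonneg_left
      (by simpa using hx) hL)) (by simp) (by simp)
  rw [h0, sub_zero, sub_zero] at h
  linarith

/-- The mean value inequality for F minus its quadratic model on the closed ball of radius ‖w‖. The
Taylor constant 1/3 is given up, so the same L serves the gradient and the value. -/
lemma abs_sub_le_of_hasGradientAt_ball {E : Type*} [NormedAddCommGroup E] [InnerProductSpace ℝ E]
    [CompleteSpace E] {F : E → ℝ} {G : E → E} {A : E →L[ℝ] E} {r L : ℝ} (hL : 0 ≤ L)
    (h0 : F 0 = 0) (hA : ∀ v w, inner ℝ (A v) w = inner ℝ v (A w))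
    (hF : ∀ w ∈ Metric.ball (0 : E) r, HasGradientAt F (G w) w)
    (hG : ∀ w ∈ Metric.ball (0 : E) r, ‖G w - A w‖ ≤ L * ‖w‖ ^ 2) {w : E}
    (hw : w ∈ Metric.ball (0 : E) r) : |F w - inner ℝ (A w) w / 2| ≤ L * ‖w‖ ^ 3 := by
  have hsub : Metric.closedBall (0 : E) ‖w‖ ⊆ Metric.ball 0 r := by
    intro x hx
    simp only [mem_closedBall_zero_iff, mem_ball_zero_iff] at hx hw ⊢
    exact hx.trans_lt hw
  have hder : ∀ x ∈ Metric.ball (0 : E) r, HasFDerivAt (fun x => F x - inner ℝ (A x) x / 2)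
      (innerSL ℝ (G x - A x)) x := by
    intro x hx
    have h1 := (hF x hx).hasFDerivAt
    have h2 := (A.hasFDerivAt (x := x)).inner ℝ (hasFDerivAt_id x)
    have h3 := h1.sub (h2.mul_const (1 / 2 : ℝ))
    refine (h3.congr_fderiv ?_).congr_of_eventuallyEq ?_
    · ext y
      simp [hA y x, real_inner_comm y (A x)]
      rw [real_inner_comm]
      ring
    · filter_upwards with y
      simp
      ring
  have h := (convex_closedBall (0 : E) ‖w‖).norm_image_sub_le_of_norm_hasFDerivWithin_le
    (C := L * ‖w‖ ^ 2) (x := 0) (y := w)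
    (fun x hx => (hder x (hsub hx)).hasFDerivWithinAt)
    (fun x hx => by
      rw [innerSL_apply_norm]
      refine (hG x (hsub hx)).trans (mul_le_mul_of_nonneg_left ?_ hL)
      exact pow_le_pow_left₀ (norm_nonneg x) (by simpa using hx) 2) (by simp) (by simp)
  rw [h0, inner_zero_right, zero_div, sub_zero, sub_zero, sub_zero, Real.norm_eq_abs] at h
  linarith

end Calculus

/-! ### Moments of scores from the cumulant function -/

section Bartlett

variable {d : ℕ} {𝒴 : Type*} [MeasurableSpace 𝒴] {μ : Measure 𝒴} [IsProbabilityMeasure μ]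
  {g : 𝒴 → EuclideanSpace ℝ (Fin d)}

/-- **Bartlett's identities**: the first two moments of the score, from the Taylor expansion of the
cumulant function. -/
lemma score_moments {L L' r : ℝ} {F : EuclideanSpace ℝ (Fin d) → ℝ}
    {G : EuclideanSpace ℝ (Fin d) → EuclideanSpace ℝ (Fin d)} {T : Matrix (Fin d) (Fin d) ℝ}
    (hr : 0 < r) (hg : Measurable g) (hb : ∀ᵐ y ∂μ, ‖g y‖ ≤ L)
    (hexp : ∀ w ∈ Metric.ball (0 : EuclideanSpace ℝ (Fin d)) r,
      ∫ y, Real.exp (-inner ℝ (g y) w) ∂μ = Real.exp (F w))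
    (hF : ∀ w ∈ Metric.ball (0 : EuclideanSpace ℝ (Fin d)) r, HasGradientAt F (G w) w)
    (hG : ∀ w ∈ Metric.ball (0 : EuclideanSpace ℝ (Fin d)) r,
      ‖G w - Matrix.toEuclideanCLM (𝕜 := ℝ) T w‖ ≤ L' * ‖w‖ ^ 2) :
    ∫ y, g y ∂μ = 0 ∧
    ∀ v : EuclideanSpace ℝ (Fin d), ∫ y, inner ℝ v (g y) ^ 2 ∂μ = v.ofLp ⬝ᵥ T *ᵥ v.ofLp := by
  have hgint : Integrable g μ := Integrable.of_bound hg.aestronglyMeasurable L hb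
  have hF0 : F 0 = 0 := by
    have h := hexp 0 (Metric.mem_ball_self hr)
    simp only [inner_zero_right, neg_zero, Real.exp_zero, integral_const, probReal_univ,
      one_smul] at h
    exact (Real.exp_eq_one_iff _).1 h.symm
  have key : ∀ v : EuclideanSpace ℝ (Fin d), ∫ y, inner ℝ v (g y) ∂μ = 0 ∧
      ∫ y, inner ℝ v (g y) ^ 2 ∂μ = v.ofLp ⬝ᵥ T *ᵥ v.ofLp := by
    intro v
    set X : 𝒴 → ℝ := fun y => -inner ℝ v (g y)
    set φ : ℝ → ℝ := fun s => F (s • v)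
    set φ' : ℝ → ℝ := fun s => inner ℝ (G (s • v)) v
    set Q := v.ofLp ⬝ᵥ T *ᵥ v.ofLp
    have hball : ∀ᶠ s : ℝ in nhds 0, s • v ∈ Metric.ball (0 : EuclideanSpace ℝ (Fin d)) r := by
      have hc : Continuous fun s : ℝ => s • v := by fun_prop
      refine hc.continuousAt.eventually_mem ?_
      simpa using Metric.ball_mem_nhds (0 : EuclideanSpace ℝ (Fin d)) hr
    have hXm : AEMeasurable X μ :=
      (hgint.const_inner v).aestronglyMeasurable.aemeasurable.neg
    have hXb : ∀ᵐ y ∂μ, X y ∈ Set.Icc (-(‖v‖ * L)) (‖v‖ * L) := by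
      filter_upwards [hb] with y hy
      have h1 := abs_le.1 (abs_real_inner_le_norm v (g y))
      have h2 := mul_le_mul_of_nonneg_left hy (norm_nonneg v)
      constructor <;> simp only [X] <;> linarith [h1.1, h1.2]
    -- Bounded scores have all exponential moments, so moments are derivatives of the moment
    -- generating function at 0.
    have hset : integrableExpSet X μ = Set.univ := by
      ext s
      simp only [integrableExpSet, Set.mem_ofPred_eq, Set.mem_univ, iff_true]
      exact integrable_exp_mul_of_mem_Icc hXm hXb
    have h0int : (0 : ℝ) ∈ interior (integrableExpSet X μ) := by rw [hset]; simp
    have hmgf : mgf X μ =ᶠ[nhds 0] fun s => Real.exp (φ s) := by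
      filter_upwards [hball] with s hs
      rw [← hexp _ hs, mgf]
      refine integral_congr_ae (Filter.Eventually.of_forall fun y => ?_)
      simp only [X, real_inner_smul_right, real_inner_comm v (g y)]
      ring_nf
    have hφ : ∀ᶠ s : ℝ in nhds 0, HasDerivAt φ (φ' s) s := by
      filter_upwards [hball] with s hs
      have h1 := (hF _ hs).hasFDerivAt
      have h2 : HasDerivAt (fun s : ℝ => s • v) v s := by
        simpa using (hasDerivAt_id s).smul_const v
      have h3 : HasDerivAt φ _ s := h1.comp_hasDerivAt s h2
      simpa using h3
    have hφ0 : φ 0 = 0 := by simp [φ, hF0]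
    have hG0 : G 0 = 0 := by
      have h := hG 0 (Metric.mem_ball_self hr)
      simpa using h
    have hφ'0 : φ' 0 = 0 := by simp [φ', hG0]
    -- A second derivative of F is needed only at 0, where the quadratic estimate on G supplies it.
    have hφ' : HasDerivAt φ' Q 0 := by
      rw [hasDerivAt_iff_isLittleO]
      have hO : (fun s : ℝ => φ' s - φ' 0 - (s - 0) • Q) =O[nhds 0] fun s : ℝ => s ^ 2 := by
        refine Asymptotics.IsBigO.of_bound (|L'| * ‖v‖ ^ 3) ?_
        filter_upwards [hball] with s hs
        have e : φ' s - φ' 0 - (s - 0) • Q =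
            inner ℝ (G (s • v) - Matrix.toEuclideanCLM (𝕜 := ℝ) T (s • v)) v := by
          rw [hφ'0, inner_sub_left, map_smul, real_inner_smul_left, inner_toEuclideanCLM]
          simp [φ', Q]
        rw [e]
        refine (norm_inner_le_norm _ _).trans ?_
        have h1 := mul_le_mul_of_nonneg_right (hG _ hs) (norm_nonneg v)
        refine h1.trans ?_
        rw [norm_smul, mul_pow, norm_pow]
        have h2 : L' * (‖s‖ ^ 2 * ‖v‖ ^ 2) * ‖v‖ = L' * (‖v‖ ^ 3 * ‖s‖ ^ 2) := by ring
        rw [h2, mul_assoc]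
        exact mul_le_mul_of_nonneg_right (le_abs_self L') (by positivity)
      refine hO.trans_isLittleO ?_
      simpa using Asymptotics.isLittleO_pow_id (𝕜 := ℝ) one_lt_two
    have hd1 : deriv (mgf X μ) =ᶠ[nhds 0] fun s => Real.exp (φ s) * φ' s := by
      filter_upwards [hmgf.eventually_nhds, hφ] with s hs hs'
      rw [Filter.EventuallyEq.deriv_eq hs]
      exact hs'.exp.deriv
    have hmean : ∫ y, X y ∂μ = 0 := by
      rw [← deriv_mgf_zero h0int, hd1.eq_of_nhds, hφ'0, mul_zero]
    have hsec : ∫ y, X y ^ 2 ∂μ = Q := by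
      have h := iteratedDeriv_mgf_zero h0int 2
      have e : iteratedDeriv 2 (mgf X μ) 0 = Q := by
        rw [iteratedDeriv_succ, iteratedDeriv_one, hd1.deriv_eq]
        have h2 : deriv (fun s => Real.exp (φ s) * φ' s) 0 = _ :=
          (hφ.self_of_nhds.exp.mul hφ').deriv
        rw [hφ0, hφ'0] at h2
        simpa using h2
      rw [e] at h
      exact h.symm
    constructor
    · simpa [X, integral_neg] using hmean
    · simpa [X] using hsec
  refine ⟨?_, fun v => (key v).2⟩
  refine ext_inner_left ℝ fun v => ?_
  rw [← integral_inner hgint, (key v).1, inner_zero_right]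

/-- Convexity of exp between −⟨g, w⟩ − F w and 0, integrated: the first endpoint has exponential
mean 1, so both contribute the value 1. -/
lemma cumulant_smul_le {F : EuclideanSpace ℝ (Fin d) → ℝ} {w : EuclideanSpace ℝ (Fin d)} {τ : ℝ}
    (hτ : τ ∈ Set.Icc (0 : ℝ) 1)
    (hw : ∫ y, Real.exp (-inner ℝ (g y) w) ∂μ = Real.exp (F w))
    (hτw : ∫ y, Real.exp (-inner ℝ (g y) (τ • w)) ∂μ = Real.exp (F (τ • w))) :
    F (τ • w) ≤ τ * F w := by
  have hi : ∀ {u}, ∫ y, Real.exp (-inner ℝ (g y) u) ∂μ = Real.exp (F u) →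
      Integrable (fun y => Real.exp (-inner ℝ (g y) u)) μ := fun {u} hu =>
    Integrable.of_integral_ne_zero (by rw [hu]; exact (Real.exp_pos _).ne')
  rw [← Real.exp_le_exp, ← hτw]
  have hpt : ∀ y, Real.exp (-inner ℝ (g y) (τ • w)) ≤ Real.exp (τ * F w) *
      (τ * Real.exp (-F w) * Real.exp (-inner ℝ (g y) w) + (1 - τ)) := by
    intro y
    have h := convexOn_exp.2 (Set.mem_univ (-inner ℝ (g y) w - F w)) (Set.mem_univ 0) hτ.1
      (sub_nonneg.2 hτ.2) (by ring)
    simp only [smul_eq_mul, mul_zero, add_zero, Real.exp_zero, mul_one] at h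
    have e1 : Real.exp (-inner ℝ (g y) (τ • w)) =
        Real.exp (τ * F w) * Real.exp (τ * (-inner ℝ (g y) w - F w)) := by
      rw [← Real.exp_add, real_inner_smul_right]; ring_nf
    have e2 : τ * Real.exp (-F w) * Real.exp (-inner ℝ (g y) w) =
        τ * Real.exp (-inner ℝ (g y) w - F w) := by
      rw [mul_assoc, ← Real.exp_add]; ring_nf
    rw [e1, e2]
    exact mul_le_mul_of_nonneg_left h (Real.exp_pos _).le
  have hint := (((hi hw).const_mul (τ * Real.exp (-F w))).add
    (integrable_const (1 - τ))).const_mul (Real.exp (τ * F w))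
  refine (integral_mono (hi hτw) hint hpt).trans (le_of_eq ?_)
  have e := integral_add ((hi hw).const_mul (τ * Real.exp (-F w))) (integrable_const (1 - τ))
  rw [integral_const_mul, hw] at e
  have e' : Real.exp (-F w) * Real.exp (F w) = 1 := by rw [← Real.exp_add]; simp
  rw [integral_const_mul]
  simp only [Pi.add_apply] at e ⊢
  rw [e, mul_assoc τ, e']
  simp

/-- Jensen in the form exp x ≥ 1 + x, with centred scores. -/
lemma cumulant_nonneg {F : EuclideanSpace ℝ (Fin d) → ℝ} {w : EuclideanSpace ℝ (Fin d)}
    (hgint : Integrable g μ) (h0 : ∫ y, g y ∂μ = 0)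
    (hw : ∫ y, Real.exp (-inner ℝ (g y) w) ∂μ = Real.exp (F w)) : 0 ≤ F w := by
  have hi : Integrable (fun y => Real.exp (-inner ℝ (g y) w)) μ :=
    Integrable.of_integral_ne_zero (by rw [hw]; exact (Real.exp_pos _).ne')
  have hin : Integrable (fun y => inner ℝ w (g y)) μ := hgint.const_inner w
  have h := integral_mono ((integrable_const (1 : ℝ)).sub hin) hi fun y => by
    have := Real.add_one_le_exp (-inner ℝ (g y) w)
    simp only [Pi.sub_apply]
    rw [real_inner_comm]
    linarith
  have e := integral_sub (integrable_const (μ := μ) (1 : ℝ)) hin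
  rw [integral_inner hgint, h0, inner_zero_right] at e
  simp only [Pi.sub_apply] at h e
  rw [e, hw] at h
  simp only [integral_const, probReal_univ, one_smul, sub_zero] at h
  exact Real.exp_le_exp.1 (by rwa [Real.exp_zero])

end Bartlett

/-! ### Losses whose Hessian does not depend on the label -/

section HessianEq

variable {d : ℕ}

lemma inner_gradient (f : EuclideanSpace ℝ (Fin d) → ℝ) (θ v : EuclideanSpace ℝ (Fin d)) :
    inner ℝ (gradient f θ) v = fderiv ℝ f θ v := InnerProductSpace.toDual_symm_apply

/-- The difference has zero Hessian on the convex interior, hence is affine there. A convex set with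
nonempty interior lies in the closure of that interior, so continuity extends the identity to
boundary points. -/
lemma sub_affine_eq_of_hessianMatrix_eq {W : Set (EuclideanSpace ℝ (Fin d))} (hW : Convex ℝ W)
    {f₁ f₂ : EuclideanSpace ℝ (Fin d) → ℝ} (h₁ : ThreeTimesDifferentiableOn f₁ (interior W))
    (h₂ : ThreeTimesDifferentiableOn f₂ (interior W)) (hc₁ : ContinuousOn f₁ W)
    (hc₂ : ContinuousOn f₂ W) (hH : ∀ θ ∈ interior W, hessianMatrix f₁ θ = hessianMatrix f₂ θ)
    {θ₀ : EuclideanSpace ℝ (Fin d)} (hθ₀ : θ₀ ∈ interior W) {θ : EuclideanSpace ℝ (Fin d)}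
    (hθ : θ ∈ W) :
    f₁ θ - f₁ θ₀ - inner ℝ (gradient f₁ θ₀) (θ - θ₀) =
      f₂ θ - f₂ θ₀ - inner ℝ (gradient f₂ θ₀) (θ - θ₀) := by
  set U := interior W
  have hU : IsOpen U := isOpen_interior
  set D : EuclideanSpace ℝ (Fin d) → ℝ := fun θ => f₁ θ - f₂ θ
  have hfd : ∀ η ∈ U, fderiv ℝ D η = fderiv ℝ f₁ η - fderiv ℝ f₂ η := fun η hη =>
    fderiv_fun_sub (h₁.1 η hη) (h₂.1 η hη)
  have hev : ∀ η ∈ U, fderiv ℝ D =ᶠ[nhds η] fun η => fderiv ℝ f₁ η - fderiv ℝ f₂ η := by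
    intro η hη
    filter_upwards [hU.mem_nhds hη] with ζ hζ using hfd ζ hζ
  have h2 : ∀ η ∈ U, DifferentiableAt ℝ (fderiv ℝ D) η := fun η hη =>
    ((h₁.2.1 η hη).fun_sub (h₂.2.1 η hη)).congr_of_eventuallyEq (hev η hη)
  have h3 : ∀ η ∈ U, fderiv ℝ (fderiv ℝ D) η = 0 := by
    intro η hη
    rw [(hev η hη).fderiv_eq, fderiv_fun_sub (h₁.2.1 η hη) (h₂.2.1 η hη)]
    ext a b
    simp only [sub_apply, fderiv_fderiv_apply_eq_dotProduct, hH η hη, sub_self, zero_apply]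
  have haff : ∀ η ∈ U, D η = D θ₀ + fderiv ℝ D θ₀ (η - θ₀) := fun η hη =>
    eq_affine_of_fderiv_fderiv_eq_zero hU hW.interior
      (fun ζ hζ => (h₁.1 ζ hζ).fun_sub (h₂.1 ζ hζ)) h2 h3 hθ₀ hη
  have hcl : W ⊆ closure U := by
    rw [hW.closure_interior_eq_closure_of_nonempty_interior ⟨θ₀, hθ₀⟩]
    exact subset_closure
  have hext : Set.EqOn D (fun η => D θ₀ + fderiv ℝ D θ₀ (η - θ₀)) W := by
    refine Set.EqOn.of_subset_closure (s := U) haff (hc₁.sub hc₂) ?_ interior_subset hcl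
    fun_prop
  have h := hext hθ
  simp only [hfd θ₀ hθ₀, sub_apply, D] at h
  rw [inner_gradient, inner_gradient]
  linarith

end HessianEq

/-! ### The exponential-family structure of a task. -/

namespace TaskSequence

variable {𝒳 𝒴 : Type*} [MeasurableSpace 𝒴] {d : ℕ} (T : TaskSequence 𝒳 𝒴 d)

/-- The score `∇ℓ(y|x_i,θ_t*)` of a label of the `i`-th sample of the pool. -/
noncomputable def score (t : ℕ) (i : Fin (T.N t)) (y : 𝒴) : EuclideanSpace ℝ (Fin d) :=
  gradient (T.loss y (T.pool t i)) (T.θstar t)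

/-- The loss minus its affine part at the true parameter, computed from the label `y₀`. -/
noncomputable def cumulant (t : ℕ) (y₀ : 𝒴) (i : Fin (T.N t)) (θ : EuclideanSpace ℝ (Fin d)) : ℝ :=
  T.loss y₀ (T.pool t i) θ - T.loss y₀ (T.pool t i) (T.θstar t) -
    inner ℝ (T.score t i y₀) (θ - T.θstar t)

variable {T} {H : 𝒳 → EuclideanSpace ℝ (Fin d) → Matrix (Fin d) (Fin d) ℝ}
  {m Lb L₁ L₂ L₃ : ℝ} {B : ℕ → Set (EuclideanSpace ℝ (Fin d))} {t : ℕ}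

lemma paramSet_subset : T.paramSet t ⊆ T.Θ := fun _ h => h.1

lemma interior_paramSet_subset : interior (T.paramSet t) ⊆ interior T.Θ :=
  interior_mono paramSet_subset

lemma isCompact_paramSet (hreg : T.Regular H m Lb L₁ L₂ L₃ B) : IsCompact (T.paramSet t) := by
  have h : IsClosed {θ | ‖θ - T.θstar (t - 1)‖ ≤ T.ρ} :=
    isClosed_le (by fun_prop) continuous_const
  exact hreg.compact.inter_right h

lemma isProbabilityMeasure_labelLaw (x : 𝒳) {θ : EuclideanSpace ℝ (Fin d)} (hθ : θ ∈ T.Θ) :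
    IsProbabilityMeasure (T.labelLaw x θ) :=
  ⟨by rw [LabelModel.labelLaw, withDensity_apply _ MeasurableSet.univ, Measure.restrict_univ,
    T.p_lintegral x θ hθ]⟩

/-- The exponential-family form: apart from the value at the true parameter, the label enters only
through a linear term. The reference label y₀ is arbitrary, because equal Hessians leave only an
affine difference. -/
lemma loss_eq_add_cumulant (hH : T.HessianEq H) (hreg : T.Regular H m Lb L₁ L₂ L₃ B)
    (hconv : Convex ℝ (T.paramSet t)) (hint : T.θstar t ∈ interior (T.paramSet t)) (y₀ y : 𝒴)
    (i : Fin (T.N t)) {θ : EuclideanSpace ℝ (Fin d)} (hθ : θ ∈ T.paramSet t) :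
    T.loss y (T.pool t i) θ = T.loss y (T.pool t i) (T.θstar t) +
      inner ℝ (T.score t i y) (θ - T.θstar t) + T.cumulant t y₀ i θ := by
  have hsm : ∀ y, ThreeTimesDifferentiableOn (T.loss y (T.pool t i)) (interior (T.paramSet t)) :=
    fun y => ⟨fun θ h => (hreg.smooth _ y).1 θ (interior_paramSet_subset h),
      fun θ h => (hreg.smooth _ y).2.1 θ (interior_paramSet_subset h),
      fun θ h => (hreg.smooth _ y).2.2 θ (interior_paramSet_subset h)⟩
  have h := sub_affine_eq_of_hessianMatrix_eq hconv (hsm y) (hsm y₀)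
    ((hreg.continuousOn _ y).mono paramSet_subset) ((hreg.continuousOn _ y₀).mono paramSet_subset)
    (fun θ h => by
      rw [hH _ y θ (interior_paramSet_subset h), hH _ y₀ θ (interior_paramSet_subset h)]) hint hθ
  rw [cumulant, score, score, ← h]
  ring

lemma measurable_loss (x : 𝒳) {θ : EuclideanSpace ℝ (Fin d)} (hθ : θ ∈ T.Θ) :
    Measurable fun y => T.loss y x θ := (T.p_measurable x θ hθ).log.neg

/-- Measurability in y is given for the loss, not for its gradient. Since the label enters linearly,
each coordinate of the score is an exact difference quotient of losses corrected by the cumulant,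
and no limit is needed. -/
lemma measurable_score (hH : T.HessianEq H) (hreg : T.Regular H m Lb L₁ L₂ L₃ B)
    (hconv : Convex ℝ (T.paramSet t)) (hint : T.θstar t ∈ interior (T.paramSet t)) (y₀ : 𝒴)
    (i : Fin (T.N t)) : Measurable (T.score t i) := by
  obtain ⟨δ, hδ, hball⟩ := Metric.mem_nhds_iff.1 (mem_interior_iff_mem_nhds.1 hint)
  have hcoord : ∀ a, Measurable fun y => T.score t i y a := by
    intro a
    set θ := T.θstar t + EuclideanSpace.single a (δ / 2)
    have hθ : θ ∈ T.paramSet t := hball (by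
      rw [mem_ball_iff_norm, add_sub_cancel_left, PiLp.norm_single,
        Real.norm_of_nonneg (by positivity)]
      linarith)
    have hm := (((measurable_loss (T.pool t i) (paramSet_subset hθ)).sub
      (measurable_loss (T.pool t i) (paramSet_subset (interior_subset hint)))).sub_const
      (T.cumulant t y₀ i θ)).const_mul (δ / 2)⁻¹
    convert hm using 2 with y
    have h := loss_eq_add_cumulant hH hreg hconv hint y₀ y i hθ
    have e : inner ℝ (T.score t i y) (θ - T.θstar t) = δ / 2 * T.score t i y a := by
      rw [add_sub_cancel_left, EuclideanSpace.inner_single_right]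
      simp
    rw [e] at h
    simp only [Pi.sub_apply]
    rw [h]
    field_simp
    ring
  have h := (MeasurableEquiv.toLp 2 (Fin d → ℝ)).measurable.comp (measurable_pi_lambda
    (fun y a => T.score t i y a) hcoord)
  exact h

/-- Exponentiating the decomposition of the loss gives p(y|x,θ*)·exp(−⟨score, θ − θ*⟩) =
p(y|x,θ)·exp F_x(θ), and p(·|x,θ) has total mass 1. -/
lemma integral_exp_neg_score (hH : T.HessianEq H) (hreg : T.Regular H m Lb L₁ L₂ L₃ B)
    (hconv : Convex ℝ (T.paramSet t)) (hint : T.θstar t ∈ interior (T.paramSet t)) (y₀ : 𝒴)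
    (i : Fin (T.N t)) {θ : EuclideanSpace ℝ (Fin d)} (hθ : θ ∈ T.paramSet t) :
    ∫ y, Real.exp (-inner ℝ (T.score t i y) (θ - T.θstar t))
      ∂(T.labelLaw (T.pool t i) (T.θstar t)) = Real.exp (T.cumulant t y₀ i θ) := by
  have hsc := measurable_score hH hreg hconv hint y₀ i
  have hm : Measurable fun y => Real.exp (-inner ℝ (T.score t i y) (θ - T.θstar t)) :=
    Real.measurable_exp.comp (hsc.inner measurable_const).neg
  have hs := paramSet_subset (interior_subset hint)
  have hθ' := paramSet_subset hθ
  set c := T.cumulant t y₀ i θ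
  have hp : ∀ y, T.p y (T.pool t i) (T.θstar t) *
      Real.exp (-inner ℝ (T.score t i y) (θ - T.θstar t)) =
      T.p y (T.pool t i) θ * Real.exp c := by
    intro y
    have h := loss_eq_add_cumulant hH hreg hconv hint y₀ y i hθ
    have e : ∀ η ∈ T.Θ, T.p y (T.pool t i) η = Real.exp (-T.loss y (T.pool t i) η) := by
      intro η hη
      rw [LabelModel.loss, neg_neg, Real.exp_log (T.p_pos _ _ _ hη)]
    rw [e _ hs, e _ hθ', ← Real.exp_add, ← Real.exp_add, h]
    congr 1
    ring
  rw [integral_eq_lintegral_of_nonneg_ae (Filter.Eventually.of_forall fun _ => (Real.exp_pos _).le)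
    hm.aestronglyMeasurable, LabelModel.labelLaw,
    lintegral_withDensity_eq_lintegral_mul _ (T.p_measurable _ _ hs).ennreal_ofReal
      hm.ennreal_ofReal]
  have e : ∀ y, ((fun y => ENNReal.ofReal (T.p y (T.pool t i) (T.θstar t))) *
      fun y => ENNReal.ofReal (Real.exp (-inner ℝ (T.score t i y) (θ - T.θstar t)))) y =
      ENNReal.ofReal (T.p y (T.pool t i) θ) * ENNReal.ofReal (Real.exp c) := by
    intro y
    rw [Pi.mul_apply, ← ENNReal.ofReal_mul (T.p_pos _ _ _ hs).le, hp,
      ENNReal.ofReal_mul (T.p_pos _ _ _ hθ').le]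
  simp only [e]
  rw [lintegral_mul_const' _ _ ENNReal.ofReal_ne_top, T.p_lintegral _ _ hθ', one_mul,
    ENNReal.toReal_ofReal (Real.exp_pos _).le]

/-- The excess risk under uniform sampling is the average of the cumulant functions. -/
lemma risk_sub_eq (hH : T.HessianEq H) (hreg : T.Regular H m Lb L₁ L₂ L₃ B) (ht : 1 ≤ t)
    (hconv : Convex ℝ (T.paramSet t)) (hint : T.θstar t ∈ interior (T.paramSet t)) (y₀ : 𝒴)
    (hsc : ∀ i, Integrable (T.score t i) (T.labelLaw (T.pool t i) (T.θstar t)))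
    (hsc0 : ∀ i, ∫ y, T.score t i y ∂(T.labelLaw (T.pool t i) (T.θstar t)) = 0)
    {θ : EuclideanSpace ℝ (Fin d)} (hθ : θ ∈ T.paramSet t) :
    T.risk t θ - T.risk t (T.θstar t) = ∑ i, (1 / T.N t : ℝ) * T.cumulant t y₀ i θ := by
  have hN : (0 : ℝ) < T.N t := by exact_mod_cast T.N_pos t ht
  have hs := paramSet_subset (interior_subset hint)
  rw [risk, risk, ← integral_sub (hreg.integrable t ht θ (paramSet_subset hθ))
    (hreg.integrable t ht _ hs)]
  have hI : Integrable (fun z : Fin (T.N t) × 𝒴 => T.loss z.2 (T.pool t z.1) θ -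
      T.loss z.2 (T.pool t z.1) (T.θstar t)) (T.dataLaw t (uniformWeights (T.N t))) :=
    (hreg.integrable t ht θ (paramSet_subset hθ)).sub (hreg.integrable t ht _ hs)
  rw [dataLaw, LabelModel.sampleLaw] at hI ⊢
  rw [integrable_finsetSum_measure] at hI
  rw [integral_finsetSum_measure fun i _ => hI i (Finset.mem_univ i)]
  refine Finset.sum_congr rfl fun i _ => ?_
  have := isProbabilityMeasure_labelLaw (T := T) (T.pool t i) hs
  rw [integral_smul_measure, (measurableEmbedding_prodMk_left i).integral_map, uniformWeights,
    ENNReal.toReal_ofReal (by positivity), smul_eq_mul]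
  congr 1
  have e : ∀ y, T.loss y (T.pool t i) θ - T.loss y (T.pool t i) (T.θstar t) =
      inner ℝ (T.score t i y) (θ - T.θstar t) + T.cumulant t y₀ i θ := fun y => by
    rw [loss_eq_add_cumulant hH hreg hconv hint y₀ y i hθ]; ring
  simp only [e]
  rw [integral_add ((hsc i).inner_const _) (integrable_const _)]
  have h0 : ∫ y, inner ℝ (T.score t i y) (θ - T.θstar t)
      ∂(T.labelLaw (T.pool t i) (T.θstar t)) = 0 := by
    simp only [real_inner_comm (θ - T.θstar t)]
    rw [integral_inner (hsc i), hsc0, inner_zero_right]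
  rw [h0]
  simp

end TaskSequence

/-! ### Bounds on quadratic forms and normalisation by an inverse square root -/

section Normalisation

variable {d : ℕ}

lemma inner_toEuclideanCLM_comm {A : Matrix (Fin d) (Fin d) ℝ} (hA : A.IsHermitian)
    (v w : EuclideanSpace ℝ (Fin d)) :
    inner ℝ (Matrix.toEuclideanCLM (𝕜 := ℝ) A v) w =
      inner ℝ v (Matrix.toEuclideanCLM (𝕜 := ℝ) A w) := by
  rw [real_inner_comm (Matrix.toEuclideanCLM (𝕜 := ℝ) A w), inner_toEuclideanCLM,
    inner_toEuclideanCLM, Matrix.dotProduct_mulVec, dotProduct_comm, ← Matrix.mulVec_transpose,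
    ← Matrix.conjTranspose_eq_transpose_of_trivial, hA.eq]

lemma posSemidef_smul_one_sub {A : Matrix (Fin d) (Fin d) ℝ} (hA : A.IsHermitian) {a : ℝ}
    (h : ∀ v, inner ℝ (Matrix.toEuclideanCLM (𝕜 := ℝ) A v) v ≤ a * ‖v‖ ^ 2) :
    (a • (1 : Matrix (Fin d) (Fin d) ℝ) - A).PosSemidef := by
  refine Matrix.PosSemidef.of_dotProduct_mulVec_nonneg
    ((Matrix.isHermitian_one.smul (IsSelfAdjoint.all a)).sub hA) fun v => ?_
  have h1 := h (WithLp.toLp 2 v)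
  rw [inner_toEuclideanCLM] at h1
  have h2 : v ⬝ᵥ v = ‖WithLp.toLp 2 v‖ ^ 2 := by
    rw [EuclideanSpace.real_norm_sq_eq, dotProduct]
    exact Finset.sum_congr rfl fun i _ => (pow_two _).symm
  rw [star_trivial, Matrix.sub_mulVec, Matrix.smul_mulVec, Matrix.one_mulVec, dotProduct_sub,
    dotProduct_smul, smul_eq_mul, h2]
  linarith

lemma posSemidef_smul_one_sub_of_spectralNorm₂_le {A : Matrix (Fin d) (Fin d) ℝ}
    (hA : A.IsHermitian) {a : ℝ} (h : spectralNorm₂ A ≤ a) :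
    (a • (1 : Matrix (Fin d) (Fin d) ℝ) - A).PosSemidef := by
  refine posSemidef_smul_one_sub hA fun v => ?_
  refine (real_inner_le_norm _ _).trans ?_
  have h1 := mul_le_mul_of_nonneg_right (((Matrix.toEuclideanCLM (𝕜 := ℝ) A).le_opNorm v).trans
    (mul_le_mul_of_nonneg_right h (norm_nonneg v))) (norm_nonneg v)
  linarith

lemma inner_toEuclideanCLM_le_of_spectrum_le {A : Matrix (Fin d) (Fin d) ℝ} (hA : A.IsHermitian)
    {a : ℝ} (h : ∀ μ ∈ spectrum ℝ A, μ ≤ a) (v : EuclideanSpace ℝ (Fin d)) :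
    inner ℝ (Matrix.toEuclideanCLM (𝕜 := ℝ) A v) v ≤ a * ‖v‖ ^ 2 := by
  obtain ⟨U, -, hU, hdiag, -⟩ := hA.exists_diagonalization
  have hpsd : (a • (1 : Matrix (Fin d) (Fin d) ℝ) - A).PosSemidef := by
    have h1 : (Matrix.diagonal fun i => a - hA.eigenvalues i).PosSemidef :=
      Matrix.PosSemidef.diagonal fun i => sub_nonneg.2 (h _ (hA.eigenvalues_mem_spectrum_real i))
    have h2 := h1.mul_mul_conjTranspose_same U
    have e : (Matrix.diagonal fun i => a - hA.eigenvalues i) =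
        a • (1 : Matrix (Fin d) (Fin d) ℝ) - Matrix.diagonal hA.eigenvalues := by
      rw [← Matrix.diagonal_one, ← Matrix.diagonal_smul, Matrix.diagonal_sub]
      congr 1
      ext i
      simp
    rw [e, mul_sub, sub_mul, ← hdiag, mul_smul_comm, mul_one, smul_mul_assoc, hU] at h2
    exact h2
  have h1 := hpsd.dotProduct_mulVec_nonneg v.ofLp
  rw [star_trivial, Matrix.sub_mulVec, Matrix.smul_mulVec, Matrix.one_mulVec, dotProduct_sub,
    dotProduct_smul, smul_eq_mul] at h1
  have h2 : v.ofLp ⬝ᵥ v.ofLp = ‖v‖ ^ 2 := by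
    rw [EuclideanSpace.real_norm_sq_eq, dotProduct]
    exact Finset.sum_congr rfl fun i _ => (pow_two _).symm
  rw [inner_toEuclideanCLM]
  linarith [h2 ▸ h1]

lemma weightedNorm_eq (A : Matrix (Fin d) (Fin d) ℝ) (v : EuclideanSpace ℝ (Fin d)) :
    weightedNorm A v = √(inner ℝ (Matrix.toEuclideanCLM (𝕜 := ℝ) A v) v) := by
  rw [weightedNorm, inner_toEuclideanCLM]

lemma isOpen_weightedNorm_lt (A : Matrix (Fin d) (Fin d) ℝ) (θ : EuclideanSpace ℝ (Fin d)) (r : ℝ) :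
    IsOpen {η | weightedNorm A (η - θ) < r} := by
  simp only [weightedNorm_eq]
  exact isOpen_lt (by fun_prop) continuous_const

variable {A : Matrix (Fin d) (Fin d) ℝ}

lemma weightedNorm_invSqrt_apply (hA : A.PosDef) (v : EuclideanSpace ℝ (Fin d)) :
    weightedNorm A (Matrix.toEuclideanCLM (𝕜 := ℝ) (invSqrt A) v) = ‖v‖ := by
  rw [weightedNorm_eq, real_inner_comm, inner_toEuclideanCLM_comm (invSqrt_isHermitian hA),
    toEuclideanCLM_mul_apply, toEuclideanCLM_mul_apply, mul_assoc, ← mul_assoc,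
    invSqrt_mul_self_mul hA, map_one]
  exact (congrArg _ (real_inner_self_eq_norm_sq v)).trans (Real.sqrt_sq (norm_nonneg v))

lemma norm_invSqrt_apply (hA : A.PosDef) (v : EuclideanSpace ℝ (Fin d)) :
    ‖Matrix.toEuclideanCLM (𝕜 := ℝ) (invSqrt A) v‖ = weightedNorm A⁻¹ v := by
  rw [weightedNorm_eq, ← invSqrt_mul_invSqrt hA, ← toEuclideanCLM_mul_apply,
    inner_toEuclideanCLM_comm (invSqrt_isHermitian hA), real_inner_self_eq_norm_sq,
    Real.sqrt_sq (norm_nonneg _)]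

lemma self_mul_invSqrt_mul_invSqrt (hA : A.PosDef) : A * invSqrt A * invSqrt A = 1 := by
  rw [mul_assoc, invSqrt_mul_invSqrt hA, Matrix.mul_nonsing_inv _
    ((Matrix.isUnit_iff_isUnit_det A).1 hA.isUnit)]

lemma invSqrt_mul_self_mul_invSqrt_apply (hA : A.PosDef) (v : EuclideanSpace ℝ (Fin d)) :
    Matrix.toEuclideanCLM (𝕜 := ℝ) (invSqrt A)
      (Matrix.toEuclideanCLM (𝕜 := ℝ) (A * invSqrt A) v) = v := by
  rw [toEuclideanCLM_mul_apply, ← mul_assoc, invSqrt_mul_self_mul hA, map_one]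
  rfl

/-- Normalising a pair of positive definite matrices preserves `Tr(B⁻¹ A)`. -/
lemma trace_inv_invSqrt_mul_mul_invSqrt (hA : A.PosDef) (B : Matrix (Fin d) (Fin d) ℝ) :
    ((invSqrt A * B * invSqrt A)⁻¹).trace = (B⁻¹ * A).trace := by
  have hJ : (invSqrt A)⁻¹ = A * invSqrt A :=
    Matrix.inv_eq_left_inv (self_mul_invSqrt_mul_invSqrt hA)
  have hJJ : (invSqrt A)⁻¹ * (invSqrt A)⁻¹ = A := by
    rw [← Matrix.mul_inv_rev, invSqrt_mul_invSqrt hA, Matrix.nonsing_inv_nonsing_inv _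
      ((Matrix.isUnit_iff_isUnit_det A).1 hA.isUnit)]
  rw [Matrix.mul_inv_rev, Matrix.mul_inv_rev, Matrix.trace_mul_comm, mul_assoc, hJJ]

lemma hasGradientAt_comp_toEuclideanCLM {J : Matrix (Fin d) (Fin d) ℝ} (hJ : J.IsHermitian)
    {f : EuclideanSpace ℝ (Fin d) → ℝ} {θ w G : EuclideanSpace ℝ (Fin d)}
    (hf : HasGradientAt f G (θ + Matrix.toEuclideanCLM (𝕜 := ℝ) J w)) :
    HasGradientAt (fun w => f (θ + Matrix.toEuclideanCLM (𝕜 := ℝ) J w))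
      (Matrix.toEuclideanCLM (𝕜 := ℝ) J G) w := by
  rw [hasGradientAt_iff_hasFDerivAt]
  have h := hf.hasFDerivAt.comp w
    (((Matrix.toEuclideanCLM (𝕜 := ℝ) J).hasFDerivAt (x := w)).const_add θ)
  refine h.congr_fderiv ?_
  ext v
  simp [inner_toEuclideanCLM_comm hJ]

lemma hasFDerivAt_toEuclideanCLM_comp {J S : Matrix (Fin d) (Fin d) ℝ}
    {G : EuclideanSpace ℝ (Fin d) → EuclideanSpace ℝ (Fin d)} {θ w : EuclideanSpace ℝ (Fin d)}
    (hG : HasFDerivAt G (Matrix.toEuclideanCLM (𝕜 := ℝ) S)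
      (θ + Matrix.toEuclideanCLM (𝕜 := ℝ) J w)) :
    HasFDerivAt (fun w => Matrix.toEuclideanCLM (𝕜 := ℝ) J
      (G (θ + Matrix.toEuclideanCLM (𝕜 := ℝ) J w)))
      (Matrix.toEuclideanCLM (𝕜 := ℝ) (J * S * J)) w := by
  have h := (Matrix.toEuclideanCLM (𝕜 := ℝ) J).hasFDerivAt.comp w (hG.comp w
    (((Matrix.toEuclideanCLM (𝕜 := ℝ) J).hasFDerivAt (x := w)).const_add θ))
  refine h.congr_fderiv ?_
  rw [map_mul, map_mul]
  rfl

/-- Differentiability is required only on [0, 1): the endpoint of the segment may be a boundary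
point of Θ, where just continuity is known. -/
lemma le_half_mul_of_second_deriv_le {φ φ' φ'' : ℝ → ℝ} {M : ℝ} (hc : ContinuousOn φ (Set.Icc 0 1))
    (h1 : ∀ s ∈ Set.Ico (0 : ℝ) 1, HasDerivAt φ (φ' s) s)
    (h2 : ∀ s ∈ Set.Ico (0 : ℝ) 1, HasDerivAt φ' (φ'' s) s) (h0 : φ 0 = 0) (h0' : φ' 0 = 0)
    (hM : ∀ s ∈ Set.Ico (0 : ℝ) 1, φ'' s ≤ M) : φ 1 ≤ M / 2 := by
  have hd1 : ∀ s ∈ Set.Ico (0 : ℝ) 1, HasDerivAt (fun s => φ' s - M * s) (φ'' s - M) s :=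
    fun s hs => by simpa using (h2 s hs).fun_sub ((hasDerivAt_id s).const_mul M)
  have hd0 : ∀ s ∈ Set.Ico (0 : ℝ) 1,
      HasDerivAt (fun s => φ s - M / 2 * s ^ 2) (φ' s - M * s) s := fun s hs => by
    refine ((h1 s hs).sub ((hasDerivAt_pow 2 s).const_mul (M / 2))).congr_deriv ?_
    norm_num
    ring
  have ha1 : AntitoneOn (fun s => φ' s - M * s) (Set.Ico 0 1) := by
    refine antitoneOn_of_deriv_nonpos (convex_Ico 0 1)
      (fun s hs => (hd1 s hs).continuousAt.continuousWithinAt) ?_ ?_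
    · exact fun s hs => (hd1 s (interior_subset hs)).differentiableAt.differentiableWithinAt
    · intro s hs
      rw [(hd1 s (interior_subset hs)).deriv]
      exact sub_nonpos.2 (hM s (interior_subset hs))
  have ha0 : AntitoneOn (fun s => φ s - M / 2 * s ^ 2) (Set.Icc 0 1) := by
    have hsub : interior (Set.Icc (0 : ℝ) 1) ⊆ Set.Ico 0 1 := by
      rw [interior_Icc]; exact Set.Ioo_subset_Ico_self
    refine antitoneOn_of_deriv_nonpos (convex_Icc 0 1) (hc.sub (by fun_prop)) ?_ ?_
    · exact fun s hs => (hd0 s (hsub hs)).differentiableAt.differentiableWithinAt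
    · intro s hs
      rw [(hd0 s (hsub hs)).deriv]
      have h := ha1 (Set.left_mem_Ico.2 one_pos) (hsub hs) (hsub hs).1
      simpa [h0'] using h
  have h := ha0 (Set.left_mem_Icc.2 zero_le_one) (Set.right_mem_Icc.2 zero_le_one) zero_le_one
  simp only [h0] at h
  norm_num at h
  linarith

end Normalisation

/-! ### Reduction of a regular task to a normalised model. -/

namespace TaskSequence

variable {𝒳 𝒴 : Type*} [MeasurableSpace 𝒴] {d : ℕ} {T : TaskSequence 𝒳 𝒴 d}
  {H : 𝒳 → EuclideanSpace ℝ (Fin d) → Matrix (Fin d) (Fin d) ℝ}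
  {m Lb L₁ L₂ L₃ : ℝ} {B : ℕ → Set (EuclideanSpace ℝ (Fin d))} {t : ℕ}

lemma hasGradientAt_cumulant (hreg : T.Regular H m Lb L₁ L₂ L₃ B) (y₀ : 𝒴) (i : Fin (T.N t))
    {θ : EuclideanSpace ℝ (Fin d)} (hθ : θ ∈ interior T.Θ) :
    HasGradientAt (T.cumulant t y₀ i)
      (gradient (T.loss y₀ (T.pool t i)) θ - T.score t i y₀) θ := by
  have h1 := ((hreg.smooth (T.pool t i) y₀).1 θ hθ).hasGradientAt.hasFDerivAt
  have h2 := (innerSL ℝ (T.score t i y₀)).hasFDerivAt.comp θ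
    ((hasFDerivAt_id θ).sub_const (T.θstar t))
  have h3 := (h1.sub_const (T.loss y₀ (T.pool t i) (T.θstar t))).sub h2
  rw [hasGradientAt_iff_hasFDerivAt]
  refine h3.congr_fderiv ?_
  ext v
  simp

lemma hasFDerivAt_gradient_sub_score (hH : T.HessianEq H) (hreg : T.Regular H m Lb L₁ L₂ L₃ B)
    (y₀ : 𝒴) (i : Fin (T.N t)) {θ : EuclideanSpace ℝ (Fin d)} (hθ : θ ∈ interior T.Θ) :
    HasFDerivAt (fun θ => gradient (T.loss y₀ (T.pool t i)) θ - T.score t i y₀)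
      (Matrix.toEuclideanCLM (𝕜 := ℝ) (H (T.pool t i) θ)) θ := by
  have h := hasFDerivAt_gradient isOpen_interior (hreg.smooth (T.pool t i) y₀).1 hθ
    ((hreg.smooth (T.pool t i) y₀).2.1 θ hθ)
  rw [hH _ _ _ hθ] at h
  exact h.sub_const _

lemma hessian_isHermitian (hH : T.HessianEq H) (hreg : T.Regular H m Lb L₁ L₂ L₃ B) (y₀ : 𝒴)
    (x : 𝒳) {θ : EuclideanSpace ℝ (Fin d)} (hθ : θ ∈ interior T.Θ) : (H x θ).IsHermitian := by
  rw [← hH x y₀ θ hθ]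
  exact hessianMatrix_isHermitian isOpen_interior (hreg.smooth x y₀).1 hθ
    ((hreg.smooth x y₀).2.1 θ hθ)

lemma infoU_eq (H : 𝒳 → EuclideanSpace ℝ (Fin d) → Matrix (Fin d) (Fin d) ℝ) (t : ℕ)
    (θ : EuclideanSpace ℝ (Fin d)) :
    T.infoU H t θ = ∑ i, (1 / T.N t : ℝ) • H (T.pool t i) θ := rfl

lemma posDef_infoU (hreg : T.Regular H m Lb L₁ L₂ L₃ B) (ht : 1 ≤ t)
    {θ : EuclideanSpace ℝ (Fin d)} (hθ : θ ∈ interior T.Θ) : (T.infoU H t θ).PosDef :=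
  posDef_of_posSemidef_sub_smul_one hreg.m_pos (hreg.strongConvex t ht θ hθ)

lemma continuousOn_cumulant (hreg : T.Regular H m Lb L₁ L₂ L₃ B) (y₀ : 𝒴) (i : Fin (T.N t)) :
    ContinuousOn (T.cumulant t y₀ i) T.Θ := by
  unfold cumulant
  exact ((hreg.continuousOn _ y₀).sub continuousOn_const).sub (by fun_prop)

lemma cumulant_θstar (y₀ : 𝒴) (i : Fin (T.N t)) : T.cumulant t y₀ i (T.θstar t) = 0 := by
  simp [cumulant]

/-- Second-order Taylor bound along the segment from θ*, whose points before the endpoint are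
interior. Both ends are within ρ of the previous parameter, so the length is at most 2ρ and
L_b(2ρ)²/2 = 2 L_b ρ². -/
lemma average_cumulant_le (hd : 0 < d) (hH : T.HessianEq H) (hreg : T.Regular H m Lb L₁ L₂ L₃ B)
    (ht : 1 ≤ t) (hconv : Convex ℝ (T.paramSet t)) (hint : T.θstar t ∈ interior (T.paramSet t))
    (y₀ : 𝒴) {θ : EuclideanSpace ℝ (Fin d)} (hθ : θ ∈ T.paramSet t) :
    ∑ i, (1 / T.N t : ℝ) * T.cumulant t y₀ i θ ≤ 2 * Lb * T.ρ ^ 2 := by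
  set δ := θ - T.θstar t with hδ
  set z : ℝ → EuclideanSpace ℝ (Fin d) := fun s => T.θstar t + s • δ with hz
  have hzint : ∀ s ∈ Set.Ico (0 : ℝ) 1, z s ∈ interior T.Θ := by
    intro s hs
    apply interior_paramSet_subset
    have h := hconv.combo_interior_self_mem_interior hint hθ (sub_pos.2 hs.2) hs.1
      (sub_add_cancel 1 s)
    convert h using 1
    simp only [hz, hδ]
    module
  have hz1 : z 1 = θ := by simp [hz, hδ]
  have hzW : ∀ s ∈ Set.Icc (0 : ℝ) 1, z s ∈ T.Θ := by
    intro s hs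
    rcases hs.2.lt_or_eq with h | rfl
    · exact interior_subset (hzint s ⟨hs.1, h⟩)
    · rw [hz1]; exact paramSet_subset hθ
  have hzd : ∀ s, HasDerivAt z δ s := fun s =>
    (((hasDerivAt_id s).smul_const δ).const_add (T.θstar t)).congr_deriv (one_smul ℝ δ)
  have hLb : 0 ≤ Lb := by
    have hpd := posDef_infoU hreg ht (interior_paramSet_subset hint)
    exact (hpd.eigenvalues_pos ⟨0, hd⟩).le.trans (hreg.bounded t ht _
      (interior_paramSet_subset hint) _ (hpd.isHermitian.eigenvalues_mem_spectrum_real _))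
  have hδρ : ‖δ‖ ≤ 2 * T.ρ := by
    have h1 := hθ.2
    have h2 := (interior_subset hint).2
    have e : δ = (θ - T.θstar (t - 1)) - (T.θstar t - T.θstar (t - 1)) := by rw [hδ]; abel
    rw [e]
    exact (norm_sub_le _ _).trans (by linarith)
  have key := le_half_mul_of_second_deriv_le
    (φ := fun s => ∑ i, (1 / T.N t : ℝ) * T.cumulant t y₀ i (z s))
    (φ' := fun s => ∑ i, (1 / T.N t : ℝ) *
      inner ℝ (gradient (T.loss y₀ (T.pool t i)) (z s) - T.score t i y₀) δ)
    (φ'' := fun s => ∑ i, (1 / T.N t : ℝ) *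
      inner ℝ (Matrix.toEuclideanCLM (𝕜 := ℝ) (H (T.pool t i) (z s)) δ) δ)
    (M := Lb * ‖δ‖ ^ 2) ?_ ?_ ?_ ?_ ?_ ?_
  · simp only [hz1] at key
    refine key.trans ?_
    have h := pow_le_pow_left₀ (norm_nonneg δ) hδρ 2
    have h' := mul_le_mul_of_nonneg_left h hLb
    linarith
  · refine continuousOn_finsetSum _ fun i _ => continuousOn_const.mul ?_
    exact (continuousOn_cumulant hreg y₀ i).comp (by fun_prop) hzW
  · intro s hs
    refine HasDerivAt.fun_sum fun i _ => HasDerivAt.const_mul _ ?_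
    have h := (hasGradientAt_cumulant hreg y₀ i (hzint s hs)).hasFDerivAt.comp_hasDerivAt s (hzd s)
    exact h.congr_deriv (InnerProductSpace.toDual_apply_apply)
  · intro s hs
    refine HasDerivAt.fun_sum fun i _ => HasDerivAt.const_mul _ ?_
    have h := (hasFDerivAt_gradient_sub_score hH hreg y₀ i (hzint s hs)).comp_hasDerivAt s (hzd s)
    simpa using h.inner ℝ (hasDerivAt_const s δ)
  · simp [hz, cumulant_θstar]
  · simp [hz, score]
  · intro s hs
    have h := inner_toEuclideanCLM_le_of_spectrum_le
      (posDef_infoU hreg ht (hzint s hs)).isHermitian (hreg.bounded t ht _ (hzint s hs)) δ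
    refine le_of_eq_of_le ?_ h
    rw [infoU_eq]
    simp only [map_sum, map_smul, sum_apply, smul_apply, sum_inner, real_inner_smul_left]

/-- In the coordinates `θ = θ_t* + I_{U_t}(θ_t*)^{-1/2} v`, a regular task is a normalised model. -/
theorem normalizedModel (hd : 0 < d) (hH : T.HessianEq H) (hreg : T.Regular H m Lb L₁ L₂ L₃ B)
    (ht : 1 ≤ t) (hconv : Convex ℝ (T.paramSet t)) (hint : T.θstar t ∈ interior (T.paramSet t))
    (y₀ : 𝒴) {r : ℝ} (hr : 0 < r)
    (hball : {θ | weightedNorm (T.infoU H t (T.θstar t)) (θ - T.θstar t) < r} ⊆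
      B t ∩ T.paramSet t)
    {J : Matrix (Fin d) (Fin d) ℝ} (hJ : J = invSqrt (T.infoU H t (T.θstar t))) :
    NormalizedModel (fun i => T.labelLaw (T.pool t i) (T.θstar t))
      (fun i y => Matrix.toEuclideanCLM (𝕜 := ℝ) J (T.score t i y))
      (fun i => J * H (T.pool t i) (T.θstar t) * J)
      (fun i v => T.cumulant t y₀ i (T.θstar t + Matrix.toEuclideanCLM (𝕜 := ℝ) J v))
      (fun i v => Matrix.toEuclideanCLM (𝕜 := ℝ) J
        (gradient (T.loss y₀ (T.pool t i)) (T.θstar t + Matrix.toEuclideanCLM (𝕜 := ℝ) J v) -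
          T.score t i y₀))
      {v | T.θstar t + Matrix.toEuclideanCLM (𝕜 := ℝ) J v ∈ T.paramSet t}
      r (2 * Lb * T.ρ ^ 2) L₁ L₂ L₃ := by
  have hs := paramSet_subset (interior_subset hint)
  have : ∀ i, IsProbabilityMeasure (T.labelLaw (T.pool t i) (T.θstar t)) := fun i =>
    isProbabilityMeasure_labelLaw _ hs
  have hsi := interior_paramSet_subset hint
  have hA := posDef_infoU hreg ht hsi
  set A := T.infoU H t (T.θstar t) with hA_def
  have hJh : J.IsHermitian := hJ ▸ invSqrt_isHermitian hA
  have hwn : ∀ v, weightedNorm A (Matrix.toEuclideanCLM (𝕜 := ℝ) J v) = ‖v‖ := fun v => by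
    rw [hJ, weightedNorm_invSqrt_apply hA]
  have hmem : ∀ w ∈ Metric.ball (0 : EuclideanSpace ℝ (Fin d)) r,
      T.θstar t + Matrix.toEuclideanCLM (𝕜 := ℝ) J w ∈
        {θ | weightedNorm A (θ - T.θstar t) < r} := by
    intro w hw
    simpa [hwn] using hw
  have hmemint : ∀ w ∈ Metric.ball (0 : EuclideanSpace ℝ (Fin d)) r,
      T.θstar t + Matrix.toEuclideanCLM (𝕜 := ℝ) J w ∈ B t ∩ interior T.Θ := fun w hw =>
    ⟨(hball (hmem w hw)).1, interior_maximal
      ((hball.trans Set.inter_subset_right).trans paramSet_subset) (isOpen_weightedNorm_lt _ _ _)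
      (hmem w hw)⟩
  have hmem0 : T.θstar t ∈ B t ∩ interior T.Θ := ⟨mem_of_mem_nhds (hreg.nhds_mem t ht), hsi⟩
  have hsc : ∀ i, Measurable (T.score t i) := fun i => measurable_score hH hreg hconv hint y₀ i
  have hgm : ∀ i, Measurable fun y => Matrix.toEuclideanCLM (𝕜 := ℝ) J (T.score t i y) := fun i =>
    (Matrix.toEuclideanCLM (𝕜 := ℝ) J).measurable.comp (hsc i)
  have hgb : ∀ i, ∀ᵐ y ∂T.labelLaw (T.pool t i) (T.θstar t),
      ‖Matrix.toEuclideanCLM (𝕜 := ℝ) J (T.score t i y)‖ ≤ L₁ := by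
    intro i
    filter_upwards [hreg.gradient_le t ht i] with y hy
    rw [hJ, norm_invSqrt_apply hA]
    exact hy
  have hexp : ∀ i v, T.θstar t + Matrix.toEuclideanCLM (𝕜 := ℝ) J v ∈ T.paramSet t →
      ∫ y, Real.exp (-inner ℝ (Matrix.toEuclideanCLM (𝕜 := ℝ) J (T.score t i y)) v)
        ∂T.labelLaw (T.pool t i) (T.θstar t) =
      Real.exp (T.cumulant t y₀ i (T.θstar t + Matrix.toEuclideanCLM (𝕜 := ℝ) J v)) := by
    intro i v hv
    rw [← integral_exp_neg_score hH hreg hconv hint y₀ i hv]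
    simp only [add_sub_cancel_left, inner_toEuclideanCLM_comm hJh]
  have hgrad : ∀ i, ∀ w ∈ Metric.ball (0 : EuclideanSpace ℝ (Fin d)) r,
      HasGradientAt (fun v => T.cumulant t y₀ i (T.θstar t + Matrix.toEuclideanCLM (𝕜 := ℝ) J v))
        (Matrix.toEuclideanCLM (𝕜 := ℝ) J
          (gradient (T.loss y₀ (T.pool t i)) (T.θstar t + Matrix.toEuclideanCLM (𝕜 := ℝ) J w) -
            T.score t i y₀)) w := fun i w hw =>
    hasGradientAt_comp_toEuclideanCLM hJh (hasGradientAt_cumulant hreg y₀ i (hmemint w hw).2)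
  have hlip : ∀ i, ∀ w ∈ Metric.ball (0 : EuclideanSpace ℝ (Fin d)) r,
      ‖Matrix.toEuclideanCLM (𝕜 := ℝ)
          (J * H (T.pool t i) (T.θstar t + Matrix.toEuclideanCLM (𝕜 := ℝ) J w) * J) -
        Matrix.toEuclideanCLM (𝕜 := ℝ) (J * H (T.pool t i)
          (T.θstar t + Matrix.toEuclideanCLM (𝕜 := ℝ) J 0) * J)‖ ≤ L₃ * ‖w‖ := by
    intro i w hw
    have h := hreg.lipschitz t ht i _ (hmemint w hw) _ hmem0
    rw [← hA_def, ← hJ, add_sub_cancel_left, hwn, spectralNorm₂, mul_sub, sub_mul, map_sub] at h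
    rwa [map_zero, add_zero]
  -- Read off from the Lipschitz bound at one nonzero point of the ball, which exists because d > 0.
  have hL₃ : 0 ≤ L₃ := by
    have hw : EuclideanSpace.single (⟨0, hd⟩ : Fin d) (r / 2) ∈
        Metric.ball (0 : EuclideanSpace ℝ (Fin d)) r := by
      rw [mem_ball_zero_iff, PiLp.norm_single, Real.norm_of_nonneg (by positivity)]
      linarith
    have h := (norm_nonneg _).trans (hlip ⟨0, T.N_pos t ht⟩ _ hw)
    rw [PiLp.norm_single, Real.norm_of_nonneg (by positivity)] at h
    exact nonneg_of_mul_nonneg_left h (by positivity)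
  have hherm : ∀ i, (J * H (T.pool t i) (T.θstar t) * J).IsHermitian := by
    intro i
    have h := Matrix.isHermitian_conjTranspose_mul_mul J
      (hessian_isHermitian hH hreg y₀ (T.pool t i) hsi)
    rwa [hJh.eq] at h
  have hder : ∀ i, ∀ w ∈ Metric.ball (0 : EuclideanSpace ℝ (Fin d)) r,
      HasFDerivAt (fun w => Matrix.toEuclideanCLM (𝕜 := ℝ) J
        (gradient (T.loss y₀ (T.pool t i)) (T.θstar t + Matrix.toEuclideanCLM (𝕜 := ℝ) J w) -
          T.score t i y₀))
        (Matrix.toEuclideanCLM (𝕜 := ℝ)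
          (J * H (T.pool t i) (T.θstar t + Matrix.toEuclideanCLM (𝕜 := ℝ) J w) * J)) w :=
    fun i w hw => hasFDerivAt_toEuclideanCLM_comp
      (G := fun θ => gradient (T.loss y₀ (T.pool t i)) θ - T.score t i y₀)
      (hasFDerivAt_gradient_sub_score hH hreg y₀ i (hmemint w hw).2)
  have hgsub : ∀ i, ∀ w ∈ Metric.ball (0 : EuclideanSpace ℝ (Fin d)) r,
      ‖Matrix.toEuclideanCLM (𝕜 := ℝ) J
          (gradient (T.loss y₀ (T.pool t i)) (T.θstar t + Matrix.toEuclideanCLM (𝕜 := ℝ) J w) -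
            T.score t i y₀) -
        Matrix.toEuclideanCLM (𝕜 := ℝ) (J * H (T.pool t i) (T.θstar t) * J) w‖ ≤
      L₃ * ‖w‖ ^ 2 := by
    intro i w hw
    have h := norm_sub_le_of_hasFDerivAt_ball hL₃
      (G := fun w => Matrix.toEuclideanCLM (𝕜 := ℝ) J
        (gradient (T.loss y₀ (T.pool t i)) (T.θstar t + Matrix.toEuclideanCLM (𝕜 := ℝ) J w) -
          T.score t i y₀))
      (G' := fun w => Matrix.toEuclideanCLM (𝕜 := ℝ)
        (J * H (T.pool t i) (T.θstar t + Matrix.toEuclideanCLM (𝕜 := ℝ) J w) * J))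
      (by rw [map_zero, add_zero, score, sub_self, map_zero]) (hder i) (hlip i) hw
    rwa [map_zero, add_zero] at h
  have hmom := fun i => score_moments hr (hgm i) (hgb i)
    (fun w hw => hexp i w (hball (hmem w hw)).2) (hgrad i) (hgsub i)
  exact
  { measurable := hgm
    norm_le := hgb
    mean := fun i => (hmom i).1
    second_moment := fun i => (hmom i).2
    hermitian := hherm
    le_smul_one := fun i => posSemidef_smul_one_sub_of_spectralNorm₂_le (hherm i)
      (hJ ▸ hreg.hessian_le t ht i)
    average := by
      have h := invSqrt_mul_self_mul hA
      rw [← hJ, hA_def, infoU_eq, Finset.mul_sum, Finset.sum_mul] at h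
      simpa only [mul_smul_comm, smul_mul_assoc] using h
    r_pos := hr
    lip_nonneg := hL₃
    ball_subset := fun w hw => (hball (hmem w hw)).2
    zero := fun i => by rw [map_zero, add_zero, cumulant_θstar]
    hasGradientAt := hgrad
    gradient_sub_le := hgsub
    abs_sub_le := fun i w hw => abs_sub_le_of_hasGradientAt_ball hL₃
      (by rw [map_zero, add_zero, cumulant_θstar]) (inner_toEuclideanCLM_comm (hherm i)) (hgrad i)
      (hgsub i) hw
    map_smul_le := fun i w hw τ hτ => by
      refine cumulant_smul_le (F := fun v => T.cumulant t y₀ i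
        (T.θstar t + Matrix.toEuclideanCLM (𝕜 := ℝ) J v)) hτ (hexp i w hw) (hexp i _ ?_)
      have h := hconv.add_smul_sub_mem (interior_subset hint) hw hτ
      rwa [add_sub_cancel_left, ← map_smul] at h
    nonneg := fun i w hw => by
      exact cumulant_nonneg (F := fun v => T.cumulant t y₀ i
        (T.θstar t + Matrix.toEuclideanCLM (𝕜 := ℝ) J v))
        (Integrable.of_bound (hgm i).aestronglyMeasurable L₁ (hgb i)) (hmom i).1 (hexp i w hw)
    average_le := fun w hw => average_cumulant_le hd hH hreg ht hconv hint y₀ hw }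

lemma inner_score_add_cumulant_le_of_isMinOn (hH : T.HessianEq H)
    (hreg : T.Regular H m Lb L₁ L₂ L₃ B) (hconv : Convex ℝ (T.paramSet t))
    (hint : T.θstar t ∈ interior (T.paramSet t)) (y₀ : 𝒴) {K : ℕ} (hK : 0 < K)
    {z : Fin K → Fin (T.N t) × 𝒴} {θ η : EuclideanSpace ℝ (Fin d)} (hθ : θ ∈ T.paramSet t)
    (hmin : IsMinOn (T.empRisk t z) (T.paramSet t) θ) (hη : η ∈ T.paramSet t) :
    ∑ k, (inner ℝ (T.score t (z k).1 (z k).2) (θ - T.θstar t) + T.cumulant t y₀ (z k).1 θ) ≤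
      ∑ k, (inner ℝ (T.score t (z k).1 (z k).2) (η - T.θstar t) + T.cumulant t y₀ (z k).1 η) := by
  have hK' : (0 : ℝ) < 1 / K := by positivity
  have h := le_of_mul_le_mul_left (hmin hη) hK'
  have e : ∀ η ∈ T.paramSet t, ∑ k, T.loss (z k).2 (T.pool t (z k).1) η =
      ∑ k, T.loss (z k).2 (T.pool t (z k).1) (T.θstar t) +
      ∑ k, (inner ℝ (T.score t (z k).1 (z k).2) (η - T.θstar t) +
        T.cumulant t y₀ (z k).1 η) := by
    intro η hη
    rw [← Finset.sum_add_distrib]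
    refine Finset.sum_congr rfl fun k _ => ?_
    rw [loss_eq_add_cumulant hH hreg hconv hint y₀ _ _ hη, add_assoc]
  rw [e θ hθ, e η hη] at h
  exact le_of_add_le_add_left h

/-- The cumulants are continuous only on Θ and the estimator lies in `Θ_t` only almost surely, so
they are extended by 0 off this compact set. -/
lemma aestronglyMeasurable_average_cumulant (hreg : T.Regular H m Lb L₁ L₂ L₃ B) (y₀ : 𝒴)
    {Ω : Type*} [MeasurableSpace Ω] {P : Measure Ω} {θhat : Ω → EuclideanSpace ℝ (Fin d)}
    (hm : AEMeasurable θhat P) (hmem : ∀ᵐ ω ∂P, θhat ω ∈ T.paramSet t) :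
    AEStronglyMeasurable (fun ω => ∑ i, (1 / T.N t : ℝ) * T.cumulant t y₀ i (θhat ω)) P := by
  classical
  have hc : ContinuousOn (fun θ => ∑ i, (1 / T.N t : ℝ) * T.cumulant t y₀ i θ) (T.paramSet t) :=
    continuousOn_finsetSum _ fun i _ => continuousOn_const.mul
      ((continuousOn_cumulant hreg y₀ i).mono paramSet_subset)
  have h := (hc.measurable_piecewise (g := fun _ => 0) continuousOn_const
    (isCompact_paramSet hreg).measurableSet).comp_aemeasurable hm
  refine AEMeasurable.aestronglyMeasurable (h.congr ?_)
  filter_upwards [hmem] with ω hω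
  exact Set.piecewise_eq_of_mem _ _ _ hω

theorem excess_risk_bounds (hd : 0 < d) (hH : T.HessianEq H) (hreg : T.Regular H m Lb L₁ L₂ L₃ B)
    (ht : 1 ≤ t) (hconv : Convex ℝ (T.paramSet t)) {r : ℝ} (hr : 0 < r)
    (hball : {θ | weightedNorm (T.infoU H t (T.θstar t)) (θ - T.θstar t) < r} ⊆
      B t ∩ T.paramSet t)
    {Γ : Fin (T.N t) → ℝ} (hΓ : Γ ∈ stdSimplex ℝ (Fin (T.N t))) {C : ℝ} (hC : 0 < C) (hC1 : C < 1)
    (hinfo : (T.info H t Γ (T.θstar t) - C • T.infoU H t (T.θstar t)).PosSemidef)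
    {K : ℕ} (hK : 0 < K) (h1 : L₁ * √(Real.log (d * K) / K) ≤ 1 / 100 * C * r)
    (h2 : gammaRate 10000 C L₁ L₂ L₃ d K < 1)
    {Ω : Type*} [MeasurableSpace Ω] {P : Measure Ω} [IsProbabilityMeasure P]
    {Z : Fin K → Ω → Fin (T.N t) × 𝒴} (hZ : IsIIDSample P (T.dataLaw t Γ) Z)
    {θhat : Ω → EuclideanSpace ℝ (Fin d)} (hθm : AEMeasurable θhat P)
    (hθ : ∀ᵐ ω ∂P, θhat ω ∈ T.paramSet t ∧
      IsMinOn (T.empRisk t fun k => Z k ω) (T.paramSet t) (θhat ω)) :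
    Integrable (fun ω => T.risk t (θhat ω) - T.risk t (T.θstar t)) P ∧
    (1 - gammaRate 10000 C L₁ L₂ L₃ d K) * (tauSq T H t Γ / K) - L₁ ^ 2 / (C * K ^ 2) ≤
      ∫ ω, (T.risk t (θhat ω) - T.risk t (T.θstar t)) ∂P ∧
    ∫ ω, (T.risk t (θhat ω) - T.risk t (T.θstar t)) ∂P ≤
      (1 + gammaRate 10000 C L₁ L₂ L₃ d K) * (tauSq T H t Γ / K) +
        2 * Lb * T.ρ ^ 2 / K ^ 2 := by
  have hint : T.θstar t ∈ interior (T.paramSet t) :=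
    interior_maximal (hball.trans Set.inter_subset_right) (isOpen_weightedNorm_lt _ _ _)
      (by simpa [weightedNorm] using hr)
  have hs := paramSet_subset (interior_subset hint)
  have hA := posDef_infoU hreg ht (interior_paramSet_subset hint)
  have : ∀ i, IsProbabilityMeasure (T.labelLaw (T.pool t i) (T.θstar t)) := fun i =>
    isProbabilityMeasure_labelLaw _ hs
  obtain ⟨y₀⟩ : Nonempty 𝒴 := nonempty_of_isProbabilityMeasure
    (T.labelLaw (T.pool t ⟨0, T.N_pos t ht⟩) (T.θstar t))
  set A := T.infoU H t (T.θstar t) with hA_def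
  set J := invSqrt A with hJ
  have hJh : J.IsHermitian := invSqrt_isHermitian hA
  have M := normalizedModel hd hH hreg ht hconv hint y₀ hr hball hJ
  -- A·J inverts J, so integrability and centring pass from the normalised score back to the
  -- original one.
  have hback : ∀ i, T.score t i = fun y => Matrix.toEuclideanCLM (𝕜 := ℝ) (A * J)
      (Matrix.toEuclideanCLM (𝕜 := ℝ) J (T.score t i y)) := by
    intro i
    ext1 y
    rw [toEuclideanCLM_mul_apply, self_mul_invSqrt_mul_invSqrt hA, map_one]
    rfl
  have hgi : ∀ i, Integrable (fun y => Matrix.toEuclideanCLM (𝕜 := ℝ) J (T.score t i y))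
      (T.labelLaw (T.pool t i) (T.θstar t)) := fun i =>
    Integrable.of_bound (M.measurable i).aestronglyMeasurable L₁ (M.norm_le i)
  have hsci : ∀ i, Integrable (T.score t i) (T.labelLaw (T.pool t i) (T.θstar t)) := fun i => by
    rw [hback]
    exact ContinuousLinearMap.integrable_comp _ (hgi i)
  have hsc0 : ∀ i, ∫ y, T.score t i y ∂T.labelLaw (T.pool t i) (T.θstar t) = 0 := fun i => by
    rw [hback, ContinuousLinearMap.integral_comp_comm _ (hgi i)]
    exact (congrArg _ (M.mean i)).trans (map_zero _)
  set v : Ω → EuclideanSpace ℝ (Fin d) := fun ω =>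
    Matrix.toEuclideanCLM (𝕜 := ℝ) (A * J) (θhat ω - T.θstar t) with hv
  have hJv : ∀ ω, T.θstar t + Matrix.toEuclideanCLM (𝕜 := ℝ) J (v ω) = θhat ω := fun ω => by
    rw [hv, hJ, invSqrt_mul_self_mul_invSqrt_apply hA, add_sub_cancel]
  have hZm : Measurable fun ω k => Z k ω := measurable_pi_lambda _ hZ.1
  have hlaw : P.map (fun ω k => Z k ω) = Measure.pi (fun _ : Fin K =>
      ∑ i, ENNReal.ofReal (Γ i) •
        (T.labelLaw (T.pool t i) (T.θstar t)).map (Prod.mk i)) := by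
    rw [(iIndepFun_iff_map_fun_eq_pi_map fun k => (hZ.1 k).aemeasurable).1 hZ.2.2]
    simp only [hZ.2.1]
    rfl
  have hG : ∑ i, Γ i • (J * H (T.pool t i) (T.θstar t) * J) =
      J * T.info H t Γ (T.θstar t) * J := by
    simp only [info, fisherInfo, Finset.mul_sum, Finset.sum_mul, mul_smul_comm, smul_mul_assoc]
  have hGC : (J * T.info H t Γ (T.θstar t) * J -
      C • (1 : Matrix (Fin d) (Fin d) ℝ)).PosSemidef := by
    have h := hinfo.conjTranspose_mul_mul_same J
    rwa [hJh.eq, mul_sub, sub_mul, mul_smul_comm, smul_mul_assoc, hJ, invSqrt_mul_self_mul hA,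
      ← hJ] at h
  have hmeas := aestronglyMeasurable_average_cumulant hreg y₀ hθm (hθ.mono fun ω h => h.1)
  have hres := M.excess_bounds hd hK hΓ.1 hΓ.2 hC hC1 hG hGC h1 h2 hZm hlaw (v := v)
    (by simpa only [hJv] using hmeas) (by
      filter_upwards [hθ] with ω hω
      refine ⟨by simpa only [Set.mem_ofPred_eq, hJv] using hω.1, fun w hw => ?_⟩
      have h := inner_score_add_cumulant_le_of_isMinOn hH hreg hconv hint y₀ hK hω.1 hω.2 hw
      have e : θhat ω - T.θstar t = Matrix.toEuclideanCLM (𝕜 := ℝ) J (v ω) := by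
        rw [← hJv ω, add_sub_cancel_left]
      simp only [add_sub_cancel_left, e, ← inner_toEuclideanCLM_comm hJh] at h
      simpa only [hJv] using h)
  have hrisk : (fun ω => T.risk t (θhat ω) - T.risk t (T.θstar t)) =ᵐ[P]
      fun ω => ∑ i, (1 / T.N t : ℝ) *
        T.cumulant t y₀ i (T.θstar t + Matrix.toEuclideanCLM (𝕜 := ℝ) J (v ω)) := by
    filter_upwards [hθ] with ω hω
    simp only [hJv]
    exact risk_sub_eq hH hreg ht hconv hint y₀ hsci hsc0 hω.1
  have htau : 1 / 2 * (J * T.info H t Γ (T.θstar t) * J)⁻¹.trace = tauSq T H t Γ := by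
    rw [hJ, trace_inv_invSqrt_mul_mul_invSqrt hA]
    rfl
  rw [htau] at hres
  rw [integrable_congr hrisk, integral_congr_ae hrisk]
  exact hres

end TaskSequence

theorem lemma1 :
    ∃ c c' : ℝ, 0 < c ∧ 0 < c' ∧
      ∀ (𝒳 𝒴 : Type*) [MeasurableSpace 𝒴] (d : ℕ) (_ : 0 < d) (T : TaskSequence 𝒳 𝒴 d)
        (H : 𝒳 → EuclideanSpace ℝ (Fin d) → Matrix (Fin d) (Fin d) ℝ) (_ : T.HessianEq H)
        (m Lb L₁ L₂ L₃ : ℝ) (B : ℕ → Set (EuclideanSpace ℝ (Fin d)))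
        (_ : T.Regular H m Lb L₁ L₂ L₃ B)
        (t : ℕ) (_ : 2 ≤ t) (_ : Convex ℝ (T.paramSet t))
        (r : ℝ) (_ : 0 < r)
        (_ : {θ | weightedNorm (T.infoU H t (T.θstar t)) (θ - T.θstar t) < r} ⊆
          B t ∩ T.paramSet t)
        (Γ : Fin (T.N t) → ℝ) (_ : Γ ∈ stdSimplex ℝ (Fin (T.N t)))
        (C : ℝ) (_ : 0 < C) (_ : C < 1)
        (_ : (T.info H t Γ (T.θstar t) - C • T.infoU H t (T.θstar t)).PosSemidef)
        (K : ℕ) (_ : 0 < K)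
        (_ : L₁ * √(Real.log (d * K) / K) ≤ c' * C * r)
        (_ : gammaRate c C L₁ L₂ L₃ d K < 1)
        (Ω : Type*) [MeasurableSpace Ω] (P : Measure Ω) [IsProbabilityMeasure P]
        (Z : Fin K → Ω → Fin (T.N t) × 𝒴) (_ : IsIIDSample P (T.dataLaw t Γ) Z)
        (θhat : Ω → EuclideanSpace ℝ (Fin d)) (_ : AEMeasurable θhat P)
        (_ : ∀ᵐ ω ∂P, θhat ω ∈ T.paramSet t ∧
          IsMinOn (T.empRisk t fun k => Z k ω) (T.paramSet t) (θhat ω)),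
        Integrable (fun ω => T.risk t (θhat ω) - T.risk t (T.θstar t)) P ∧
        (1 - gammaRate c C L₁ L₂ L₃ d K) * (tauSq T H t Γ / K) - L₁ ^ 2 / (C * K ^ 2) ≤
          ∫ ω, (T.risk t (θhat ω) - T.risk t (T.θstar t)) ∂P ∧
        ∫ ω, (T.risk t (θhat ω) - T.risk t (T.θstar t)) ∂P ≤
          (1 + gammaRate c C L₁ L₂ L₃ d K) * (tauSq T H t Γ / K) +
            2 * Lb * T.ρ ^ 2 / K ^ 2 := by
  -- 1/100 makes the localisation radius 64L₁q/C smaller than r, where q = √(log(dK)/K). 10000 lets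
  -- the rate dominate 8η = 1024·L₁L₃q/C² and the Chernoff loss ε ≤ 3√L₂·q/C², with ample room.
  refine ⟨10000, 1 / 100, by norm_num, by norm_num, ?_⟩
  intro 𝒳 𝒴 _ d hd T H hH m Lb L₁ L₂ L₃ B hreg t ht hconv r hr hball Γ hΓ C hC hC1 hinfo K hK h1 h2 Ω
    _ P _ Z hZ θhat hθm hθ
  exact TaskSequence.excess_risk_bounds hd hH hreg (one_le_two.trans ht) hconv hr hball hΓ hC hC1
    hinfo hK h1 h2 hZ hθm hθ
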